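/- **Setting.** Fix $T$ and consider, for each $n$, a panel of $n$ units with assignment paths $\mathbf W_i\in\{0,1\}^T$ and potential outcomes $\mathbf Y_i(0),\mathbf Y_i(1)\in\mathbb R^T$. All (observed and unobserved) confounders $(\mathbf X_i,\mathbf U_i)$ are held fixed: $\mathbb P$ and $\mathbb E$ (which may change with $n$) denote probability and expectation conditional on them, so that i.i.d. units become independent, not necessarily identically distributed, units $\mathcal Z_i=(\mathbf Y_i(1),\mathbf Y_i(0),\mathbf W_i)$. Observed outcomes are $Y^{\rm obs}_{it}=Y_{it}(1)W_{it}+Y_{it}(0)(1-W_{it})$. Let $\pi_i(\mathbf w)=\mathbb P[\mathbf W_i=\mathbf w]$, $\tau_{it}=\mathbb E[Y_{it}(1)-Y_{it}(0)]$, $\boldsymbol\tau_i=(\tau_{it})_t$, and let $m_{it}$ be the doubly centered version (over $i\in[n]$ and $t\in[T]$) of $\mathbb E[Y_{it}(0)]$. For fixed weights $\xi_t\ge0$ with $\sum_t\xi_t=1$ the estimand is $\tau^*=\tau^*(\xi)=\sum_t\xi_t\frac1n\sum_i\tau_{it}$. Let $\mathbb S^*\subset\{0,1\}^T$ be fixed,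 with at least two elements and at least one element other than $\mathbf 0_T,\mathbf 1_T$. Let $\boldsymbol\Pi$ be a fixed probability mass function with support $\mathbb S^*$ that solves the DATE equation $$\mathbb E_{\mathbf W\sim\boldsymbol\Pi}\big[(\mathrm{diag}(\mathbf W)-\xi\mathbf W^\top)J(\mathbf W-\mathbb E_{\boldsymbol\Pi}[\mathbf W])\big]=0,\qquad J=I_T-\mathbf 1_T\mathbf 1_T^\top/T .$$ Given estimates $\hat\pi_i$ of $\pi_i$ and $\hat{\mathbf m}_i$ of $\mathbf m_i$, the RIPW estimator $\hat\tau=\hat\tau(\boldsymbol\Pi)$ is the $\tau$-coordinate of a minimizer, over $\tau,\mu,\alpha,\gamma$ with $\sum_i\alpha_i=\sum_t\gamma_t=0$, of $$\sum_{i=1}^n\sum_{t=1}^T\big(Y^{\rm obs}_{it}-\hat m_{it}-\mu-\alpha_i-\gamma_t-W_{it}\tau\big)^2\,\Theta_i,\qquad \Theta_i=\boldsymbol\Pi(\mathbf W_i)/\hat\pi_i(\mathbf W_i).$$ Put $\tilde{\mathbf Y}_i=\mathbf Y_i^{\rm obs}-\hat{\mathbf m}_i$, $\Gamma_\theta=\frac1n\sum\Theta_i$,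 $\Gamma_{ww}=\frac1n\sum\Theta_i\mathbf W_i^\top J\mathbf W_i$, $\Gamma_{wy}=\frac1n\sum\Theta_i\mathbf W_i^\top J\tilde{\mathbf Y}_i$, $\mathbf\Gamma_w=\frac1n\sum\Theta_iJ\mathbf W_i$, $\mathbf\Gamma_y=\frac1n\sum\Theta_iJ\tilde{\mathbf Y}_i$, $\mathcal D=\Gamma_{ww}\Gamma_\theta-\mathbf\Gamma_w^\top\mathbf\Gamma_w$, and $$\mathcal V_i=\Theta_i\Big\{\mathbb E[\Gamma_{wy}]-\tau^*\mathbb E[\Gamma_{ww}]-(\mathbb E[\mathbf\Gamma_y]-\tau^*\mathbb E[\mathbf\Gamma_w])^\top J\mathbf W_i+\mathbb E[\Gamma_\theta]\mathbf W_i^\top J(\tilde{\mathbf Y}_i-\tau^*\mathbf W_i)-\mathbb E[\mathbf\Gamma_w]^\top J(\tilde{\mathbf Y}_i-\tau^*\mathbf W_i)\Big\}.$$ Let $\hat{\mathcal V}_i$ be $\mathcal V_i$ with each $\mathbb E[\Gamma_\cdot]$ replaced by $\Gamma_\cdot$ and $\tau^*$ by $\hat\tau$, let $\hat\sigma^2=\frac1{n-1}\sum_i(\hat{\mathcal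 V}_i-\frac1n\sum_j\hat{\mathcal V}_j)^2$, and let $\hat C_{1-\alpha}=\big[\hat\tau\pm z_{1-\alpha/2}\,\hat\sigma/(\sqrt n\,\mathcal D)\big]$, with $z_\eta$ the standard normal $\eta$-quantile. Finally $$\delta_{\pi i}=\sqrt{\mathbb E[(\hat\pi_i(\mathbf W_i)-\pi_i(\mathbf W_i))^2]},\qquad \delta_{yi}=\sqrt{\mathbb E\|\hat{\mathbf m}_i-\mathbf m_i\|_2^2}+\|\boldsymbol\tau_i-\tau^*\mathbf 1_T\|_2,$$ $$\bar\delta_\pi=\sqrt{\tfrac1n\textstyle\sum_i\delta_{\pi i}^2},\qquad \bar\delta_y=\sqrt{\tfrac1n\textstyle\sum_i\delta_{yi}^2}.$$ **Theorem.** Suppose that: * (cross-fitting) $[n]$ is split into $K=O(1)$ folds of sizes $\lfloor n/K\rfloor$ or $\lceil n/K\rceil$, and for $i$ in fold $\mathcal I_k$ the pair $(\hat\pi_i,\hat{\mathbf m}_i)$ is a measurable function of $\{\mathcal Z_j:j\notin\mathcal I_k\}$; * (latent mean ignorability) $\mathbb E[(\mathbf Y_i(1),\mathbf Y_i(0))\mid\mathbf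 W_i]=\mathbb E[(\mathbf Y_i(1),\mathbf Y_i(0))]$; * (overlap) $\pi_i,\hat\pi_i$ take values in $[0,1]$ and there is a constant $c>0$, independent of $i$ and $n$, with $\hat\pi_i(\mathbf w)>c$ and $\pi_i(\mathbf w)>c$ for all $\mathbf w\in\mathbb S^*$, almost surely; * (independence) the units $\mathcal Z_1,\dots,\mathcal Z_n$ are independent; * (boundedness) there is $M<\infty$, independent of $n$, with $|Y_{it}(w)-\hat m_{it}|<M$ for all $i,t,w$, almost surely; * (asymptotically deterministic estimates) there are deterministic functions $\pi'_i$ and vectors $\mathbf m'_i$ which satisfy the overlap and boundedness conditions in place of $\hat\pi_i$ and $\hat{\mathbf m}_i$ (with constants independent of $i$ and $n$), such that for some $r>0$ $$\frac1n\sum_{i=1}^n\Big\{\mathbb E[(\hat\pi_i(\mathbf W_i)-\pi'_i(\mathbf W_i))^2]+\mathbb E\|\hat{\mathbf m}_i-\mathbf m'_i\|_2^2\Big\}=O(n^{-r}),$$ and, for each $n$, either $\pi'_i=\pi_i$ for all $i$ or $\mathbf m'_i=\mathbf m_i$ for all $i$. Then: 1. If $\bar\delta_\pi\bar\delta_y=o(1)$,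 then $\hat\tau(\boldsymbol\Pi)-\tau^*(\xi)\to0$ in probability. 2. If $\bar\delta_\pi\bar\delta_y=o(1/\sqrt n)$, $r>1/2$, and there is $\nu_0>0$ such that, for all large $n$, $\frac1n\sum_{i=1}^n\mathrm{Var}(\mathcal V_i)\ge\nu_0$ when $(\pi'_i,\mathbf m'_i)$ replaces $(\hat\pi_i,\hat{\mathbf m}_i)$ in the definition of $\mathcal V_i$, then for every $\alpha\in(0,1)$ $$\liminf_{n\to\infty}\mathbb P\big(\tau^*(\xi)\in\hat C_{1-\alpha}\big)\ge1-\alpha .$$ -/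

import Mathlib

open MeasureTheory ProbabilityTheory Filter Topology Asymptotics

namespace RIPW

noncomputable section

/-- Assignment paths, i.e. elements of `{0, 1}^T`. -/
abbrev Path (T : ℕ) : Type := Fin T → Bool

/-- An assignment path as a real vector. -/
def Path.vec {T : ℕ} (w : Path T) : Fin T → ℝ := fun t => if w t then 1 else 0

/-- The Euclidean norm of a vector indexed by time. -/
def l2 {T : ℕ} (v : Fin T → ℝ) : ℝ := Real.sqrt (∑ t, v t ^ 2)

/-- The centering map `v ↦ J v`, where `J = I - 1 1ᵀ / T`. -/
def center {T : ℕ} (v : Fin T → ℝ) : Fin T → ℝ := fun t => v t - (∑ s, v s) / T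

/-- The Euclidean inner product `uᵀ v`. -/
def dot {T : ℕ} (u v : Fin T → ℝ) : ℝ := ∑ t, u t * v t

/-! ### Estimand weights, reshaped distribution, DATE equation -/

/-- Deterministic time weights: nonnegative with total mass one. -/
def IsTimeWeight {T : ℕ} (ξ : Fin T → ℝ) : Prop := (∀ t, 0 ≤ ξ t) ∧ ∑ t, ξ t = 1

/-- The requirement on the overlap set: at least two paths, at least one of which is neither
the all-zero nor the all-one path. -/
def IsOverlapSet {T : ℕ} (S : Finset (Path T)) : Prop :=
  2 ≤ S.card ∧ ∃ w ∈ S, w ≠ (fun _ => false) ∧ w ≠ (fun _ => true)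

/-- `Q` is a probability mass function on `{0, 1}^T` with support `S`. -/
def IsReshaped {T : ℕ} (S : Finset (Path T)) (Q : Path T → ℝ) : Prop :=
  (∀ w ∈ S, 0 < Q w) ∧ (∀ w ∉ S, Q w = 0) ∧ ∑ w, Q w = 1

/-- The mean path `E_{W ∼ Q}[W]`. -/
def meanPath {T : ℕ} (Q : Path T → ℝ) : Fin T → ℝ := fun t => ∑ w, Q w * w.vec t

/-- The DATE equation `E_{W ∼ Q}[(diag(W) - ξ Wᵀ) J (W - E_{W ∼ Q}[W])] = 0`. -/
def DATEEquation {T : ℕ} (Q : Path T → ℝ) (ξ : Fin T → ℝ) : Prop :=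
  ∀ t, ∑ w, Q w *
    (w.vec t * center (w.vec - meanPath Q) t
      - ξ t * dot w.vec (center (w.vec - meanPath Q))) = 0

/-! ### Panels -/

/-- A panel of `n` units over `T` periods, as random quantities on `Ω`: the potential outcomes
`Y a i ω t` (`a = true` is treatment, `a = false` is control) and the assignment paths. -/
structure Panel (n T : ℕ) (Ω : Type*) where
  Y : Bool → Fin n → Ω → Fin T → ℝ
  W : Fin n → Ω → Path T

/-- A family of (possibly data-dependent) propensity functions, one for each unit. -/
abbrev PropEst (n T : ℕ) (Ω : Type*) : Type _ := Fin n → Ω → Path T → ℝ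

/-- A family of (possibly data-dependent) vectors of outcome adjustments, one for each unit. -/
abbrev OutEst (n T : ℕ) (Ω : Type*) : Type _ := Fin n → Ω → Fin T → ℝ

namespace Panel

variable {n T : ℕ} {Ω : Type*}

/-- All the data of unit `i`: both potential outcome vectors and the assignment path. -/
def unit (D : Panel n T Ω) (i : Fin n) (ω : Ω) : (Bool → Fin T → ℝ) × Path T :=
  (fun a => D.Y a i ω, D.W i ω)

/-- The observed outcomes: `Y_it(1)` if `W_it = 1`, and `Y_it(0)` if `W_it = 0`. -/
def Yobs (D : Panel n T Ω) (i : Fin n) (ω : Ω) (t : Fin T) : ℝ := D.Y (D.W i ω t) i ω t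

/-! #### Population quantities -/

section Population

variable [MeasurableSpace Ω] (P : Measure Ω)

/-- The generalized propensity score `π_i(w) = P(W_i = w)`. -/
def prop (D : Panel n T Ω) (i : Fin n) (w : Path T) : ℝ := P.real {ω | D.W i ω = w}

/-- `τ_it = E[Y_it(1) - Y_it(0)]`. -/
def tau (D : Panel n T Ω) (i : Fin n) (t : Fin T) : ℝ :=
  ∫ ω, (D.Y true i ω t - D.Y false i ω t) ∂P

/-- The doubly averaged treatment effect `τ*(ξ) = ∑_t ξ_t (1/n) ∑_i τ_it`. -/
def date (D : Panel n T Ω) (ξ : Fin T → ℝ) : ℝ :=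
  ∑ t, ξ t * ((∑ i, D.tau P i t) / n)

/-- `E[Y_it(0)]`. -/
def meanY0 (D : Panel n T Ω) (i : Fin n) (t : Fin T) : ℝ := ∫ ω, D.Y false i ω t ∂P

/-- `m_it`, the doubly centered version of `E[Y_it(0)]`. -/
def m (D : Panel n T Ω) (i : Fin n) (t : Fin T) : ℝ :=
  D.meanY0 P i t - (∑ j, D.meanY0 P j t) / n - (∑ s, D.meanY0 P i s) / T
    + (∑ j, ∑ s, D.meanY0 P j s) / (n * T)

/-- Latent mean ignorability: `E[Y_i(a) | W_i] = E[Y_i(a)]` for every unit and both arms. -/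
def LatentMeanIgnorable (D : Panel n T Ω) : Prop :=
  ∀ (a : Bool) (i : Fin n) (t : Fin T),
    P[(fun ω => D.Y a i ω t) | MeasurableSpace.comap (D.W i) inferInstance]
      =ᵐ[P] fun _ => ∫ ω, D.Y a i ω t ∂P

/-- `δ_πi = √E[(π̂_i(W_i) - π_i(W_i))²]`. -/
def deltaProp (D : Panel n T Ω) (πh : PropEst n T Ω) (i : Fin n) : ℝ :=
  Real.sqrt (∫ ω, (πh i ω (D.W i ω) - D.prop P i (D.W i ω)) ^ 2 ∂P)

/-- `δ_yi = √E‖m̂_i - m_i‖₂² + ‖τ_i - τ* 1‖₂`. -/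
def deltaOut (D : Panel n T Ω) (ξ : Fin T → ℝ) (mh : OutEst n T Ω) (i : Fin n) : ℝ :=
  Real.sqrt (∫ ω, l2 (fun t => mh i ω t - D.m P i t) ^ 2 ∂P)
    + l2 (fun t => D.tau P i t - D.date P ξ)

/-- `δ̄_π`, the root mean square of the `δ_πi`. -/
def avgDeltaProp (D : Panel n T Ω) (πh : PropEst n T Ω) : ℝ :=
  Real.sqrt ((∑ i, D.deltaProp P πh i ^ 2) / n)

/-- `δ̄_y`, the root mean square of the `δ_yi`. -/
def avgDeltaOut (D : Panel n T Ω) (ξ : Fin T → ℝ) (mh : OutEst n T Ω) : ℝ :=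
  Real.sqrt ((∑ i, D.deltaOut P ξ mh i ^ 2) / n)

/-- `(1/n) ∑_i { E[(π̂_i(W_i) - π'_i(W_i))²] + E‖m̂_i - m'_i‖₂² }`, the distance between estimates
and deterministic limits. -/
def limitError (D : Panel n T Ω) (πh : PropEst n T Ω) (mh : OutEst n T Ω)
    (π' : Fin n → Path T → ℝ) (m' : Fin n → Fin T → ℝ) : ℝ :=
  (∑ i, ((∫ ω, (πh i ω (D.W i ω) - π' i (D.W i ω)) ^ 2 ∂P)
    + ∫ ω, l2 (fun t => mh i ω t - m' i t) ^ 2 ∂P)) / n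

end Population

/-! #### Cross-fitting -/

/-- The information in the data of all units outside the fold of unit `i`. -/
abbrev outOfFold (D : Panel n T Ω) {K : ℕ} (fold : Fin n → Fin K) (i : Fin n) :
    MeasurableSpace Ω :=
  ⨆ j : {j : Fin n // fold j ≠ fold i}, MeasurableSpace.comap (D.unit j) inferInstance

/-- `(π̂_i, m̂_i)` come from `K`-fold cross-fitting: the folds `{i | fold i = k}` have sizes
`⌊n/K⌋` or `⌈n/K⌉`, and `(π̂_i, m̂_i)` is a function of the data of the units that lie outside
the fold of `i`. -/
structure IsCrossFit (D : Panel n T Ω) {K : ℕ} (fold : Fin n → Fin K)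
    (πh : PropEst n T Ω) (mh : OutEst n T Ω) : Prop where
  balanced : ∀ k : Fin K,
    (Finset.univ.filter fun i => fold i = k).card = ⌊(n : ℝ) / K⌋₊ ∨
      (Finset.univ.filter fun i => fold i = k).card = ⌈(n : ℝ) / K⌉₊
  prop_measurable : ∀ i w, Measurable[D.outOfFold fold i] fun ω => πh i ω w
  out_measurable : ∀ i t, Measurable[D.outOfFold fold i] fun ω => mh i ω t

/-! #### The RIPW estimator and the confidence interval -/

section Estimator

variable (Q : Path T → ℝ)

/-- The reshaped inverse propensity weight `Θ_i = Π(W_i) / π̂_i(W_i)`. -/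
def theta (D : Panel n T Ω) (πh : PropEst n T Ω) (i : Fin n) (ω : Ω) : ℝ :=
  Q (D.W i ω) / πh i ω (D.W i ω)

/-- The adjusted outcomes `Y_i^obs - m̂_i`. -/
def res (D : Panel n T Ω) (mh : OutEst n T Ω) (i : Fin n) (ω : Ω) : Fin T → ℝ :=
  fun t => D.Yobs i ω t - mh i ω t

/-- The weighted two-way fixed effects least squares objective. -/
def objective (D : Panel n T Ω) (πh : PropEst n T Ω) (mh : OutEst n T Ω) (ω : Ω)
    (τ μ : ℝ) (α : Fin n → ℝ) (γ : Fin T → ℝ) : ℝ :=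
  ∑ i, ∑ t, (D.res mh i ω t - μ - α i - γ t - (D.W i ω).vec t * τ) ^ 2 * D.theta Q πh i ω

/-- `τ` is a value of the RIPW estimator: the `τ`-coordinate of a minimizer of the weighted
objective over `(τ, μ, α, γ)` with `∑ α_i = ∑ γ_t = 0`. -/
def IsEstimate (D : Panel n T Ω) (πh : PropEst n T Ω) (mh : OutEst n T Ω) (ω : Ω)
    (τ : ℝ) : Prop :=
  ∃ (μ : ℝ) (α : Fin n → ℝ) (γ : Fin T → ℝ), ∑ i, α i = 0 ∧ ∑ t, γ t = 0 ∧
    ∀ (τ₁ μ₁ : ℝ) (α₁ : Fin n → ℝ) (γ₁ : Fin T → ℝ), ∑ i, α₁ i = 0 → ∑ t, γ₁ t = 0 →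
      D.objective Q πh mh ω τ μ α γ ≤ D.objective Q πh mh ω τ₁ μ₁ α₁ γ₁

/-- `Γ_θ = (1/n) ∑ Θ_i`. -/
def Gθ (D : Panel n T Ω) (πh : PropEst n T Ω) (ω : Ω) : ℝ :=
  (∑ i, D.theta Q πh i ω) / n

/-- `Γ_ww = (1/n) ∑ Θ_i W_iᵀ J W_i`. -/
def Gww (D : Panel n T Ω) (πh : PropEst n T Ω) (ω : Ω) : ℝ :=
  (∑ i, D.theta Q πh i ω * dot (D.W i ω).vec (center (D.W i ω).vec)) / n

/-- `Γ_wy = (1/n) ∑ Θ_i W_iᵀ J (Y_i^obs - m̂_i)`. -/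
def Gwy (D : Panel n T Ω) (πh : PropEst n T Ω) (mh : OutEst n T Ω) (ω : Ω) : ℝ :=
  (∑ i, D.theta Q πh i ω * dot (D.W i ω).vec (center (D.res mh i ω))) / n

/-- The vector `Γ_w = (1/n) ∑ Θ_i J W_i`. -/
def Gw (D : Panel n T Ω) (πh : PropEst n T Ω) (ω : Ω) (t : Fin T) : ℝ :=
  (∑ i, D.theta Q πh i ω * center (D.W i ω).vec t) / n

/-- The vector `Γ_y = (1/n) ∑ Θ_i J (Y_i^obs - m̂_i)`. -/
def Gy (D : Panel n T Ω) (πh : PropEst n T Ω) (mh : OutEst n T Ω) (ω : Ω) (t : Fin T) : ℝ :=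
  (∑ i, D.theta Q πh i ω * center (D.res mh i ω) t) / n

/-- `𝒟 = Γ_ww Γ_θ - Γ_wᵀ Γ_w`. -/
def denom (D : Panel n T Ω) (πh : PropEst n T Ω) (ω : Ω) : ℝ :=
  D.Gww Q πh ω * D.Gθ Q πh ω - dot (D.Gw Q πh ω) (D.Gw Q πh ω)

/-- The common form of the influence term and of its plug-in estimate: for given values
`gθ, gww, gwy, gw, gy` and an effect `τ`,
`Θ_i { (gwy - τ gww) - (gy - τ gw)ᵀ J W_i + gθ W_iᵀ J (Ỹ_i - τ W_i) - gwᵀ J (Ỹ_i - τ W_i) }`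
with `Ỹ_i = Y_i^obs - m̂_i`. -/
def infl (D : Panel n T Ω) (πh : PropEst n T Ω) (mh : OutEst n T Ω)
    (gθ gww gwy : ℝ) (gw gy : Fin T → ℝ) (τ : ℝ) (i : Fin n) (ω : Ω) : ℝ :=
  D.theta Q πh i ω *
    ((gwy - τ * gww)
      - dot (fun t => gy t - τ * gw t) (center (D.W i ω).vec)
      + gθ * dot (D.W i ω).vec (center fun t => D.res mh i ω t - τ * (D.W i ω).vec t)
      - dot gw (center fun t => D.res mh i ω t - τ * (D.W i ω).vec t))

/-- `𝒱_i`, in which the `Γ`'s enter through their expectations and `τ` is the estimand. -/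
def V [MeasurableSpace Ω] (P : Measure Ω) (D : Panel n T Ω) (ξ : Fin T → ℝ)
    (πh : PropEst n T Ω) (mh : OutEst n T Ω) (i : Fin n) (ω : Ω) : ℝ :=
  D.infl Q πh mh (∫ ω', D.Gθ Q πh ω' ∂P) (∫ ω', D.Gww Q πh ω' ∂P) (∫ ω', D.Gwy Q πh mh ω' ∂P)
    (fun t => ∫ ω', D.Gw Q πh ω' t ∂P) (fun t => ∫ ω', D.Gy Q πh mh ω' t ∂P)
    (D.date P ξ) i ω

/-- The plug-in estimate of `𝒱_i` at the estimated effect `τ`. -/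
def Vhat (D : Panel n T Ω) (πh : PropEst n T Ω) (mh : OutEst n T Ω) (τ : ℝ)
    (i : Fin n) (ω : Ω) : ℝ :=
  D.infl Q πh mh (D.Gθ Q πh ω) (D.Gww Q πh ω) (D.Gwy Q πh mh ω) (D.Gw Q πh ω)
    (D.Gy Q πh mh ω) τ i ω

/-- `σ̂`, the empirical standard deviation (with denominator `n - 1`) of the plug-in
estimates. -/
def sigmaHat (D : Panel n T Ω) (πh : PropEst n T Ω) (mh : OutEst n T Ω) (τ : ℝ) (ω : Ω) : ℝ :=
  Real.sqrt ((∑ i, (D.Vhat Q πh mh τ i ω - (∑ j, D.Vhat Q πh mh τ j ω) / n) ^ 2) / ((n : ℝ) - 1))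

end Estimator

end Panel

/-- The `p`-th quantile of the standard normal distribution. -/
def normalQuantile (p : ℝ) : ℝ := sInf {x : ℝ | p ≤ cdf (gaussianReal 0 1) x}

/-- The Wald interval `[τ ∓ z_{1-α/2} σ̂ / (√n 𝒟)]` around the estimated effect `τ`. -/
def Panel.waldInterval {n T : ℕ} {Ω : Type*} (Q : Path T → ℝ) (D : Panel n T Ω)
    (πh : PropEst n T Ω) (mh : OutEst n T Ω) (τ α : ℝ) (ω : Ω) : Set ℝ :=
  Set.Icc
    (τ - normalQuantile (1 - α / 2) * D.sigmaHat Q πh mh τ ω / (Real.sqrt n * D.denom Q πh ω))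
    (τ + normalQuantile (1 - α / 2) * D.sigmaHat Q πh mh τ ω / (Real.sqrt n * D.denom Q πh ω))

/-! ### Assumptions on a sequence of panels -/

section Assumptions

variable {T : ℕ} {Ω : ℕ → Type*} [∀ n, MeasurableSpace (Ω n)] (P : ∀ n, Measure (Ω n))

/-- Propensity functions with values in `[0, 1]` that exceed, on `S`, a constant `c > 0` which
depends neither on the unit nor on the number of units. -/
def Overlap (S : Finset (Path T)) (πh : ∀ n, PropEst n T (Ω n)) : Prop :=
  (∀ n i, ∀ᵐ ω ∂(P n), ∀ w, 0 ≤ πh n i ω w ∧ πh n i ω w ≤ 1) ∧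
    ∃ c > 0, ∀ n i, ∀ᵐ ω ∂(P n), ∀ w ∈ S, c < πh n i ω w

/-- Adjusted potential outcomes bounded by a constant which does not depend on the number of
units. -/
def BoundedOutcomes (D : ∀ n, Panel n T (Ω n)) (mh : ∀ n, OutEst n T (Ω n)) : Prop :=
  ∃ M : ℝ, ∀ n i, ∀ᵐ ω ∂(P n), ∀ a t, |(D n).Y a i ω t - mh n i ω t| < M

end Assumptions

end

end RIPW

set_option linter.unusedSectionVars false

namespace RIPW

/-! ### A central limit theorem for bounded triangular arrays -/

section CLT

/-! The estimator is a ratio of quadratic forms in one finite-dimensional average. Record unit i by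
its cells: for every path w, the indicator of W_i = w times Π(w)/π̂_i(w), and this product times
each adjusted outcome. All the Γ's are linear in the cell average G, and the first-order conditions
of least squares (`IsEstimate.denom_mul`) give exactly 𝒟(τ̂ - τ*) = B(G, G), where B is the bilinear
form `form` at τ*. A Lagrange identity (`le_formW`) and overlap keep 𝒟 above a positive constant
with probability tending to one, so everything depends on the numerator B(G, G).

Let G₀ be the average of the mean cells computed with the estimates frozen. Cross-fitting writes
each coordinate of G - G₀ through averages of products u_i v_i, where u_i is centered and depends on
unit i alone while v_i depends only on other folds. Such products are orthogonal within a fold, so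
boundedly many folds give second moments of order 1/n (`integral_sq_sum_mul_le`).

The drift B(G₀, G₀) is the bias. Unit and time effects drop out of it. What is left vanishes if the
frozen weights π_i Π/π̂_i equal Π, by the DATE equation and the choice of τ*, and it also vanishes
if the outcome errors and the effect heterogeneity are zero. Hence it is bounded by a product of two
errors, a multiple of δ̄_π δ̄_y in expectation (`abs_form_bias_le`,
`integral_abs_form_avgCellMean_le`).

Let g be the mean of the cell average computed at the deterministic limits (π', m'), let s be its
centered version, and let Δ be the mean squared distance of the estimates from these limits. By
`form_expansion`, B(G, G) is the linear part B(g, s) + B(s, g) plus the bias, a product of the drift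
G₀ - g (size √Δ) with s (size n^(-1/2)), the change G - G₀ - s of the noise (size √(Δ/n)) and a
square of size 1/n. Apart from the bias, every remainder is o(n^(-1/2)) once Δ → 0.

The linear part is the average of the centered influence terms V_i at the limits, which are
independent and uniformly bounded, so a central limit theorem for bounded arrays applies. The
plug-in terms approximate V_i in mean square, and the empirical variance of the V_i is
asymptotically no smaller than their average variance, because unequal means only add to it. The
studentized numerator is therefore at most as dispersed as a normal variable, which gives coverage
of at least 1 - α. -/

lemma norm_prod_sub_prod_le {ι : Type*} (s : Finset ι) (f g : ι → ℂ)
    (hf : ∀ i, ‖f i‖ ≤ 1) (hg : ∀ i, ‖g i‖ ≤ 1) :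
    ‖∏ i ∈ s, f i - ∏ i ∈ s, g i‖ ≤ ∑ i ∈ s, ‖f i - g i‖ := by
  classical
  induction s using Finset.induction_on with
  | empty => simp
  | insert a s ha ih =>
    rw [Finset.prod_insert ha, Finset.prod_insert ha, Finset.sum_insert ha]
    have h1 : ‖∏ i ∈ s, g i‖ ≤ 1 := by
      rw [norm_prod]
      exact Finset.prod_le_one (fun i _ => norm_nonneg _) fun i _ => hg i
    -- Telescoping: one factor is exchanged at a time, and the remaining factors have norm at most
    -- one.
    have h2 : f a * ∏ i ∈ s, f i - g a * ∏ i ∈ s, g i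
        = (f a - g a) * ∏ i ∈ s, g i + f a * (∏ i ∈ s, f i - ∏ i ∈ s, g i) := by ring
    rw [h2]
    refine (norm_add_le _ _).trans ?_
    rw [norm_mul, norm_mul]
    refine add_le_add ?_ ?_
    · exact mul_le_of_le_one_right (norm_nonneg _) h1
    · exact (mul_le_of_le_one_left (norm_nonneg _) (hf a)).trans ih

lemma norm_exp_mul_I_sub_le {y : ℝ} (hy : |y| ≤ 1) :
    ‖Complex.exp (y * Complex.I) - (1 + y * Complex.I - (y ^ 2 / 2 : ℝ))‖ ≤ |y| ^ 3 := by
  have hn : ‖(y * Complex.I : ℂ)‖ = |y| := by simp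
  have h := Complex.exp_bound (x := y * Complex.I) (by rw [hn]; exact hy) (n := 3) (by norm_num)
  rw [hn] at h
  have h3 : ∑ m ∈ Finset.range 3, (y * Complex.I : ℂ) ^ m / (m.factorial : ℂ)
      = 1 + y * Complex.I - (y ^ 2 / 2 : ℝ) := by
    simp only [Finset.sum_range_succ, Finset.range_zero, Finset.sum_empty, Nat.factorial]
    have hI : (y * Complex.I : ℂ) ^ 2 = -y ^ 2 := by rw [mul_pow, Complex.I_sq]; ring
    rw [hI]
    push_cast
    ring
  rw [h3] at h
  refine h.trans ?_
  have : (0:ℝ) ≤ |y| ^ 3 := by positivity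
  norm_num [Nat.factorial]
  linarith

variable {Ω : Type*} [MeasurableSpace Ω] {P : Measure Ω} [IsProbabilityMeasure P]

/-- Second-order Taylor expansion of the exponential, in which the mean-zero condition removes the
linear term. The cubic error satisfies |X|³ ≤ b X², so it is proportional to the variance and can
later be summed over units. -/
lemma norm_charFun_map_sub_le {X : Ω → ℝ} (hX : Measurable X) {b t : ℝ}
    (hb : ∀ᵐ ω ∂P, |X ω| ≤ b) (ht : |t| * b ≤ 1) (h0 : ∫ ω, X ω ∂P = 0) :
    ‖charFun (P.map X) t - (1 - (t ^ 2 / 2 * ∫ ω, X ω ^ 2 ∂P : ℝ))‖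
      ≤ |t| ^ 3 * b * ∫ ω, X ω ^ 2 ∂P := by
  have hXi : Integrable X P := Integrable.of_bound hX.aestronglyMeasurable b (by simpa using hb)
  have hX2 : Integrable (fun ω => X ω ^ 2) P := by
    refine Integrable.of_bound (by fun_prop) (b ^ 2) ?_
    filter_upwards [hb] with ω h
    rw [Real.norm_eq_abs, abs_pow]
    gcongr
  have he : Integrable (fun ω => Complex.exp (t * X ω * Complex.I)) P := by
    refine Integrable.of_bound (by fun_prop) 1 (ae_of_all _ fun ω => ?_)
    have := Complex.norm_exp_ofReal_mul_I (t * X ω)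
    push_cast at this
    exact this.le
  have hp : Integrable (fun ω => (1 + (t * X ω : ℝ) * Complex.I
      - (((t * X ω) ^ 2 / 2 : ℝ) : ℂ))) P := by
    refine Integrable.sub (Integrable.add (integrable_const _) ?_) ?_
    · exact ((hXi.const_mul t).ofReal).mul_const _
    · refine Integrable.ofReal ?_
      simp_rw [mul_pow]
      exact (hX2.const_mul _).div_const _
  have hpi : ∫ ω, (1 + (t * X ω : ℝ) * Complex.I - (((t * X ω) ^ 2 / 2 : ℝ) : ℂ)) ∂P
      = 1 - (t ^ 2 / 2 * ∫ ω, X ω ^ 2 ∂P : ℝ) := by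
    rw [integral_sub, integral_add (integrable_const _), integral_mul_const]
    · have e1 : ∫ ω, ((t * X ω : ℝ) : ℂ) ∂P = 0 := by
        rw [integral_complex_ofReal, integral_const_mul, h0]; simp
      have e2 : ∫ ω, (((t * X ω) ^ 2 / 2 : ℝ) : ℂ) ∂P = (t ^ 2 / 2 * ∫ ω, X ω ^ 2 ∂P : ℝ) := by
        rw [integral_complex_ofReal, ← integral_const_mul]
        congr 2 with ω
        ring
      rw [e1, e2]
      simp
    · exact ((hXi.const_mul t).ofReal).mul_const _
    · exact Integrable.add (integrable_const _) (((hXi.const_mul t).ofReal).mul_const _)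
    · refine Integrable.ofReal ?_
      simp_rw [mul_pow]
      exact (hX2.const_mul _).div_const _
  rw [charFun_apply_real, integral_map hX.aemeasurable (by fun_prop), ← hpi, ← integral_sub he hp,
    ← integral_const_mul]
  refine norm_integral_le_of_norm_le (hX2.const_mul _) ?_
  filter_upwards [hb] with ω h
  have hle : |t * X ω| ≤ 1 := by
    rw [abs_mul]
    exact (mul_le_mul_of_nonneg_left h (abs_nonneg t)).trans ht
  have h1 := norm_exp_mul_I_sub_le hle
  push_cast at h1 ⊢
  refine h1.trans ?_
  rw [abs_mul, mul_pow, mul_assoc]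
  refine mul_le_mul_of_nonneg_left ?_ (by positivity)
  rw [pow_succ, sq_abs, mul_comm]
  exact mul_le_mul_of_nonneg_right h (sq_nonneg _)

end CLT

variable {Ω : ℕ → Type*} [∀ n, MeasurableSpace (Ω n)] {P : ∀ n, Measure (Ω n)}
  [∀ n, IsProbabilityMeasure (P n)]

/-- The two characteristic functions are compared factor by factor. Each factor contributes an error
of size o(1) times its variance, and the variances sum to one. -/
theorem tendsto_charFun_sum_array {X : ∀ n, Fin n → Ω n → ℝ} (hX : ∀ n i, Measurable (X n i))
    (hind : ∀ n, iIndepFun (X n) (P n)) {b : ℕ → ℝ} (hb0 : Tendsto b atTop (𝓝 0))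
    (hb : ∀ᶠ n in atTop, ∀ i, ∀ᵐ ω ∂(P n), |X n i ω| ≤ b n)
    (h0 : ∀ n i, ∫ ω, X n i ω ∂(P n) = 0)
    (hvar : ∀ᶠ n in atTop, ∑ i, ∫ ω, X n i ω ^ 2 ∂(P n) = 1) (t : ℝ) :
    Tendsto (fun n => charFun ((P n).map fun ω => ∑ i, X n i ω) t) atTop
      (𝓝 (charFun (gaussianReal 0 1) t)) := by
  rw [tendsto_iff_norm_sub_tendsto_zero]
  have hlim : Tendsto (fun n => |t| ^ 3 * |b n| + t ^ 4 / 4 * b n ^ 2) atTop (𝓝 0) := by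
    have := ((hb0.abs.const_mul (|t| ^ 3))).add ((hb0.pow 2).const_mul (t ^ 4 / 4))
    simpa using this
  have ht1 : ∀ᶠ n in atTop, |t| * |b n| ≤ 1 := by
    have : Tendsto (fun n => |t| * |b n|) atTop (𝓝 0) := by simpa using hb0.abs.const_mul |t|
    exact this.eventually_le_const one_pos
  have ht2 : ∀ᶠ n in atTop, t ^ 2 / 2 * b n ^ 2 ≤ 1 := by
    have : Tendsto (fun n => t ^ 2 / 2 * b n ^ 2) atTop (𝓝 0) := by
      simpa using (hb0.pow 2).const_mul (t ^ 2 / 2)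
    exact this.eventually_le_const one_pos
  refine tendsto_of_tendsto_of_tendsto_of_le_of_le' tendsto_const_nhds hlim
    (Eventually.of_forall fun n => norm_nonneg _) ?_
  filter_upwards [hb, hvar, ht1, ht2] with n hbn hvn ht1n ht2n
  have hbn' : ∀ i, ∀ᵐ ω ∂(P n), |X n i ω| ≤ |b n| := fun i => by
    filter_upwards [hbn i] with ω h using h.trans (le_abs_self _)
  rw [(hind n).charFun_map_fun_sum_eq_prod fun i => (hX n i).aemeasurable]
  set v : Fin n → ℝ := fun i => ∫ ω, X n i ω ^ 2 ∂(P n) with hv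
  have hv0 : ∀ i, 0 ≤ v i := fun i => integral_nonneg fun ω => sq_nonneg _
  have hvb : ∀ i, v i ≤ b n ^ 2 := fun i => by
    have h1 : ∀ᵐ ω ∂(P n), ‖X n i ω ^ 2‖ ≤ b n ^ 2 := by
      filter_upwards [hbn' i] with ω h
      rw [Real.norm_eq_abs, abs_pow, ← sq_abs (b n)]
      gcongr
    have := norm_integral_le_of_norm_le_const h1
    simp only [measureReal_def, measure_univ, ENNReal.toReal_one, mul_one] at this
    exact (le_abs_self _).trans this
  -- As the variances sum to one, the Gaussian characteristic function splits into matching factors.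
  have hg : charFun (gaussianReal 0 1) t = ∏ i, ((Real.exp (-(t ^ 2 / 2 * v i)) : ℝ) : ℂ) := by
    rw [← Complex.ofReal_prod, ← Real.exp_sum, charFun_gaussianReal]
    rw [Finset.sum_neg_distrib, ← Finset.mul_sum, hvn]
    push_cast
    congr 1
    simp
  rw [hg, Finset.prod_apply]
  refine (norm_prod_sub_prod_le _ _ _ (fun i => ?_) (fun i => ?_)).trans ?_
  · have := Measure.isProbabilityMeasure_map (μ := P n) (hX n i).aemeasurable
    exact norm_charFun_le_one t
  · rw [Complex.norm_real, Real.norm_eq_abs, abs_of_pos (Real.exp_pos _)]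
    exact Real.exp_le_one_iff.2 (neg_nonpos.2 (mul_nonneg (by positivity) (hv0 i)))
  · have hterm : ∀ i, ‖charFun ((P n).map (X n i)) t
        - ((Real.exp (-(t ^ 2 / 2 * v i)) : ℝ) : ℂ)‖
        ≤ (|t| ^ 3 * |b n| + t ^ 4 / 4 * b n ^ 2) * v i := fun i => by
      have h1 := norm_charFun_map_sub_le (hX n i) (hbn' i) ht1n (h0 n i)
      have hy0 : 0 ≤ t ^ 2 / 2 * v i := mul_nonneg (by positivity) (hv0 i)
      have hy1 : t ^ 2 / 2 * v i ≤ 1 :=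
        (mul_le_mul_of_nonneg_left (hvb i) (by positivity)).trans ht2n
      have h2 := Real.norm_exp_sub_one_sub_id_le (x := -(t ^ 2 / 2 * v i))
        (by rw [norm_neg, Real.norm_eq_abs, abs_of_nonneg hy0]; exact hy1)
      rw [norm_neg, Real.norm_eq_abs, Real.norm_eq_abs, abs_of_nonneg hy0] at h2
      have h3 : charFun ((P n).map (X n i)) t - ((Real.exp (-(t ^ 2 / 2 * v i)) : ℝ) : ℂ)
          = (charFun ((P n).map (X n i)) t - (1 - (t ^ 2 / 2 * v i : ℝ)))
            - ((Real.exp (-(t ^ 2 / 2 * v i)) - 1 - -(t ^ 2 / 2 * v i) : ℝ) : ℂ) := by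
        push_cast
        ring
      rw [h3]
      refine (norm_sub_le _ _).trans ?_
      rw [Complex.norm_real, Real.norm_eq_abs]
      refine (add_le_add h1 h2).trans ?_
      rw [add_mul]
      refine add_le_add le_rfl ?_
      have : (t ^ 2 / 2 * v i) ^ 2 = t ^ 4 / 4 * (v i * v i) := by ring
      rw [this, mul_assoc]
      refine mul_le_mul_of_nonneg_left ?_ (by positivity)
      exact mul_le_mul_of_nonneg_right (hvb i) (hv0 i)
    refine (Finset.sum_le_sum fun i _ => hterm i).trans ?_
    rw [← Finset.mul_sum, hvn, mul_one]

/-- Lévy continuity followed by the portmanteau theorem: the endpoints of the interval are null for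
the Gaussian law. The argument passes to laws on ℝ because the probability spaces change with n. -/
theorem tendsto_measure_abs_sum_le {X : ∀ n, Fin n → Ω n → ℝ} (hX : ∀ n i, Measurable (X n i))
    (hind : ∀ n, iIndepFun (X n) (P n)) {b : ℕ → ℝ} (hb0 : Tendsto b atTop (𝓝 0))
    (hb : ∀ᶠ n in atTop, ∀ i, ∀ᵐ ω ∂(P n), |X n i ω| ≤ b n)
    (h0 : ∀ n i, ∫ ω, X n i ω ∂(P n) = 0)
    (hvar : ∀ᶠ n in atTop, ∑ i, ∫ ω, X n i ω ^ 2 ∂(P n) = 1) (a : ℝ) :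
    Tendsto (fun n => P n {ω | |∑ i, X n i ω| ≤ a}) atTop
      (𝓝 (gaussianReal 0 1 (Set.Icc (-a) a))) := by
  have hm : ∀ n, Measurable fun ω => ∑ i, X n i ω := fun n =>
    Finset.measurable_fun_sum _ fun i _ => hX n i
  let μ : ℕ → ProbabilityMeasure ℝ := fun n =>
    ⟨(P n).map fun ω => ∑ i, X n i ω, Measure.isProbabilityMeasure_map (hm n).aemeasurable⟩
  let μ₀ : ProbabilityMeasure ℝ := ⟨gaussianReal 0 1, inferInstance⟩
  have hμ : Tendsto μ atTop (𝓝 μ₀) := ProbabilityMeasure.tendsto_iff_tendsto_charFun.2 fun t =>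
    tendsto_charFun_sum_array hX hind hb0 hb h0 hvar t
  have : NullSingletonClass (gaussianReal 0 1) := nullSingletonClass_gaussianReal (by norm_num)
  have hfr : (μ₀ : Measure ℝ) (frontier (Set.Icc (-a) a)) = 0 := by
    change gaussianReal 0 1 _ = 0
    by_cases h : -a ≤ a
    · rw [frontier_Icc h]
      exact (Set.toFinite _).measure_zero _
    · rw [Set.Icc_eq_empty h]
      simp
  have := ProbabilityMeasure.tendsto_measure_of_null_frontier_of_tendsto' hμ hfr
  refine this.congr fun n => ?_
  change ((P n).map fun ω => ∑ i, X n i ω) (Set.Icc (-a) a) = _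
  rw [Measure.map_apply (hm n) measurableSet_Icc]
  congr 1
  ext ω
  simp [abs_le]

/-! ### Almost surely bounded random variables -/

section AEBdd

variable {Ω : Type*} [MeasurableSpace Ω] {P : Measure Ω}

/-- A measurable real function that is almost surely bounded. -/
def AEBdd (P : Measure Ω) (X : Ω → ℝ) : Prop := Measurable X ∧ ∃ C, ∀ᵐ ω ∂P, |X ω| ≤ C

namespace AEBdd

variable {X Y : Ω → ℝ}

lemma measurable (h : AEBdd P X) : Measurable X := h.1

lemma const (c : ℝ) : AEBdd P fun _ => c := ⟨measurable_const, |c|, ae_of_all _ fun _ => le_rfl⟩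

lemma add (hX : AEBdd P X) (hY : AEBdd P Y) : AEBdd P fun ω => X ω + Y ω := by
  obtain ⟨hX, C, hC⟩ := hX
  obtain ⟨hY, C', hC'⟩ := hY
  refine ⟨hX.add hY, C + C', ?_⟩
  filter_upwards [hC, hC'] with ω h h' using (abs_add_le _ _).trans (add_le_add h h')

lemma mul (hX : AEBdd P X) (hY : AEBdd P Y) : AEBdd P fun ω => X ω * Y ω := by
  obtain ⟨hX, C, hC⟩ := hX
  obtain ⟨hY, C', hC'⟩ := hY
  refine ⟨hX.mul hY, C * C', ?_⟩
  filter_upwards [hC, hC'] with ω h h'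
  rw [abs_mul]
  exact mul_le_mul h h' (abs_nonneg _) ((abs_nonneg _).trans h)

lemma const_mul (hX : AEBdd P X) (c : ℝ) : AEBdd P fun ω => c * X ω := (const c).mul hX

lemma mul_const (hX : AEBdd P X) (c : ℝ) : AEBdd P fun ω => X ω * c := hX.mul (const c)

lemma div_const (hX : AEBdd P X) (c : ℝ) : AEBdd P fun ω => X ω / c := by
  simpa only [div_eq_mul_inv] using hX.mul_const c⁻¹

lemma sub (hX : AEBdd P X) (hY : AEBdd P Y) : AEBdd P fun ω => X ω - Y ω := by
  simpa only [sub_eq_add_neg, neg_one_mul] using hX.add (hY.const_mul (-1))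

lemma pow (hX : AEBdd P X) (k : ℕ) : AEBdd P fun ω => X ω ^ k := by
  induction k with
  | zero => simpa using const 1
  | succ k ih => simpa only [pow_succ] using ih.mul hX

lemma abs (hX : AEBdd P X) : AEBdd P fun ω => |X ω| := by
  obtain ⟨hX, C, hC⟩ := hX
  exact ⟨measurable_norm.comp hX, C, by simpa using hC⟩

lemma sum {ι : Type*} (s : Finset ι) {X : ι → Ω → ℝ} (h : ∀ i, AEBdd P (X i)) :
    AEBdd P fun ω => ∑ i ∈ s, X i ω := by
  classical
  induction s using Finset.induction_on with
  | empty => simpa using const 0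
  | insert a s ha ih => simpa only [Finset.sum_insert ha] using (h a).add ih

lemma integrable [IsFiniteMeasure P] (h : AEBdd P X) : Integrable X P := by
  obtain ⟨hX, C, hC⟩ := h
  exact Integrable.of_bound hX.aestronglyMeasurable C (by simpa using hC)

end AEBdd

end AEBdd

/-! ### Orthogonality under cross-fitting -/

section CrossFit

variable {Ω 𝓩 : Type*} [MeasurableSpace Ω] [MeasurableSpace 𝓩] {P : Measure Ω}
  [IsProbabilityMeasure P] {n K : ℕ} {Z : Fin n → Ω → 𝓩}

lemma indepFun_of_measurable_compl (hZ : ∀ i, Measurable (Z i)) (hind : iIndepFun Z P) (i : Fin n)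
    {f g : Ω → ℝ} (hf : Measurable[MeasurableSpace.comap (Z i) inferInstance] f)
    (hg : Measurable[⨆ j ∈ ({i}ᶜ : Set (Fin n)), MeasurableSpace.comap (Z j) inferInstance] g) :
    IndepFun f g P := by
  have h := indep_iSup_of_disjoint (fun j => (hZ j).comap_le) hind.iIndep
    (S := {i}) (T := {i}ᶜ) disjoint_compl_right
  simp only [Set.mem_singleton_iff, iSup_iSup_eq_left] at h
  rw [IndepFun_iff_Indep]
  exact indep_of_indep_of_le_right (indep_of_indep_of_le_left h hf.comap_le) hg.comap_le

lemma outOfFold_le_compl (fold : Fin n → Fin K) {i j : Fin n} (h : fold i = fold j) :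
    (⨆ l : {l : Fin n // fold l ≠ fold j}, MeasurableSpace.comap (Z l) inferInstance)
      ≤ ⨆ l ∈ ({i}ᶜ : Set (Fin n)), MeasurableSpace.comap (Z l) inferInstance := by
  refine iSup_le fun l => ?_
  refine le_iSup₂_of_le (l : Fin n) ?_ le_rfl
  rintro rfl
  exact l.2 h

lemma outOfFold_le (hZ : ∀ i, Measurable (Z i)) (fold : Fin n → Fin K) (i : Fin n) :
    (⨆ l : {l : Fin n // fold l ≠ fold i}, MeasurableSpace.comap (Z l) inferInstance)
      ≤ ‹MeasurableSpace Ω› :=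
  iSup_le fun l => (hZ l).comap_le

lemma indepFun_outOfFold (hZ : ∀ i, Measurable (Z i)) (hind : iIndepFun Z P)
    (fold : Fin n → Fin K) (i : Fin n) {f g : Ω → ℝ}
    (hf : Measurable[MeasurableSpace.comap (Z i) inferInstance] f)
    (hg : Measurable[⨆ l : {l : Fin n // fold l ≠ fold i},
      MeasurableSpace.comap (Z l) inferInstance] g) :
    IndepFun f g P :=
  indepFun_of_measurable_compl hZ hind i hf (hg.mono (outOfFold_le_compl fold rfl) le_rfl)

/-- The key to cross-fitting. Apart from u_i, no factor involves unit i: v_i and v_j are built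
outside the common fold of i and j, and u_j concerns another unit. So the centered u_i is
independent of the rest of the product. -/
lemma integral_mul_eq_zero_of_fold_eq (hZ : ∀ i, Measurable (Z i)) (hind : iIndepFun Z P)
    (fold : Fin n → Fin K) {u v : Fin n → Ω → ℝ}
    (hu : ∀ i, Measurable[MeasurableSpace.comap (Z i) inferInstance] (u i))
    (hv : ∀ i, Measurable[⨆ j : {j : Fin n // fold j ≠ fold i},
      MeasurableSpace.comap (Z j) inferInstance] (v i))
    (hu0 : ∀ i, ∫ ω, u i ω ∂P = 0) {i j : Fin n} (hij : i ≠ j) (hf : fold i = fold j) :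
    ∫ ω, (u i ω * v i ω) * (u j ω * v j ω) ∂P = 0 := by
  have hmi : Measurable[⨆ l ∈ ({i}ᶜ : Set (Fin n)), MeasurableSpace.comap (Z l) inferInstance]
      fun ω => v i ω * (u j ω * v j ω) := by
    refine Measurable.mul ((hv i).mono (outOfFold_le_compl fold rfl) le_rfl)
      (Measurable.mul ((hu j).mono ?_ le_rfl) ((hv j).mono (outOfFold_le_compl fold hf) le_rfl))
    exact le_iSup₂_of_le j (by simpa using hij.symm) le_rfl
  have hle : (⨆ l ∈ ({i}ᶜ : Set (Fin n)), MeasurableSpace.comap (Z l) inferInstance)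
      ≤ ‹MeasurableSpace Ω› := iSup₂_le fun l _ => (hZ l).comap_le
  have h := (indepFun_of_measurable_compl hZ hind i (hu i) hmi).integral_fun_mul_eq_mul_integral
    ((hu i).mono (hZ i).comap_le le_rfl).aestronglyMeasurable
    (hmi.mono hle le_rfl).aestronglyMeasurable
  rw [hu0 i, zero_mul] at h
  rw [← h]
  congr 1 with ω
  ring

/-- Cauchy–Schwarz over the folds costs a factor K. Inside a fold the cross terms vanish, leaving
only the diagonal. -/
theorem integral_sq_sum_mul_le (hZ : ∀ i, Measurable (Z i)) (hind : iIndepFun Z P)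
    (fold : Fin n → Fin K) {u v : Fin n → Ω → ℝ}
    (hu : ∀ i, Measurable[MeasurableSpace.comap (Z i) inferInstance] (u i))
    (hv : ∀ i, Measurable[⨆ j : {j : Fin n // fold j ≠ fold i},
      MeasurableSpace.comap (Z j) inferInstance] (v i))
    (hub : ∀ i, AEBdd P (u i)) (hvb : ∀ i, AEBdd P (v i)) (hu0 : ∀ i, ∫ ω, u i ω ∂P = 0) :
    ∫ ω, (∑ i, u i ω * v i ω) ^ 2 ∂P ≤ K * ∑ i, ∫ ω, (u i ω * v i ω) ^ 2 ∂P := by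
  classical
  have hxb : ∀ i, AEBdd P fun ω => u i ω * v i ω := fun i => (hub i).mul (hvb i)
  have hpt : ∀ ω, (∑ i, u i ω * v i ω) ^ 2
      ≤ K * ∑ k, (∑ i with fold i = k, u i ω * v i ω) ^ 2 := fun ω => by
    rw [← Finset.sum_fiberwise _ fold]
    refine sq_sum_le_card_mul_sum_sq.trans ?_
    simp
  have hfold : ∀ k, ∫ ω, (∑ i with fold i = k, u i ω * v i ω) ^ 2 ∂P
      = ∑ i with fold i = k, ∫ ω, (u i ω * v i ω) ^ 2 ∂P := fun k => by
    simp_rw [sq, Finset.sum_mul_sum]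
    rw [integral_finsetSum _ fun i _ => (AEBdd.sum _ fun j => (hxb i).mul (hxb j)).integrable]
    refine Finset.sum_congr rfl fun i hi => ?_
    rw [integral_finsetSum _ fun j _ => ((hxb i).mul (hxb j)).integrable]
    refine Finset.sum_eq_single_of_mem i hi fun j hj hji => ?_
    refine integral_mul_eq_zero_of_fold_eq hZ hind fold hu hv hu0 hji.symm ?_
    rw [(Finset.mem_filter.1 hi).2, (Finset.mem_filter.1 hj).2]
  calc ∫ ω, (∑ i, u i ω * v i ω) ^ 2 ∂P
      ≤ ∫ ω, K * ∑ k, (∑ i with fold i = k, u i ω * v i ω) ^ 2 ∂P := by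
        refine integral_mono ((AEBdd.sum _ hxb).pow 2).integrable ?_ hpt
        exact ((AEBdd.sum _ fun k => (AEBdd.sum _ hxb).pow 2).const_mul _).integrable
    _ = K * ∑ k, ∑ i with fold i = k, ∫ ω, (u i ω * v i ω) ^ 2 ∂P := by
        rw [integral_const_mul, integral_finsetSum _ fun k _ =>
          ((AEBdd.sum _ hxb).pow 2).integrable]
        simp_rw [hfold]
    _ = _ := by rw [Finset.sum_fiberwise]

/-- The resulting rate: for bounded u_i, an average of the products has second moment of order K/n
times the mean square of the v_i. Bounded v_i thus give 1/n, and small v_i give more. -/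
theorem integral_sq_avg_mul_le (hZ : ∀ i, Measurable (Z i)) (hind : iIndepFun Z P)
    (fold : Fin n → Fin K) {u v : Fin n → Ω → ℝ}
    (hu : ∀ i, Measurable[MeasurableSpace.comap (Z i) inferInstance] (u i))
    (hv : ∀ i, Measurable[⨆ j : {j : Fin n // fold j ≠ fold i},
      MeasurableSpace.comap (Z j) inferInstance] (v i))
    {U : ℝ} (hub : ∀ i, ∀ᵐ ω ∂P, |u i ω| ≤ U) (hvb : ∀ i, AEBdd P (v i))
    (hu0 : ∀ i, ∫ ω, u i ω ∂P = 0) :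
    ∫ ω, ((∑ i, u i ω * v i ω) / n) ^ 2 ∂P
      ≤ K * U ^ 2 * ((∑ i, ∫ ω, v i ω ^ 2 ∂P) / n) / n := by
  have hub' : ∀ i, AEBdd P (u i) := fun i => ⟨(hu i).mono (hZ i).comap_le le_rfl, U, hub i⟩
  simp_rw [div_pow]
  rw [integral_div]
  have h1 := integral_sq_sum_mul_le hZ hind fold hu hv hub' hvb hu0
  have h2 : ∑ i, ∫ ω, (u i ω * v i ω) ^ 2 ∂P ≤ U ^ 2 * ∑ i, ∫ ω, v i ω ^ 2 ∂P := by
    rw [Finset.mul_sum]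
    refine Finset.sum_le_sum fun i _ => ?_
    rw [← integral_const_mul]
    refine integral_mono_ae (((hub' i).mul (hvb i)).pow 2).integrable
      (((hvb i).pow 2).const_mul _).integrable ?_
    filter_upwards [hub i] with ω h
    rw [mul_pow]
    refine mul_le_mul_of_nonneg_right ?_ (sq_nonneg _)
    rw [← sq_abs]
    gcongr
  calc _ ≤ (K * (U ^ 2 * ∑ i, ∫ ω, v i ω ^ 2 ∂P)) / (n : ℝ) ^ 2 := by
        gcongr
        exact h1.trans (by gcongr)
    _ = _ := by rw [sq (n : ℝ)]; simp only [div_eq_mul_inv, mul_inv]; ring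

end CrossFit

/-! ### Cauchy–Schwarz for expectations -/

section CauchySchwarz

variable {Ω : Type*} [MeasurableSpace Ω] {P : Measure Ω} [IsFiniteMeasure P]

lemma integral_abs_mul_le {X Y : Ω → ℝ} (hX : AEBdd P X) (hY : AEBdd P Y) :
    ∫ ω, |X ω * Y ω| ∂P ≤ √(∫ ω, X ω ^ 2 ∂P) * √(∫ ω, Y ω ^ 2 ∂P) := by
  have hL : ∀ {X : Ω → ℝ}, AEBdd P X → MemLp X (ENNReal.ofReal 2) P := fun {X} h => by
    obtain ⟨hX, C, hC⟩ := h
    exact MemLp.of_bound hX.aestronglyMeasurable C (by simpa using hC)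
  have h := integral_mul_norm_le_Lp_mul_Lq Real.HolderConjugate.two_two (hL hX) (hL hY)
  simpa [abs_mul, Real.sqrt_eq_rpow] using h

lemma integral_abs_le_sqrt [IsProbabilityMeasure P] {X : Ω → ℝ} (hX : AEBdd P X) :
    ∫ ω, |X ω| ∂P ≤ √(∫ ω, X ω ^ 2 ∂P) := by
  simpa using integral_abs_mul_le hX (AEBdd.const (P := P) 1)

end CauchySchwarz

noncomputable section

/-! ### The centering map -/

section Center

variable {T : ℕ}

lemma center_add (u v : Fin T → ℝ) (t : Fin T) :
    center (fun t => u t + v t) t = center u t + center v t := by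
  simp only [center, Finset.sum_add_distrib]; ring

lemma center_sub (u v : Fin T → ℝ) (t : Fin T) :
    center (fun t => u t - v t) t = center u t - center v t := by
  simp only [center, Finset.sum_sub_distrib]; ring

lemma center_const_mul (c : ℝ) (v : Fin T → ℝ) (t : Fin T) :
    center (fun t => c * v t) t = c * center v t := by
  simp only [center, ← Finset.mul_sum]; ring

lemma center_const (c : ℝ) (t : Fin T) : center (fun _ => c) t = 0 := by
  have : (T : ℝ) ≠ 0 := by exact_mod_cast (Fin.pos t).ne'
  simp [center, this]

lemma sum_center (v : Fin T → ℝ) : ∑ t, center v t = 0 := by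
  rcases Nat.eq_zero_or_pos T with rfl | h
  · simp
  · have : (T : ℝ) ≠ 0 := by exact_mod_cast h.ne'
    simp only [center, Finset.sum_sub_distrib, Finset.sum_const, Finset.card_univ, Fintype.card_fin,
      nsmul_eq_mul]
    field_simp
    ring

lemma sum_mul_center (u v : Fin T → ℝ) : ∑ t, u t * center v t = ∑ t, center u t * v t := by
  simp only [center, mul_sub, sub_mul, Finset.sum_sub_distrib, ← Finset.sum_mul, ← Finset.mul_sum]
  ring

lemma sum_center_mul_center (u v : Fin T → ℝ) :
    ∑ t, center u t * center v t = ∑ t, center u t * v t := by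
  simp only [center]
  rw [← sub_eq_zero, ← Finset.sum_sub_distrib]
  have := sum_center u
  simp only [center] at this
  simp_rw [← mul_sub, sub_sub_cancel_left, ← Finset.sum_mul, this, zero_mul]

lemma dot_center (u v : Fin T → ℝ) : dot u (center v) = ∑ t, center u t * v t :=
  sum_mul_center u v

lemma abs_center_le {v : Fin T → ℝ} {B : ℝ} (h : ∀ t, |v t| ≤ B) (t : Fin T) :
    |center v t| ≤ 2 * B := by
  have hT : (0 : ℝ) < T := by exact_mod_cast Fin.pos t
  have h1 : |(∑ s, v s) / T| ≤ B := by
    rw [abs_div, Nat.abs_cast, div_le_iff₀ hT]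
    refine (Finset.abs_sum_le_sum_abs _ _).trans ((Finset.sum_le_sum fun s _ => h s).trans ?_)
    simp [mul_comm]
  calc |center v t| ≤ |v t| + |(∑ s, v s) / T| := abs_sub _ _
    _ ≤ 2 * B := by linarith [h t]

lemma Path.abs_vec_le (w : Path T) (t : Fin T) : |w.vec t| ≤ 1 := by
  unfold Path.vec; split_ifs <;> simp

end Center

/-! ### The bilinear forms behind the estimator -/

section Forms

variable {T : ℕ}

/-- The coordinates in which one unit enters the estimator: for every path its weight, and its
weighted adjusted outcomes. -/
abbrev Cell (T : ℕ) : Type := Path T × Option (Fin T)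

/-- `Γ_θ` as a linear function of the cell averages. -/
def fθ : (Cell T → ℝ) →ₗ[ℝ] ℝ := ∑ w, LinearMap.proj (w, none)

/-- `Γ_w` as a linear function of the cell averages. -/
def fw (t : Fin T) : (Cell T → ℝ) →ₗ[ℝ] ℝ :=
  ∑ w : Path T, center w.vec t • LinearMap.proj (w, none)

/-- `Γ_ww` as a linear function of the cell averages. -/
def fww : (Cell T → ℝ) →ₗ[ℝ] ℝ :=
  ∑ w : Path T, dot w.vec (center w.vec) • LinearMap.proj (w, none)

/-- `Γ_wy` as a linear function of the cell averages. -/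
def fwy : (Cell T → ℝ) →ₗ[ℝ] ℝ :=
  ∑ w : Path T, ∑ t, center w.vec t • LinearMap.proj (w, some t)

/-- `Γ_y` as a linear function of the cell averages. -/
def fy (t : Fin T) : (Cell T → ℝ) →ₗ[ℝ] ℝ :=
  ∑ w : Path T, (LinearMap.proj (w, some t) - (T : ℝ)⁻¹ • ∑ s, LinearMap.proj (w, some s))

lemma fθ_apply (x : Cell T → ℝ) : fθ x = ∑ w, x (w, none) := by simp [fθ]

lemma fw_apply (t : Fin T) (x : Cell T → ℝ) :
    fw t x = ∑ w : Path T, center w.vec t * x (w, none) := by simp [fw]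

lemma fww_apply (x : Cell T → ℝ) :
    fww x = ∑ w : Path T, dot w.vec (center w.vec) * x (w, none) := by simp [fww]

lemma fwy_apply (x : Cell T → ℝ) :
    fwy x = ∑ w : Path T, ∑ t, center w.vec t * x (w, some t) := by simp [fwy]

lemma fy_apply (t : Fin T) (x : Cell T → ℝ) :
    fy t x = ∑ w : Path T, center (fun s => x (w, some s)) t := by
  simp [fy, center, div_eq_inv_mul]

/-- The numerator form: `Γ_θ Γ_wy - Γ_wᵀ Γ_y` on the diagonal. -/
def formY : LinearMap.BilinForm ℝ (Cell T → ℝ) :=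
  (LinearMap.mul ℝ ℝ).compl₁₂ fθ fwy - ∑ t, (LinearMap.mul ℝ ℝ).compl₁₂ (fw t) (fy t)

/-- The denominator form: `Γ_θ Γ_ww - Γ_wᵀ Γ_w` on the diagonal. -/
def formW : LinearMap.BilinForm ℝ (Cell T → ℝ) :=
  (LinearMap.mul ℝ ℝ).compl₁₂ fθ fww - ∑ t, (LinearMap.mul ℝ ℝ).compl₁₂ (fw t) (fw t)

lemma formY_apply (x y : Cell T → ℝ) : formY x y = fθ x * fwy y - ∑ t, fw t x * fy t y := by
  simp [formY, LinearMap.sum_apply]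

lemma formW_apply (x y : Cell T → ℝ) : formW x y = fθ x * fww y - ∑ t, fw t x * fw t y := by
  simp [formW, LinearMap.sum_apply]

/-- The numerator form for outcomes from which the effect `τ` is removed. -/
def form (τ : ℝ) : LinearMap.BilinForm ℝ (Cell T → ℝ) := formY - τ • formW

lemma form_apply (τ : ℝ) (x y : Cell T → ℝ) : form τ x y = formY x y - τ * formW x y := by
  simp [form]

lemma exists_bilin_bound (B : LinearMap.BilinForm ℝ (Cell T → ℝ)) :
    ∃ C, 0 ≤ C ∧ ∀ x y, |B x y| ≤ C * ‖x‖ * ‖y‖ := by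
  let B' : (Cell T → ℝ) →L[ℝ] ((Cell T → ℝ) →L[ℝ] ℝ) :=
    LinearMap.toContinuousLinearMap (LinearMap.toContinuousLinearMap.toLinearMap ∘ₗ B)
  exact ⟨‖B'‖, B'.opNorm_nonneg, fun x y => B'.le_opNorm₂ x y⟩

/-- The constant depends on T only and the growth in τ is explicit, so the bound stays uniform along
a sequence of estimands. -/
lemma exists_form_bound (T : ℕ) :
    ∃ C, 0 ≤ C ∧ ∀ (τ : ℝ) (x y : Cell T → ℝ), |form τ x y| ≤ C * (1 + |τ|) * ‖x‖ * ‖y‖ := by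
  obtain ⟨C₁, h₁, H₁⟩ := exists_bilin_bound (formY (T := T))
  obtain ⟨C₂, h₂, H₂⟩ := exists_bilin_bound (formW (T := T))
  refine ⟨C₁ + C₂, by positivity, fun τ x y => ?_⟩
  rw [form_apply]
  refine (abs_sub _ _).trans ?_
  rw [abs_mul]
  have h3 := mul_le_mul_of_nonneg_left (H₂ x y) (abs_nonneg τ)
  have h4 := H₁ x y
  have h5 : 0 ≤ ‖x‖ * ‖y‖ := by positivity
  have h6 : 0 ≤ |τ| * C₁ * (‖x‖ * ‖y‖) := by positivity
  have h7 : 0 ≤ C₂ * (‖x‖ * ‖y‖) := by positivity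
  nlinarith

/-- Lagrange's identity: twice the quadratic form is the sum over ordered pairs of paths of x_w x_w'
‖Jw - Jw'‖². All terms are nonnegative, and the chosen pair occurs in both orders. -/
lemma le_formW {x : Cell T → ℝ} (hx : ∀ w, 0 ≤ x (w, none)) (w₁ w₂ : Path T) (hne : w₁ ≠ w₂) :
    x (w₁, none) * x (w₂, none) * ∑ t, (center w₁.vec t - center w₂.vec t) ^ 2 ≤ formW x x := by
  have key : ∑ w : Path T, ∑ w' : Path T,
      x (w, none) * x (w', none) * ∑ t, (center w.vec t - center w'.vec t) ^ 2
      = 2 * formW x x := by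
    have hd : ∀ w : Path T, dot w.vec (center w.vec) = ∑ t, center w.vec t * center w.vec t :=
      fun w => by rw [dot_center, ← sum_center_mul_center]
    rw [formW_apply, fθ_apply, fww_apply]
    simp_rw [fw_apply, hd]
    have h1 : ∀ w w' : Path T, x (w, none) * x (w', none) *
        ∑ t, (center w.vec t - center w'.vec t) ^ 2
        = x (w', none) * ((∑ t, center w.vec t * center w.vec t) * x (w, none))
          + x (w, none) * ((∑ t, center w'.vec t * center w'.vec t) * x (w', none))
          - ∑ t, 2 * ((center w.vec t * x (w, none)) * (center w'.vec t * x (w', none))) := by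
      intro w w'
      simp only [Finset.mul_sum, Finset.sum_mul, ← Finset.sum_add_distrib,
        ← Finset.sum_sub_distrib]
      refine Finset.sum_congr rfl fun t _ => ?_
      ring
    have h2 : ∑ w : Path T, ∑ w' : Path T, ∑ t, 2 * ((center w.vec t * x (w, none))
        * (center w'.vec t * x (w', none)))
        = 2 * ∑ t, (∑ w : Path T, center w.vec t * x (w, none))
          * (∑ w : Path T, center w.vec t * x (w, none)) := by
      simp_rw [Finset.sum_mul_sum, Finset.mul_sum]
      rw [Finset.sum_comm_cycle]
    simp_rw [h1, Finset.sum_sub_distrib, Finset.sum_add_distrib]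
    have h3 : ∀ f g : Path T → ℝ, ∑ w, ∑ w', f w' * g w = (∑ w, f w) * ∑ w, g w := fun f g => by
      simp_rw [← Finset.sum_mul, ← Finset.mul_sum]
    have h4 : ∀ f g : Path T → ℝ, ∑ w, ∑ w', f w * g w' = (∑ w, f w) * ∑ w, g w := fun f g =>
      (Finset.sum_mul_sum _ _ _ _).symm
    rw [h2, h3 (fun w => x (w, none)), h4 (fun w => x (w, none))]
    ring
  set F : Path T → Path T → ℝ := fun w w' =>
    x (w, none) * x (w', none) * ∑ t, (center w.vec t - center w'.vec t) ^ 2 with hF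
  have hF0 : ∀ w w', 0 ≤ F w w' := fun w w' =>
    mul_nonneg (mul_nonneg (hx _) (hx _)) (Finset.sum_nonneg fun t _ => sq_nonneg _)
  have hsymm : F w₂ w₁ = F w₁ w₂ := by
    simp only [hF]
    rw [mul_comm (x (w₂, none))]
    congr 1
    exact Finset.sum_congr rfl fun t _ => by ring
  have h1 : F w₁ w₂ ≤ ∑ w', F w₁ w' :=
    Finset.single_le_sum (fun w' _ => hF0 w₁ w') (Finset.mem_univ w₂)
  have h2 : F w₂ w₁ ≤ ∑ w', F w₂ w' :=
    Finset.single_le_sum (fun w' _ => hF0 w₂ w') (Finset.mem_univ w₁)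
  have h3 : ∑ w ∈ {w₁, w₂}, ∑ w', F w w' ≤ ∑ w, ∑ w', F w w' :=
    Finset.sum_le_sum_of_subset_of_nonneg (Finset.subset_univ _)
      fun w _ _ => Finset.sum_nonneg fun w' _ => hF0 w w'
  rw [Finset.sum_pair hne, key] at h3
  linarith

/-- If Jw₁ = Jw₂, then w₁ - w₂ is constant in time. For distinct binary paths this constant is 1 or
-1, which forces w₁ to be constant. Taking w₁ to be the path that is neither all zeros nor all ones
excludes this. -/
lemma exists_pair_of_isOverlapSet {S : Finset (Path T)} (hS : IsOverlapSet S) :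
    ∃ w₁ ∈ S, ∃ w₂ ∈ S, w₁ ≠ w₂ ∧ 0 < ∑ t, (center w₁.vec t - center w₂.vec t) ^ 2 := by
  obtain ⟨hcard, w₁, hw₁, h0, h1⟩ := hS
  obtain ⟨w₂, hw₂, hne⟩ := Finset.exists_mem_ne (by omega : 1 < S.card) w₁
  refine ⟨w₁, hw₁, w₂, hw₂, hne.symm, ?_⟩
  refine lt_of_le_of_ne (Finset.sum_nonneg fun t _ => sq_nonneg _) fun h => ?_
  rw [eq_comm, Finset.sum_eq_zero_iff_of_nonneg fun t _ => sq_nonneg _] at h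
  have h2 : ∀ t s, w₁.vec t - w₂.vec t = w₁.vec s - w₂.vec s := fun t s => by
    have ht := pow_eq_zero_iff two_ne_zero |>.1 (h t (Finset.mem_univ _))
    have hs := pow_eq_zero_iff two_ne_zero |>.1 (h s (Finset.mem_univ _))
    simp only [center] at ht hs
    linarith
  obtain ⟨t, ht⟩ := Function.ne_iff.1 hne
  simp only [Path.vec] at h2
  have h3 : ∀ s, w₁ s = w₁ t := fun s => by
    have := h2 t s
    revert this ht
    cases w₁ t <;> cases w₁ s <;> cases w₂ t <;> cases w₂ s <;> norm_num
  cases hc : w₁ t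
  · exact h0 (funext fun s => (h3 s).trans hc)
  · exact h1 (funext fun s => (h3 s).trans hc)

end Forms

/-! ### The estimator in terms of the forms -/

namespace Panel

variable {n T : ℕ} {Ω : Type*} (Q : Path T → ℝ) (D : Panel n T Ω) (πh : PropEst n T Ω)
  (mh : OutEst n T Ω)

/-- The contribution of a unit to the cells. -/
def cell (i : Fin n) (ω : Ω) : Cell T → ℝ := fun c =>
  if D.W i ω = c.1 then
    Q c.1 / πh i ω c.1 * c.2.elim 1 fun t => D.Y (c.1 t) i ω t - mh i ω t
  else 0

/-- The cell averages. -/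
def avgCell (ω : Ω) : Cell T → ℝ := fun c => (∑ i, D.cell Q πh mh i ω c) / n

lemma avgCell_eq (ω : Ω) :
    D.avgCell Q πh mh ω = (n : ℝ)⁻¹ • ∑ i, D.cell Q πh mh i ω := by
  ext c
  simp [avgCell, div_eq_inv_mul]

lemma fθ_cell (i : Fin n) (ω : Ω) : fθ (D.cell Q πh mh i ω) = D.theta Q πh i ω := by
  rw [fθ_apply, Finset.sum_eq_single (D.W i ω)]
  · simp [cell, theta]
  · intro w _ hw; simp [cell, hw.symm]
  · simp

lemma fw_cell (t : Fin T) (i : Fin n) (ω : Ω) :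
    fw t (D.cell Q πh mh i ω) = D.theta Q πh i ω * center (D.W i ω).vec t := by
  rw [fw_apply, Finset.sum_eq_single (D.W i ω)]
  · simp [cell, theta, mul_comm]
  · intro w _ hw; simp [cell, hw.symm]
  · simp

lemma fww_cell (i : Fin n) (ω : Ω) :
    fww (D.cell Q πh mh i ω)
      = D.theta Q πh i ω * dot (D.W i ω).vec (center (D.W i ω).vec) := by
  rw [fww_apply, Finset.sum_eq_single (D.W i ω)]
  · simp [cell, theta, mul_comm]
  · intro w _ hw; simp [cell, hw.symm]
  · simp

lemma fwy_cell (i : Fin n) (ω : Ω) :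
    fwy (D.cell Q πh mh i ω)
      = D.theta Q πh i ω * dot (D.W i ω).vec (center (D.res mh i ω)) := by
  rw [fwy_apply, Finset.sum_eq_single (D.W i ω), dot_center]
  · simp only [cell, theta, Option.elim, if_true, Finset.mul_sum, res, Yobs]
    exact Finset.sum_congr rfl fun t _ => by ring
  · intro w _ hw; simp [cell, hw.symm]
  · simp

lemma fy_cell (t : Fin T) (i : Fin n) (ω : Ω) :
    fy t (D.cell Q πh mh i ω) = D.theta Q πh i ω * center (D.res mh i ω) t := by
  rw [fy_apply, Finset.sum_eq_single (D.W i ω)]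
  · simp only [cell, theta, Option.elim, if_true]
    exact center_const_mul _ _ _
  · intro w _ hw; simp [cell, hw.symm, center]
  · simp

lemma fθ_avgCell (ω : Ω) : fθ (D.avgCell Q πh mh ω) = D.Gθ Q πh ω := by
  simp [avgCell_eq, fθ_cell, Gθ, div_eq_inv_mul]

lemma fw_avgCell (t : Fin T) (ω : Ω) : fw t (D.avgCell Q πh mh ω) = D.Gw Q πh ω t := by
  simp [avgCell_eq, fw_cell, Gw, div_eq_inv_mul]

lemma fww_avgCell (ω : Ω) : fww (D.avgCell Q πh mh ω) = D.Gww Q πh ω := by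
  simp [avgCell_eq, fww_cell, Gww, div_eq_inv_mul]

lemma fwy_avgCell (ω : Ω) : fwy (D.avgCell Q πh mh ω) = D.Gwy Q πh mh ω := by
  simp [avgCell_eq, fwy_cell, Gwy, div_eq_inv_mul]

lemma fy_avgCell (t : Fin T) (ω : Ω) : fy t (D.avgCell Q πh mh ω) = D.Gy Q πh mh ω t := by
  simp [avgCell_eq, fy_cell, Gy, div_eq_inv_mul]

lemma formW_avgCell (ω : Ω) :
    formW (D.avgCell Q πh mh ω) (D.avgCell Q πh mh ω) = D.denom Q πh ω := by
  simp only [formW_apply, fθ_avgCell, fww_avgCell, fw_avgCell, denom, dot, mul_comm]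

/-- The influence term is the derivative of the quadratic form x ↦ B(x, x) at x, in the direction of
the cells of the unit. -/
lemma infl_eq (x : Cell T → ℝ) (τ : ℝ) (i : Fin n) (ω : Ω) :
    D.infl Q πh mh (fθ x) (fww x) (fwy x) (fun t => fw t x) (fun t => fy t x) τ i ω
      = form τ x (D.cell Q πh mh i ω) + form τ (D.cell Q πh mh i ω) x := by
  have h1 : center (fun t => D.res mh i ω t - τ * (D.W i ω).vec t)
      = fun t => center (D.res mh i ω) t - τ * center (D.W i ω).vec t := by
    ext t; rw [center_sub, center_const_mul]
  simp only [form_apply, formY_apply, formW_apply, fθ_cell, fww_cell, fwy_cell, fw_cell, fy_cell,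
    infl, h1, dot]
  simp only [mul_sub, sub_mul, Finset.sum_sub_distrib, mul_add]
  have h2 : ∀ (a : ℝ) (f g : Fin T → ℝ), ∑ t, f t * (a * g t) = a * ∑ t, f t * g t :=
    fun a f g => by rw [Finset.mul_sum]; exact Finset.sum_congr rfl fun t _ => by ring
  have h3 : ∀ (a : ℝ) (f g : Fin T → ℝ), ∑ t, a * f t * g t = a * ∑ t, g t * f t :=
    fun a f g => by rw [Finset.mul_sum]; exact Finset.sum_congr rfl fun t _ => by ring
  have h4 : ∑ t, center (D.W i ω).vec t * fw t x = ∑ t, fw t x * center (D.W i ω).vec t :=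
    Finset.sum_congr rfl fun t _ => mul_comm _ _
  simp only [h2, h3, h4]
  ring

lemma Vhat_eq (τ : ℝ) (i : Fin n) (ω : Ω) :
    D.Vhat Q πh mh τ i ω = form τ (D.avgCell Q πh mh ω) (D.cell Q πh mh i ω)
      + form τ (D.cell Q πh mh i ω) (D.avgCell Q πh mh ω) := by
  rw [← infl_eq, fθ_avgCell, fww_avgCell, fwy_avgCell]
  simp only [fw_avgCell, fy_avgCell]
  rfl

end Panel

/-! ### First-order conditions -/

lemma eq_zero_of_forall_nonneg_quadratic {a b : ℝ} (h : ∀ s : ℝ, 0 ≤ s * b + s ^ 2 * a) :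
    b = 0 := by
  have h1 := discrim_le_zero (a := a) (b := b) (c := 0) fun s => by
    have := h s
    nlinarith
  have h2 : b ^ 2 ≤ 0 := by simpa [discrim] using h1
  exact pow_eq_zero_iff two_ne_zero |>.1 (le_antisymm h2 (sq_nonneg b))

namespace Panel

variable {n T : ℕ} {Ω : Type*} (Q : Path T → ℝ) (D : Panel n T Ω) (πh : PropEst n T Ω)
  (mh : OutEst n T Ω)

/-- Vanishing derivative of the objective in an arbitrary direction. The objective is quadratic, so
no differentiation is needed, only the behavior of a parabola at its minimum. -/
lemma sum_residual_mul_eq_zero {ω : Ω} {τ μ : ℝ} {α : Fin n → ℝ} {γ : Fin T → ℝ}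
    (hα : ∑ i, α i = 0) (hγ : ∑ t, γ t = 0)
    (hmin : ∀ (τ₁ μ₁ : ℝ) (α₁ : Fin n → ℝ) (γ₁ : Fin T → ℝ), ∑ i, α₁ i = 0 → ∑ t, γ₁ t = 0 →
      D.objective Q πh mh ω τ μ α γ ≤ D.objective Q πh mh ω τ₁ μ₁ α₁ γ₁)
    (hn : 0 < n) (hT : 0 < T) (d : ℝ) (g : Fin n → ℝ) (h : Fin T → ℝ) :
    ∑ i, ∑ t, (D.res mh i ω t - μ - α i - γ t - (D.W i ω).vec t * τ)
      * (g i + h t + (D.W i ω).vec t * d) * D.theta Q πh i ω = 0 := by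
  have hn' : (n : ℝ) ≠ 0 := by exact_mod_cast hn.ne'
  have hT' : (T : ℝ) ≠ 0 := by exact_mod_cast hT.ne'
  set e : Fin n → Fin T → ℝ := fun i t =>
    D.res mh i ω t - μ - α i - γ t - (D.W i ω).vec t * τ with he
  set f : Fin n → Fin T → ℝ := fun i t => g i + h t + (D.W i ω).vec t * d with hf
  set θ := fun i => D.theta Q πh i ω
  have key : ∀ s : ℝ, 0 ≤ s * (-2 * ∑ i, ∑ t, e i t * f i t * θ i)
      + s ^ 2 * ∑ i, ∑ t, f i t ^ 2 * θ i := fun s => by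
    -- The direction (g, h) need not satisfy the sum constraints. It is recentered, and the removed
    -- means go into μ, so the fitted values still move by exactly s(g_i + h_t + W_it d).
    have := hmin (τ + s * d) (μ + s * ((∑ i, g i) / n + (∑ t, h t) / T))
      (fun i => α i + s * (g i - (∑ j, g j) / n)) (fun t => γ t + s * (h t - (∑ r, h r) / T))
      (by
        simp only [Finset.sum_add_distrib, hα, ← Finset.mul_sum, Finset.sum_sub_distrib]
        simp [mul_div_cancel₀ _ hn'])
      (by
        simp only [Finset.sum_add_distrib, hγ, ← Finset.mul_sum, Finset.sum_sub_distrib]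
        simp [mul_div_cancel₀ _ hT'])
    have h2 : D.objective Q πh mh ω (τ + s * d) (μ + s * ((∑ i, g i) / n + (∑ t, h t) / T))
        (fun i => α i + s * (g i - (∑ j, g j) / n)) (fun t => γ t + s * (h t - (∑ r, h r) / T))
        = D.objective Q πh mh ω τ μ α γ + (s * (-2 * ∑ i, ∑ t, e i t * f i t * θ i)
      + s ^ 2 * ∑ i, ∑ t, f i t ^ 2 * θ i) := by
      simp only [objective, Finset.mul_sum, ← Finset.sum_add_distrib]
      refine Finset.sum_congr rfl fun i _ => Finset.sum_congr rfl fun t _ => ?_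
      simp only [he, hf, θ]
      ring
    linarith
  have := eq_zero_of_forall_nonneg_quadratic key
  linarith

variable {Q D πh mh}

/-- The nuisance parameters are eliminated through the normal equations: the unit directions
determine μ + α_i, the time directions determine γ, and the direction of τ leaves one linear
equation for τ. -/
theorem IsEstimate.denom_mul {ω : Ω} {τ : ℝ} (h : D.IsEstimate Q πh mh ω τ) (hT : 0 < T) :
    D.denom Q πh ω * τ = formY (D.avgCell Q πh mh ω) (D.avgCell Q πh mh ω) := by
  rcases Nat.eq_zero_or_pos n with rfl | hn
  · have : D.avgCell Q πh mh ω = 0 := by ext c; simp [avgCell]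
    rw [← formW_avgCell Q D πh mh, this]
    simp
  have hn' : (n : ℝ) ≠ 0 := by exact_mod_cast hn.ne'
  have hT' : (T : ℝ) ≠ 0 := by exact_mod_cast hT.ne'
  obtain ⟨μ, α, γ, hα, hγ, hmin⟩ := h
  have hfoc := D.sum_residual_mul_eq_zero Q πh mh hα hγ hmin hn hT
  set θ := fun i => D.theta Q πh i ω with hθ
  set y := fun i => D.res mh i ω with hy
  set W := fun i => (D.W i ω).vec with hW
  -- The factor θ_i is kept on both sides, because a unit with zero weight leaves α_i undetermined.
  have ha : ∀ i, θ i * (μ + α i) = θ i * ((∑ t, y i t) / T - τ * ((∑ t, W i t) / T)) := fun i => by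
    have h1 := hfoc 0 (Pi.single i 1) 0
    rw [Finset.sum_eq_single i (fun j _ hj => by simp [hj]) (by simp)] at h1
    simp only [Pi.single_eq_same, Pi.zero_apply, mul_zero, add_zero, mul_one, ← Finset.sum_mul,
      Finset.sum_sub_distrib, hγ] at h1
    simp only [Finset.sum_const, Finset.card_univ, Fintype.card_fin, nsmul_eq_mul] at h1
    simp only [hθ, hy, hW]
    field_simp
    linarith
  have he : ∀ i t, (y i t - μ - α i - γ t - W i t * τ) * θ i
      = θ i * center (y i) t - τ * (θ i * center (W i) t) - γ t * θ i := fun i t => by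
    have := ha i
    simp only [center]
    linear_combination -this
  have hb : ∀ t, fy t (D.avgCell Q πh mh ω) - τ * fw t (D.avgCell Q πh mh ω)
      = γ t * fθ (D.avgCell Q πh mh ω) := fun t => by
    have h1 := hfoc 0 0 (Pi.single t 1)
    simp only [Pi.zero_apply, mul_zero, add_zero, zero_add] at h1
    have h2 : ∑ i, (θ i * center (y i) t - τ * (θ i * center (W i) t) - γ t * θ i) = 0 := by
      rw [← h1]
      refine Finset.sum_congr rfl fun i _ => ?_
      rw [Finset.sum_eq_single t (fun s _ hs => by simp [hs]) (by simp), ← he]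
      simp [hy, hW, hθ]
    rw [fy_avgCell, fw_avgCell, fθ_avgCell, Gy, Gw, Gθ]
    simp only [Finset.sum_sub_distrib, ← Finset.mul_sum] at h2
    field_simp
    simp only [hθ, hy, hW] at h2
    linarith
  have hc : fwy (D.avgCell Q πh mh ω) - τ * fww (D.avgCell Q πh mh ω)
      = ∑ t, γ t * fw t (D.avgCell Q πh mh ω) := by
    have h1 := hfoc 1 0 0
    simp only [Pi.zero_apply, add_zero, zero_add, mul_one] at h1
    have h2 : ∀ i, ∑ t, (y i t - μ - α i - γ t - W i t * τ) * W i t * θ i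
        = θ i * dot (W i) (center (y i)) - τ * (θ i * dot (W i) (center (W i)))
          - ∑ t, γ t * (θ i * center (W i) t) := fun i => by
      have h3 : ∑ t, γ t * (θ i * center (W i) t) = ∑ t, γ t * (θ i * W i t) := by
        simp only [center, mul_sub, Finset.sum_sub_distrib]
        rw [← Finset.sum_mul, hγ]
        simp
      rw [h3]
      simp only [dot, Finset.mul_sum, ← Finset.sum_sub_distrib]
      refine Finset.sum_congr rfl fun t _ => ?_
      have := he i t
      linear_combination W i t * this
    have h4 : ∑ i, (θ i * dot (W i) (center (y i)) - τ * (θ i * dot (W i) (center (W i)))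
          - ∑ t, γ t * (θ i * center (W i) t)) = 0 := by
      rw [← h1]
      exact Finset.sum_congr rfl fun i _ => (h2 i).symm
    rw [fwy_avgCell, fww_avgCell]
    simp_rw [fw_avgCell, Gwy, Gww, Gw]
    simp only [Finset.sum_sub_distrib, ← Finset.mul_sum] at h4
    rw [Finset.sum_comm] at h4
    simp only [← Finset.mul_sum] at h4
    simp only [hθ, hy, hW] at h4
    simp only [mul_div_assoc', ← Finset.sum_div]
    field_simp
    linarith
  rw [← formW_avgCell Q D πh mh, formY_apply, formW_apply]
  have hd : ∑ t, fw t (D.avgCell Q πh mh ω) * fy t (D.avgCell Q πh mh ω)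
      = (∑ t, γ t * fw t (D.avgCell Q πh mh ω)) * fθ (D.avgCell Q πh mh ω)
        + τ * ∑ t, fw t (D.avgCell Q πh mh ω) * fw t (D.avgCell Q πh mh ω) := by
    rw [Finset.sum_mul, Finset.mul_sum, ← Finset.sum_add_distrib]
    refine Finset.sum_congr rfl fun t _ => ?_
    linear_combination fw t (D.avgCell Q πh mh ω) * hb t
  rw [hd, ← hc]
  ring

end Panel

/-! ### The bias of the numerator form -/

section Bias

variable {n T : ℕ}

/-- Two-way effects are invisible to the form: centering over time removes a_i, the contributions of
b_t to the two products cancel, and `form τ` subtracts the effect τ. The vector u is free, since its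
contributions to the two products also cancel; it will be the mean path under Π. -/
lemma form_weighted_avg {x : Cell T → ℝ} {p : Fin n → Path T → ℝ} {h : Fin n → Path T → Fin T → ℝ}
    {a : Fin n → ℝ} {b : Fin T → ℝ} {τ : ℝ}
    (hx₀ : ∀ w, x (w, none) = (∑ i, p i w) / n)
    (hx₁ : ∀ w t, x (w, some t) = (∑ i, p i w * (h i w t + a i + b t + τ * w.vec t)) / n)
    (u : Fin T → ℝ) :
    form τ x x = (∑ w, (∑ i, p i w) / n)
        * (∑ w, (∑ i, p i w * ∑ t, center (fun s => w.vec s - u s) t * h i w t) / n)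
      - ∑ t, (∑ w : Path T, center (fun s => w.vec s - u s) t * ((∑ i, p i w) / n))
        * ∑ w, (∑ i, p i w * center (h i w) t) / n := by
  set pm : Path T → ℝ := fun w => (∑ i, p i w) / n with hp
  set H : Path T → Fin T → ℝ := fun w t => (∑ i, p i w * h i w t) / n with hH
  set A : Path T → ℝ := fun w => (∑ i, p i w * a i) / n with hA
  have hx₁' : ∀ w t, x (w, some t) = H w t + A w + pm w * b t + τ * (pm w * w.vec t) := fun w t => by
    rw [hx₁]
    simp only [hH, hA, hp, mul_add, Finset.sum_add_distrib, add_div]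
    simp only [← mul_assoc, mul_comm _ τ, ← Finset.sum_mul]
    simp only [mul_assoc, ← Finset.mul_sum]
    ring
  have hJH : ∀ w t, (∑ i, p i w * center (h i w) t) / n = center (H w) t := fun w t => by
    simp only [hH, center, mul_sub, Finset.sum_sub_distrib, sub_div, ← Finset.sum_div]
    congr 1
    rw [Finset.sum_comm]
    simp only [mul_div_assoc', Finset.mul_sum, Finset.sum_div]
    refine Finset.sum_congr rfl fun i _ => Finset.sum_congr rfl fun s _ => ?_
    rw [div_right_comm]
  have hJH' : ∀ w (v : Fin T → ℝ), (∑ i, p i w * ∑ t, v t * h i w t) / n = ∑ t, v t * H w t :=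
    fun w v => by
    simp only [hH, Finset.mul_sum, mul_div_assoc', ← Finset.sum_div]
    rw [Finset.sum_comm]
    congr 1
    refine Finset.sum_congr rfl fun i _ => Finset.sum_congr rfl fun s _ => ?_
    ring
  have hpm : ∀ w, (∑ i, p i w) / n = pm w := fun _ => rfl
  simp_rw [hJH, hJH', center_sub, hpm] at hx₀ ⊢
  rw [form_apply, formY_apply, formW_apply, fθ_apply, fwy_apply, fww_apply]
  simp_rw [fw_apply, fy_apply, hx₀, hx₁']
  have hy : ∀ w : Path T, ∀ t, center (fun s => H w s + A w + pm w * b s + τ * (pm w * w.vec s)) t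
      = center (H w) t + pm w * center b t + τ * (pm w * center w.vec t) := fun w t => by
    rw [center_add, center_add, center_add, center_const, center_const_mul, center_const_mul,
      center_const_mul]
    ring
  simp_rw [hy]
  set Θ := ∑ w, pm w with hΘ
  set V : Fin T → ℝ := fun t => ∑ w : Path T, center w.vec t * pm w with hV
  set k : Fin T → ℝ := fun t => ∑ w, center (H w) t with hk
  have hV0 : ∑ t, V t = 0 := by
    simp only [hV]
    rw [Finset.sum_comm]
    simp_rw [← Finset.sum_mul, sum_center]
    simp
  -- the four sums
  have s1 : ∑ w : Path T, ∑ t, center w.vec t * (H w t + A w + pm w * b t + τ * (pm w * w.vec t))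
      = (∑ w : Path T, ∑ t, center w.vec t * H w t) + ∑ t, V t * b t
        + τ * ∑ w : Path T, dot w.vec (center w.vec) * pm w := by
    have : ∀ w : Path T, ∑ t, center w.vec t * A w = 0 := fun w => by
      rw [← Finset.sum_mul, sum_center, zero_mul]
    simp only [mul_add, Finset.sum_add_distrib, this, add_zero]
    congr 1
    · congr 1
      simp only [hV, Finset.sum_mul]
      rw [Finset.sum_comm]
      exact Finset.sum_congr rfl fun t _ => Finset.sum_congr rfl fun w _ => by ring
    · simp only [dot_center, Finset.mul_sum, Finset.sum_mul]
      exact Finset.sum_congr rfl fun t _ => Finset.sum_congr rfl fun w _ => by ring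
  have s2 : ∀ t, ∑ w : Path T, (center (H w) t + pm w * center b t + τ * (pm w * center w.vec t))
      = k t + Θ * center b t + τ * V t := fun t => by
    simp only [Finset.sum_add_distrib, hk, hΘ, hV, ← Finset.sum_mul, ← Finset.mul_sum]
    congr 2
    exact Finset.sum_congr rfl fun w _ => mul_comm _ _
  have s3 : ∑ t, V t * center b t = ∑ t, V t * b t := by
    simp only [center, mul_sub, Finset.sum_sub_distrib, ← Finset.sum_mul, hV0]
    ring
  have s4 : ∀ t, ∑ w : Path T, (center w.vec t - center u t) * pm w = V t - center u t * Θ :=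
    fun t => by
    simp only [sub_mul, Finset.sum_sub_distrib, hV, hΘ, Finset.mul_sum]
  have s5 : ∑ t, center u t * k t = ∑ w : Path T, ∑ t, center u t * H w t := by
    simp only [hk, Finset.mul_sum]
    rw [Finset.sum_comm]
    exact Finset.sum_congr rfl fun w _ => sum_center_mul_center u (H w)
  have hVt : ∀ t, ∑ w : Path T, center w.vec t * pm w = V t := fun t => rfl
  have hkt : ∀ t, ∑ w, center (H w) t = k t := fun t => rfl
  rw [s1]
  simp_rw [s2, s4, hVt, hkt]
  simp only [sub_mul, mul_add, Finset.sum_sub_distrib, Finset.sum_add_distrib]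
  have s6 : ∀ c : ℝ, ∀ f g : Fin T → ℝ, ∑ t, f t * (c * g t) = c * ∑ t, f t * g t :=
    fun c f g => by rw [Finset.mul_sum]; exact Finset.sum_congr rfl fun t _ => by ring
  have s7 : ∑ t, center u t * Θ * k t = Θ * ∑ t, center u t * k t := by
    rw [Finset.mul_sum]; exact Finset.sum_congr rfl fun t _ => by ring
  simp only [s6, s7, s3, s5]
  ring

end Bias

/-! ### Size of the bias under the DATE equation. -/

section BiasBound

variable {n T : ℕ}

lemma abs_meanPath_le {Q : Path T → ℝ} (hQ0 : ∀ w, 0 ≤ Q w) (hQ1 : ∑ w, Q w = 1) (t : Fin T) :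
    |meanPath Q t| ≤ 1 := by
  unfold meanPath
  refine (Finset.abs_sum_le_sum_abs _ _).trans ?_
  rw [← hQ1]
  refine Finset.sum_le_sum fun w _ => ?_
  rw [abs_mul, abs_of_nonneg (hQ0 w)]
  exact mul_le_of_le_one_right (hQ0 w) (w.abs_vec_le t)

lemma sum_mul_center_sub_meanPath {Q : Path T → ℝ} (hQ1 : ∑ w, Q w = 1) (t : Fin T) :
    ∑ w : Path T, Q w * center (fun s => w.vec s - meanPath Q s) t = 0 := by
  have h1 : ∀ s, ∑ w : Path T, Q w * (w.vec s - meanPath Q s) = 0 := fun s => by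
    simp only [mul_sub, Finset.sum_sub_distrib, ← Finset.sum_mul, hQ1, meanPath]
    ring
  simp only [center, mul_sub (Q _) (_ - _) (_ / _), Finset.sum_sub_distrib, h1, zero_sub]
  simp only [mul_div_assoc', ← Finset.sum_div, Finset.mul_sum, ← Finset.sum_sub_distrib]
  rw [Finset.sum_comm]
  simp [h1]

lemma avg_mul_avg_le (f g : Fin n → ℝ) :
    ((∑ i, f i) / n) * ((∑ i, g i) / n) ≤ √((∑ i, f i ^ 2) / n) * √((∑ i, g i ^ 2) / n) := by
  have h : ∀ f : Fin n → ℝ, |(∑ i, f i) / n| ≤ √((∑ i, f i ^ 2) / n) := fun f => by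
    refine Real.abs_le_sqrt ?_
    rcases Nat.eq_zero_or_pos n with rfl | hn
    · simp
    · have hn' : (0 : ℝ) < n := by exact_mod_cast hn
      have := sq_sum_le_card_mul_sum_sq (s := (Finset.univ : Finset (Fin n))) (f := f)
      rw [Finset.card_univ, Fintype.card_fin] at this
      rw [div_pow, div_le_div_iff₀ (by positivity) hn']
      nlinarith
  calc _ ≤ |(∑ i, f i) / n| * |(∑ i, g i) / n| := by rw [← abs_mul]; exact le_abs_self _
    _ ≤ _ := mul_le_mul (h f) (h g) (abs_nonneg _) (Real.sqrt_nonneg _)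

lemma avg_mul_le (f g : Fin n → ℝ) :
    (∑ i, f i * g i) / n ≤ √((∑ i, f i ^ 2) / n) * √((∑ i, g i ^ 2) / n) := by
  rw [Real.sqrt_div' _ (Nat.cast_nonneg n), Real.sqrt_div' _ (Nat.cast_nonneg n), div_mul_div_comm,
    Real.mul_self_sqrt (Nat.cast_nonneg n)]
  exact div_le_div_of_nonneg_right (Real.sum_mul_le_sqrt_mul_sqrt _ _ _) (Nat.cast_nonneg n)

/-- With c_w = J(w - E_Π W), both products contain a factor that vanishes when p_i is replaced by Π:
the second because Σ_w Π(w) c_w = 0, the first by the DATE equation. Subtracting these zeros puts a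
weight error ρ_i next to an outcome error β_i in the first product, and the average of ρ next to the
average of β in the second. Cauchy–Schwarz over the units then applies. -/
theorem abs_form_bias_le {Q : Path T → ℝ} {ξ : Fin T → ℝ} (hQ0 : ∀ w, 0 ≤ Q w)
    (hQ1 : ∑ w, Q w = 1) (hDATE : DATEEquation Q ξ) (hn : 0 < n)
    {x : Cell T → ℝ} {p : Fin n → Path T → ℝ} {e δ : Fin n → Fin T → ℝ}
    {a : Fin n → ℝ} {b : Fin T → ℝ} {τ c₀ : ℝ}
    (hx₀ : ∀ w, x (w, none) = (∑ i, p i w) / n)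
    (hx₁ : ∀ w t, x (w, some t)
      = (∑ i, p i w * ((e i t + w.vec t * δ i t) + a i + b t + τ * w.vec t)) / n)
    (hδ : ∑ t, ξ t * ∑ i, δ i t = 0) (hp0 : ∀ i w, 0 ≤ p i w) (hp : ∀ i, ∑ w, p i w ≤ c₀) :
    |form τ x x| ≤ (4 + 8 * T) * c₀ * (√((∑ i, (∑ w, |p i w - Q w|) ^ 2) / n)
      * √((∑ i, (∑ t, (|e i t| + |δ i t|)) ^ 2) / n)) := by
  have hn' : (0 : ℝ) < n := by exact_mod_cast hn
  have hc₀ : 0 ≤ c₀ := (Finset.sum_nonneg fun w _ => hp0 ⟨0, hn⟩ w).trans (hp ⟨0, hn⟩)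
  set h : Fin n → Path T → Fin T → ℝ := fun i w t => e i t + w.vec t * δ i t with hh
  set c : Path T → Fin T → ℝ := fun w t => center (fun s => w.vec s - meanPath Q s) t with hc
  set ρ : Fin n → ℝ := fun i => ∑ w, |p i w - Q w| with hρ
  set β : Fin n → ℝ := fun i => ∑ t, (|e i t| + |δ i t|) with hβ
  have hρ0 : ∀ i, 0 ≤ ρ i := fun i => Finset.sum_nonneg fun w _ => abs_nonneg _
  have hβ0 : ∀ i, 0 ≤ β i := fun i => Finset.sum_nonneg fun w _ => by positivity
  -- The entries of w minus the mean path are at most 2 in absolute value, and centering at most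
  -- doubles this.
  have hcb : ∀ w t, |c w t| ≤ 4 := fun w t => by
    refine (abs_center_le (B := 2) (fun s => ?_) t).trans (by norm_num)
    refine (abs_sub _ _).trans ?_
    linarith [w.abs_vec_le s, abs_meanPath_le hQ0 hQ1 s]
  have hht : ∀ i w t, |h i w t| ≤ |e i t| + |δ i t| := fun i w t => by
    refine (abs_add_le _ _).trans ?_
    rw [abs_mul]
    gcongr
    exact mul_le_of_le_one_left (abs_nonneg _) (w.abs_vec_le t)
  have hhβ : ∀ i w t, |h i w t| ≤ β i := fun i w t => (hht i w t).trans
    (Finset.single_le_sum (f := fun t => |e i t| + |δ i t|)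
      (fun s _ => by positivity) (Finset.mem_univ t))
  have hQc : ∀ t, ∑ w, Q w * c w t = 0 := sum_mul_center_sub_meanPath hQ1
  rw [form_weighted_avg hx₀ hx₁ (meanPath Q)]
  have hmass : |∑ w, (∑ i, p i w) / (n : ℝ)| ≤ c₀ := by
    rw [abs_of_nonneg (Finset.sum_nonneg fun w _ =>
      div_nonneg (Finset.sum_nonneg fun i _ => hp0 i w) hn'.le), ← Finset.sum_div, Finset.sum_comm,
      div_le_iff₀ hn']
    refine (Finset.sum_le_sum fun i _ => hp i).trans ?_
    simp [mul_comm]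
  have hg : ∀ i w, |∑ t, c w t * h i w t| ≤ 4 * β i := fun i w => by
    refine (Finset.abs_sum_le_sum_abs _ _).trans ?_
    rw [hβ, Finset.mul_sum]
    refine Finset.sum_le_sum fun t _ => ?_
    rw [abs_mul]
    exact mul_le_mul (hcb w t) (hht i w t) (abs_nonneg _) (by norm_num)
  -- The baseline errors e drop out because c has mean zero under Π. By DATE, the heterogeneity δ
  -- enters only through Σ_t ξ_t δ_it, whose sum over the units is zero.
  have hQg : ∑ w, ∑ i, Q w * ∑ t, c w t * h i w t = 0 := by
    have h1 : ∀ t, ∑ w, Q w * (c w t * w.vec t) = ξ t * ∑ w, Q w * dot w.vec (c w) := fun t => by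
      have := hDATE t
      simp only [mul_sub, Finset.sum_sub_distrib, sub_eq_zero] at this
      rw [Finset.mul_sum]
      calc _ = _ := Finset.sum_congr rfl fun w _ => by rw [mul_comm (c w t)]; rfl
        _ = _ := this
        _ = _ := Finset.sum_congr rfl fun w _ => by rw [mul_left_comm]; rfl
    have h2 : ∀ i, ∑ w, Q w * ∑ t, c w t * h i w t
        = (∑ t, ξ t * δ i t) * ∑ w, Q w * dot w.vec (c w) := fun i => by
      calc ∑ w, Q w * ∑ t, c w t * h i w t
          = ∑ t, (e i t * ∑ w, Q w * c w t + δ i t * ∑ w, Q w * (c w t * w.vec t)) := by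
            simp only [Finset.mul_sum, ← Finset.sum_add_distrib]
            rw [Finset.sum_comm]
            refine Finset.sum_congr rfl fun t _ => Finset.sum_congr rfl fun w _ => ?_
            simp only [hh]; ring
        _ = _ := by
            simp only [hQc, h1, mul_zero, zero_add]
            rw [Finset.sum_mul]
            exact Finset.sum_congr rfl fun t _ => by ring
    rw [Finset.sum_comm]
    simp_rw [h2, ← Finset.sum_mul]
    rw [Finset.sum_comm]
    simp_rw [← Finset.mul_sum, hδ, zero_mul]
  have hH : |∑ w, (∑ i, p i w * ∑ t, c w t * h i w t) / (n : ℝ)|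
      ≤ 4 * ((∑ i, ρ i * β i) / n) := by
    have h1 : ∑ w, (∑ i, p i w * ∑ t, c w t * h i w t) / (n : ℝ)
        = (∑ i, ∑ w, (p i w - Q w) * ∑ t, c w t * h i w t) / n := by
      rw [← Finset.sum_div, Finset.sum_comm (γ := Fin n)]
      simp only [sub_mul, Finset.sum_sub_distrib]
      rw [hQg, sub_zero]
    rw [h1, abs_div, Nat.abs_cast, mul_div_assoc']
    refine div_le_div_of_nonneg_right ?_ hn'.le
    rw [Finset.mul_sum]
    refine (Finset.abs_sum_le_sum_abs _ _).trans (Finset.sum_le_sum fun i _ => ?_)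
    refine (Finset.abs_sum_le_sum_abs _ _).trans ?_
    rw [hρ, mul_left_comm, Finset.sum_mul]
    refine Finset.sum_le_sum fun w _ => ?_
    rw [abs_mul]
    exact mul_le_mul_of_nonneg_left (hg i w) (abs_nonneg _)
  have hu : ∀ t, |∑ w, c w t * ((∑ i, p i w) / (n : ℝ))| ≤ 4 * ((∑ i, ρ i) / n) := fun t => by
    have h1 : ∑ w, c w t * ((∑ i, p i w) / (n : ℝ))
        = (∑ i, ∑ w, c w t * (p i w - Q w)) / n := by
      have h2 : ∑ w, c w t * Q w = 0 := by
        rw [← hQc t]; exact Finset.sum_congr rfl fun w _ => mul_comm _ _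
      simp only [mul_sub, Finset.sum_sub_distrib, h2, sub_zero]
      rw [Finset.sum_comm, Finset.sum_div]
      exact Finset.sum_congr rfl fun w _ => by rw [← Finset.mul_sum, mul_div_assoc]
    rw [h1, abs_div, Nat.abs_cast, mul_div_assoc']
    refine div_le_div_of_nonneg_right ?_ hn'.le
    rw [Finset.mul_sum]
    refine (Finset.abs_sum_le_sum_abs _ _).trans (Finset.sum_le_sum fun i _ => ?_)
    refine (Finset.abs_sum_le_sum_abs _ _).trans ?_
    rw [hρ, Finset.mul_sum]
    refine Finset.sum_le_sum fun w _ => ?_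
    rw [abs_mul]
    exact mul_le_mul_of_nonneg_right (hcb w t) (abs_nonneg _)
  have hk : ∀ t, |∑ w, (∑ i, p i w * center (h i w) t) / (n : ℝ)|
      ≤ 2 * c₀ * ((∑ i, β i) / n) := fun t => by
    rw [← Finset.sum_div, Finset.sum_comm, abs_div, Nat.abs_cast, mul_div_assoc']
    refine div_le_div_of_nonneg_right ?_ hn'.le
    rw [Finset.mul_sum]
    refine (Finset.abs_sum_le_sum_abs _ _).trans (Finset.sum_le_sum fun i _ => ?_)
    calc |∑ w, p i w * center (h i w) t| ≤ ∑ w, p i w * (2 * β i) := by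
          refine (Finset.abs_sum_le_sum_abs _ _).trans (Finset.sum_le_sum fun w _ => ?_)
          rw [abs_mul, abs_of_nonneg (hp0 i w)]
          exact mul_le_mul_of_nonneg_left (abs_center_le (hhβ i w) t) (hp0 i w)
      _ ≤ 2 * c₀ * β i := by
          rw [← Finset.sum_mul]
          nlinarith [mul_le_mul_of_nonneg_right (hp i) (hβ0 i)]
  have hρm : 0 ≤ (∑ i, ρ i) / (n : ℝ) := div_nonneg (Finset.sum_nonneg fun i _ => hρ0 i) hn'.le
  set R := √((∑ i, ρ i ^ 2) / n) * √((∑ i, β i ^ 2) / n) with hR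
  have b1 : (∑ i, ρ i * β i) / n ≤ R := avg_mul_le ρ β
  have b2 : (∑ i, ρ i) / n * ((∑ i, β i) / n) ≤ R := avg_mul_avg_le ρ β
  calc _ ≤ c₀ * (4 * ((∑ i, ρ i * β i) / n))
        + ∑ t : Fin T, 4 * ((∑ i, ρ i) / n) * (2 * c₀ * ((∑ i, β i) / n)) := by
        refine (abs_sub _ _).trans (add_le_add ?_ ?_)
        · rw [abs_mul]
          exact mul_le_mul hmass hH (abs_nonneg _) hc₀
        · refine (Finset.abs_sum_le_sum_abs _ _).trans (Finset.sum_le_sum fun t _ => ?_)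
          rw [abs_mul]
          exact mul_le_mul (hu t) (hk t) (abs_nonneg _) (by positivity)
    _ = 4 * c₀ * ((∑ i, ρ i * β i) / n)
        + 8 * T * c₀ * ((∑ i, ρ i) / n * ((∑ i, β i) / n)) := by
        rw [Finset.sum_const, Finset.card_univ, Fintype.card_fin, nsmul_eq_mul]; ring
    _ ≤ 4 * c₀ * R + 8 * T * c₀ * R := by gcongr
    _ = _ := by ring

end BiasBound

lemma AEBdd.norm_pi {Ω ι : Type*} [MeasurableSpace Ω] [Fintype ι] {P : Measure Ω}
    {X : Ω → ι → ℝ} (h : ∀ c, AEBdd P fun ω => X ω c) : AEBdd P fun ω => ‖X ω‖ := by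
  refine ⟨(measurable_pi_iff.2 fun c => (h c).measurable).norm, ?_⟩
  choose C hC using fun c => (h c).2
  refine ⟨∑ c, |C c|, ?_⟩
  filter_upwards [ae_all_iff.2 hC] with ω hω
  rw [abs_norm]
  refine (pi_norm_le_iff_of_nonneg (Finset.sum_nonneg fun c _ => abs_nonneg _)).2 fun c => ?_
  exact ((hω c).trans (le_abs_self _)).trans
    (Finset.single_le_sum (f := fun c => |C c|) (fun c _ => abs_nonneg _) (Finset.mem_univ c))

lemma sq_norm_le_sum_sq {ι : Type*} [Fintype ι] (x : ι → ℝ) : ‖x‖ ^ 2 ≤ ∑ c, x c ^ 2 := by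
  have h0 : 0 ≤ ∑ c, x c ^ 2 := Finset.sum_nonneg fun c _ => sq_nonneg _
  have : ‖x‖ ≤ √(∑ c, x c ^ 2) := by
    refine (pi_norm_le_iff_of_nonneg (Real.sqrt_nonneg _)).2 fun c => ?_
    refine Real.abs_le_sqrt ?_
    exact Finset.single_le_sum (f := fun c => x c ^ 2) (fun c _ => sq_nonneg _) (Finset.mem_univ c)
  calc ‖x‖ ^ 2 ≤ √(∑ c, x c ^ 2) ^ 2 := by gcongr
    _ = _ := Real.sq_sqrt h0

/-! ### Panels of fixed size: noise and drift of the cells. -/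

namespace Panel

variable {n T K : ℕ} {Ω : Type*} [MeasurableSpace Ω]

/-- The conditions of the theorem for a fixed number of units, with explicit constants. -/
structure Regular (P : Measure Ω) (D : Panel n T Ω) (S : Finset (Path T)) (Q : Path T → ℝ)
    (fold : Fin n → Fin K) (πh : PropEst n T Ω) (mh : OutEst n T Ω) (π' : Fin n → Path T → ℝ)
    (m' : Fin n → Fin T → ℝ) (c M : ℝ) : Prop where
  measurable_Y : ∀ a i, Measurable (D.Y a i)
  measurable_W : ∀ i, Measurable (D.W i)
  reshaped : IsReshaped S Q
  indep : iIndepFun (fun i => D.unit i) P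
  ignorable : D.LatentMeanIgnorable P
  prop_measurable : ∀ i w, Measurable[D.outOfFold fold i] fun ω => πh i ω w
  out_measurable : ∀ i t, Measurable[D.outOfFold fold i] fun ω => mh i ω t
  c_pos : 0 < c
  c_le : c ≤ 1
  one_le_M : 1 ≤ M
  est_mem : ∀ i, ∀ᵐ ω ∂P, ∀ w, 0 ≤ πh i ω w ∧ πh i ω w ≤ 1
  est_gt : ∀ i, ∀ᵐ ω ∂P, ∀ w ∈ S, c < πh i ω w
  prop_gt : ∀ i, ∀ w ∈ S, c < D.prop P i w
  lim_mem : ∀ i w, 0 ≤ π' i w ∧ π' i w ≤ 1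
  lim_gt : ∀ i, ∀ w ∈ S, c < π' i w
  bdd : ∀ i, ∀ᵐ ω ∂P, ∀ a t, |D.Y a i ω t - mh i ω t| ≤ M
  bdd_lim : ∀ i, ∀ᵐ ω ∂P, ∀ a t, |D.Y a i ω t - m' i t| ≤ M

/-- The mean `E[Y_it(a)]`. -/
def meanY (P : Measure Ω) (D : Panel n T Ω) (a : Bool) (i : Fin n) (t : Fin T) : ℝ :=
  ∫ ω, D.Y a i ω t ∂P

/-- The mean contribution of a unit to the cells, for given values of the estimates. -/
def cellMean (P : Measure Ω) (Q : Path T → ℝ) (D : Panel n T Ω) (i : Fin n) (p : Path T → ℝ)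
    (m : Fin T → ℝ) : Cell T → ℝ := fun c =>
  D.prop P i c.1 * (Q c.1 / p c.1) * c.2.elim 1 fun t => D.meanY P (c.1 t) i t - m t

/-- The cell averages of the mean contributions. -/
def avgCellMean (P : Measure Ω) (Q : Path T → ℝ) (D : Panel n T Ω) (πh : PropEst n T Ω)
    (mh : OutEst n T Ω) (ω : Ω) : Cell T → ℝ := fun c =>
  (∑ i, D.cellMean P Q i (πh i ω) (mh i ω) c) / n

/-- The centered indicator that unit `i` follows the path `w`. -/
def indC (P : Measure Ω) (D : Panel n T Ω) (w : Path T) (i : Fin n) (ω : Ω) : ℝ :=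
  (if D.W i ω = w then 1 else 0) - D.prop P i w

/-- The centered outcome of unit `i` relative to `m`, restricted to the path `w`. -/
def outC (P : Measure Ω) (D : Panel n T Ω) (m : Fin n → Fin T → ℝ) (w : Path T) (t : Fin T)
    (i : Fin n) (ω : Ω) : ℝ :=
  (if D.W i ω = w then D.Y (w t) i ω t - m i t else 0)
    - D.prop P i w * (D.meanY P (w t) i t - m i t)

/-- The distance of estimates from their deterministic limits. -/
def disc (S : Finset (Path T)) (πh : PropEst n T Ω) (mh : OutEst n T Ω) (π' : Fin n → Path T → ℝ)
    (m' : Fin n → Fin T → ℝ) (i : Fin n) (ω : Ω) : ℝ :=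
  ∑ w ∈ S, |πh i ω w - π' i w| + ∑ t, |mh i ω t - m' i t|

section Decomposition

variable (P : Measure Ω) (D : Panel n T Ω) (Q : Path T → ℝ) (πh : PropEst n T Ω)
  (mh : OutEst n T Ω) (m' : Fin n → Fin T → ℝ)

lemma cell_sub_cellMean_none (w : Path T) (i : Fin n) (ω : Ω) :
    D.cell Q πh mh i ω (w, none) - D.cellMean P Q i (πh i ω) (mh i ω) (w, none)
      = D.indC P w i ω * (Q w / πh i ω w) := by
  simp only [cell, cellMean, indC, Option.elim]
  split_ifs <;> ring

/-- The outcomes are centered at the deterministic m' rather than at m̂, so that `outC` is a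
function of the unit alone. The discrepancy m̂ - m' moves to the out-of-fold factor of the second
term. -/
lemma cell_sub_cellMean_some (w : Path T) (t : Fin T) (i : Fin n) (ω : Ω) :
    D.cell Q πh mh i ω (w, some t) - D.cellMean P Q i (πh i ω) (mh i ω) (w, some t)
      = D.outC P m' w t i ω * (Q w / πh i ω w)
        - D.indC P w i ω * (Q w / πh i ω w * (mh i ω t - m' i t)) := by
  simp only [cell, cellMean, indC, outC, Option.elim]
  split_ifs <;> ring

end Decomposition

namespace Regular

variable {P : Measure Ω} [IsProbabilityMeasure P] {D : Panel n T Ω} {S : Finset (Path T)}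
  {Q : Path T → ℝ} {fold : Fin n → Fin K} {πh : PropEst n T Ω} {mh : OutEst n T Ω}
  {π' : Fin n → Path T → ℝ} {m' : Fin n → Fin T → ℝ} {c M : ℝ}
  (R : D.Regular P S Q fold πh mh π' m' c M)

include R

lemma measurable_unit (i : Fin n) : Measurable (D.unit i) :=
  (measurable_pi_iff.2 fun a => R.measurable_Y a i).prodMk (R.measurable_W i)

lemma measurableSet_W_eq (i : Fin n) (w : Path T) : MeasurableSet {ω | D.W i ω = w} :=
  R.measurable_W i (measurableSet_singleton w)

lemma measurable_Y_apply (a : Bool) (i : Fin n) (t : Fin T) : Measurable fun ω => D.Y a i ω t :=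
  (measurable_pi_apply t).comp (R.measurable_Y a i)

lemma measurable_prop (i : Fin n) (w : Path T) : Measurable fun ω => πh i ω w :=
  (R.prop_measurable i w).mono (outOfFold_le R.measurable_unit fold i) le_rfl

lemma measurable_out (i : Fin n) (t : Fin T) : Measurable fun ω => mh i ω t :=
  (R.out_measurable i t).mono (outOfFold_le R.measurable_unit fold i) le_rfl

lemma Q_nonneg (w : Path T) : 0 ≤ Q w := by
  by_cases h : w ∈ S
  · exact (R.reshaped.1 w h).le
  · exact (R.reshaped.2.1 w h).ge

lemma Q_le_one (w : Path T) : Q w ≤ 1 := by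
  rw [← R.reshaped.2.2]
  exact Finset.single_le_sum (fun w _ => R.Q_nonneg w) (Finset.mem_univ w)

omit R in
lemma prop_nonneg (i : Fin n) (w : Path T) : 0 ≤ D.prop P i w := measureReal_nonneg

omit R in
lemma prop_le_one (i : Fin n) (w : Path T) : D.prop P i w ≤ 1 := measureReal_le_one

lemma aebdd_Y (a : Bool) (i : Fin n) (t : Fin T) : AEBdd P fun ω => D.Y a i ω t := by
  refine ⟨R.measurable_Y_apply a i t, M + |m' i t|, ?_⟩
  filter_upwards [R.bdd_lim i] with ω h
  have := abs_add_le (D.Y a i ω t - m' i t) (m' i t)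
  rw [sub_add_cancel] at this
  linarith [h a t]

lemma abs_meanY_sub_le (a : Bool) (i : Fin n) (t : Fin T) : |D.meanY P a i t - m' i t| ≤ M := by
  have h : D.meanY P a i t - m' i t = ∫ ω, (D.Y a i ω t - m' i t) ∂P := by
    rw [integral_sub (R.aebdd_Y a i t).integrable (integrable_const _)]
    simp [meanY]
  rw [h]
  have := norm_integral_le_of_norm_le_const (μ := P) (f := fun ω => D.Y a i ω t - m' i t) (C := M)
    (by filter_upwards [R.bdd_lim i] with ω h using h a t)
  simpa using this

lemma measurable_comap_indC (w : Path T) (i : Fin n) :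
    Measurable[MeasurableSpace.comap (D.unit i) inferInstance] (D.indC P w i) := by
  have : Measurable fun z : (Bool → Fin T → ℝ) × Path T =>
      (if z.2 = w then (1 : ℝ) else 0) - D.prop P i w :=
    (Measurable.ite (measurable_snd (measurableSet_singleton w)) measurable_const
      measurable_const).sub_const _
  exact this.comp (comap_measurable (D.unit i))

lemma measurable_comap_outC (w : Path T) (t : Fin T) (i : Fin n) :
    Measurable[MeasurableSpace.comap (D.unit i) inferInstance] (D.outC P m' w t i) := by
  have : Measurable fun z : (Bool → Fin T → ℝ) × Path T =>
      (if z.2 = w then z.1 (w t) t - m' i t else 0)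
        - D.prop P i w * (D.meanY P (w t) i t - m' i t) := by
    refine (Measurable.ite (measurable_snd (measurableSet_singleton w)) ?_
      measurable_const).sub_const _
    fun_prop
  exact this.comp (comap_measurable (D.unit i))

lemma abs_indC_le (w : Path T) (i : Fin n) (ω : Ω) : |D.indC P w i ω| ≤ 2 * M := by
  have h0 := prop_nonneg (P := P) (D := D) i w
  have h1 := prop_le_one (P := P) (D := D) i w
  have := R.one_le_M
  unfold indC
  rw [abs_le]
  split_ifs <;> constructor <;> linarith

lemma abs_outC_le (w : Path T) (t : Fin T) (i : Fin n) :
    ∀ᵐ ω ∂P, |D.outC P m' w t i ω| ≤ 2 * M := by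
  have hM : 0 ≤ M := zero_le_one.trans R.one_le_M
  filter_upwards [R.bdd_lim i] with ω h
  unfold outC
  have h1 : |D.prop P i w * (D.meanY P (w t) i t - m' i t)| ≤ M := by
    rw [abs_mul, abs_of_nonneg (prop_nonneg i w)]
    exact (mul_le_of_le_one_left (abs_nonneg _) (prop_le_one i w)).trans (R.abs_meanY_sub_le _ _ _)
  have h2 : |if D.W i ω = w then D.Y (w t) i ω t - m' i t else 0| ≤ M := by
    split_ifs
    · exact h _ t
    · simpa using hM
  linarith [abs_sub (if D.W i ω = w then D.Y (w t) i ω t - m' i t else 0)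
    (D.prop P i w * (D.meanY P (w t) i t - m' i t))]

lemma integral_ind (w : Path T) (i : Fin n) :
    ∫ ω, (if D.W i ω = w then (1 : ℝ) else 0) ∂P = D.prop P i w := by
  have : (fun ω => if D.W i ω = w then (1 : ℝ) else 0)
      = {ω | D.W i ω = w}.indicator fun _ => 1 := by
    ext ω; simp [Set.indicator_apply]
  rw [this, integral_indicator (R.measurableSet_W_eq i w)]
  simp [prop]

lemma aebdd_ind (w : Path T) (i : Fin n) :
    AEBdd P fun ω => if D.W i ω = w then (1 : ℝ) else 0 := by
  refine ⟨Measurable.ite (R.measurableSet_W_eq i w) measurable_const measurable_const, 1,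
    ae_of_all _ fun ω => ?_⟩
  beta_reduce
  split_ifs <;> simp

/-- This is where latent mean ignorability enters: on the event W_i = w, the outcome may be replaced
by its conditional expectation given W_i, which is constant. -/
lemma integral_ind_mul_Y (w : Path T) (a : Bool) (t : Fin T) (i : Fin n) :
    ∫ ω, (if D.W i ω = w then D.Y a i ω t else 0) ∂P = D.prop P i w * D.meanY P a i t := by
  have h1 : (fun ω => if D.W i ω = w then D.Y a i ω t else 0)
      = {ω | D.W i ω = w}.indicator fun ω => D.Y a i ω t := by
    ext ω; simp [Set.indicator_apply]
  have hle : MeasurableSpace.comap (D.W i) inferInstance ≤ ‹MeasurableSpace Ω› :=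
    (R.measurable_W i).comap_le
  have hs : MeasurableSet[MeasurableSpace.comap (D.W i) inferInstance] {ω | D.W i ω = w} :=
    ⟨{w}, measurableSet_singleton w, rfl⟩
  rw [h1, integral_indicator (R.measurableSet_W_eq i w),
    ← setIntegral_condExp hle (R.aebdd_Y a i t).integrable hs,
    setIntegral_congr_ae (g := fun _ => D.meanY P a i t) (R.measurableSet_W_eq i w)]
  · simp [prop]
  · filter_upwards [R.ignorable a i t] with ω h _ using h

lemma integral_indC (w : Path T) (i : Fin n) : ∫ ω, D.indC P w i ω ∂P = 0 := by
  unfold indC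
  rw [integral_sub (R.aebdd_ind w i).integrable (integrable_const _), R.integral_ind]
  simp

lemma aebdd_ite_Y (w : Path T) (a : Bool) (t : Fin T) (i : Fin n) :
    AEBdd P fun ω => if D.W i ω = w then D.Y a i ω t else 0 := by
  have := (R.aebdd_ind w i).mul (R.aebdd_Y a i t)
  simpa only [ite_mul, one_mul, zero_mul] using this

lemma integral_outC (w : Path T) (t : Fin T) (i : Fin n) : ∫ ω, D.outC P m' w t i ω ∂P = 0 := by
  have h : ∀ ω, D.outC P m' w t i ω = (if D.W i ω = w then D.Y (w t) i ω t else 0)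
      - m' i t * (if D.W i ω = w then 1 else 0)
      - D.prop P i w * (D.meanY P (w t) i t - m' i t) := fun ω => by
    unfold outC; split_ifs <;> ring
  simp_rw [h]
  rw [integral_sub, integral_sub (R.aebdd_ite_Y w _ t i).integrable
    ((R.aebdd_ind w i).const_mul _).integrable, R.integral_ind_mul_Y, integral_const_mul,
    R.integral_ind]
  · simp; ring
  · exact ((R.aebdd_ite_Y w _ t i).sub ((R.aebdd_ind w i).const_mul _)).integrable
  · exact integrable_const _

/-! #### Weights and adjustments -/

lemma abs_weight_le (i : Fin n) (w : Path T) : ∀ᵐ ω ∂P, |Q w / πh i ω w| ≤ 1 / c := by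
  filter_upwards [R.est_gt i] with ω h
  by_cases hw : w ∈ S
  · have h1 := h w hw
    rw [abs_of_nonneg (div_nonneg (R.Q_nonneg w) (R.c_pos.trans h1).le)]
    exact div_le_div₀ zero_le_one (R.Q_le_one w) R.c_pos h1.le
  · rw [R.reshaped.2.1 w hw]
    simpa using R.c_pos.le

lemma aebdd_weight (i : Fin n) (w : Path T) : AEBdd P fun ω => Q w / πh i ω w :=
  ⟨measurable_const.div (R.measurable_prop i w), _, R.abs_weight_le i w⟩

lemma abs_out_sub_le (i : Fin n) : ∀ᵐ ω ∂P, ∀ t, |mh i ω t - m' i t| ≤ 2 * M := by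
  filter_upwards [R.bdd i, R.bdd_lim i] with ω h h' t
  have := abs_sub (D.Y true i ω t - m' i t) (D.Y true i ω t - mh i ω t)
  rw [sub_sub_sub_cancel_left] at this
  linarith [h true t, h' true t]

lemma aebdd_out_sub (i : Fin n) (t : Fin T) : AEBdd P fun ω => mh i ω t - m' i t :=
  ⟨(R.measurable_out i t).sub_const _, _, (R.abs_out_sub_le i).mono fun _ h => h t⟩

lemma aebdd_out (i : Fin n) (t : Fin T) : AEBdd P fun ω => mh i ω t := by
  simpa using (R.aebdd_out_sub i t).add (AEBdd.const (m' i t))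

lemma aebdd_prop (i : Fin n) (w : Path T) : AEBdd P fun ω => πh i ω w := by
  refine ⟨R.measurable_prop i w, 1, ?_⟩
  filter_upwards [R.est_mem i] with ω h
  rw [abs_of_nonneg (h w).1]
  exact (h w).2

lemma aebdd_disc (i : Fin n) : AEBdd P (disc S πh mh π' m' i) :=
  (AEBdd.sum _ fun w => ((R.aebdd_prop i w).sub (AEBdd.const _)).abs).add
    (AEBdd.sum _ fun t => (R.aebdd_out_sub i t).abs)

omit R [MeasurableSpace Ω] in
lemma disc_nonneg (i : Fin n) (ω : Ω) : 0 ≤ disc S πh mh π' m' i ω :=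
  add_nonneg (Finset.sum_nonneg fun _ _ => abs_nonneg _)
    (Finset.sum_nonneg fun _ _ => abs_nonneg _)

omit R [MeasurableSpace Ω] in
lemma abs_out_sub_le_disc (i : Fin n) (t : Fin T) (ω : Ω) :
    |mh i ω t - m' i t| ≤ disc S πh mh π' m' i ω :=
  (Finset.single_le_sum (f := fun t => |mh i ω t - m' i t|) (fun _ _ => abs_nonneg _)
    (Finset.mem_univ t)).trans
      (le_add_of_nonneg_left (Finset.sum_nonneg fun _ _ => abs_nonneg _))

/-- The reciprocal is Lipschitz with constant c⁻² on values above c. Off the overlap set both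
weights are zero, so overlap is needed only on S. -/
lemma abs_weight_sub_le (i : Fin n) (w : Path T) : ∀ᵐ ω ∂P,
    |Q w / πh i ω w - Q w / π' i w| ≤ (1 / c) ^ 2 * disc S πh mh π' m' i ω := by
  filter_upwards [R.est_gt i] with ω h
  by_cases hw : w ∈ S
  · have h1 := h w hw
    have h2 := R.lim_gt i w hw
    have h1' := R.c_pos.trans h1
    have h2' := R.c_pos.trans h2
    have h3 : |πh i ω w - π' i w| ≤ disc S πh mh π' m' i ω :=
      (Finset.single_le_sum (f := fun w => |πh i ω w - π' i w|) (fun _ _ => abs_nonneg _)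
        hw).trans (le_add_of_nonneg_right (Finset.sum_nonneg fun _ _ => abs_nonneg _))
    have h4 : Q w / πh i ω w - Q w / π' i w
        = Q w / (πh i ω w * π' i w) * (π' i w - πh i ω w) := by
      field_simp
    rw [h4, abs_mul, abs_of_nonneg (div_nonneg (R.Q_nonneg w) (by positivity)), abs_sub_comm]
    refine mul_le_mul ?_ h3 (abs_nonneg _) (by positivity)
    rw [div_pow, one_pow, sq]
    exact div_le_div₀ zero_le_one (R.Q_le_one w) (mul_pos R.c_pos R.c_pos)
      (mul_le_mul h1.le h2.le R.c_pos.le h1'.le)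
  · rw [R.reshaped.2.1 w hw]
    simpa using mul_nonneg (by positivity) (disc_nonneg i ω)

end Regular

end Panel

namespace Panel

namespace Regular

variable {n T K : ℕ} {Ω : Type*} [MeasurableSpace Ω]
  {P : Measure Ω} [IsProbabilityMeasure P] {D : Panel n T Ω} {S : Finset (Path T)}
  {Q : Path T → ℝ} {fold : Fin n → Fin K} {πh : PropEst n T Ω} {mh : OutEst n T Ω}
  {π' : Fin n → Path T → ℝ} {m' : Fin n → Fin T → ℝ} {c M : ℝ}
  (R : D.Regular P S Q fold πh mh π' m' c M)

include R

/-! #### The deterministic limits as estimates -/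

lemma limit : D.Regular P S Q fold (fun i _ => π' i) (fun i _ => m' i) π' m' c M where
  measurable_Y := R.measurable_Y
  measurable_W := R.measurable_W
  reshaped := R.reshaped
  indep := R.indep
  ignorable := R.ignorable
  -- Constants are measurable for every σ-algebra, so the limits are themselves cross-fitted
  -- estimates and every bound below applies to them too.
  prop_measurable _ _ := measurable_const
  out_measurable _ _ := measurable_const
  c_pos := R.c_pos
  c_le := R.c_le
  one_le_M := R.one_le_M
  est_mem i := ae_of_all _ fun _ => R.lim_mem i
  est_gt i := ae_of_all _ fun _ => R.lim_gt i
  prop_gt := R.prop_gt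
  lim_mem := R.lim_mem
  lim_gt := R.lim_gt
  bdd := R.bdd_lim
  bdd_lim := R.bdd_lim

lemma one_le_inv : 1 ≤ 1 / c := by rw [le_div_iff₀ R.c_pos]; linarith [R.c_le]

/-! #### Bounds on cells -/

lemma abs_meanY_sub_out_le (i : Fin n) : ∀ᵐ ω ∂P, ∀ a t, |D.meanY P a i t - mh i ω t| ≤ 3 * M := by
  filter_upwards [R.abs_out_sub_le i] with ω h a t
  have := abs_sub (D.meanY P a i t - m' i t) (mh i ω t - m' i t)
  rw [sub_sub_sub_cancel_right] at this
  linarith [h t, R.abs_meanY_sub_le a i t]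

lemma abs_cell_le (i : Fin n) (k : Cell T) :
    ∀ᵐ ω ∂P, |D.cell Q πh mh i ω k| ≤ 3 * M * (1 / c) := by
  have hM := R.one_le_M
  have hc := R.one_le_inv
  filter_upwards [R.bdd i, R.abs_weight_le i k.1] with ω h h'
  unfold cell
  split_ifs
  · rw [abs_mul, mul_comm]
    refine mul_le_mul ?_ h' (abs_nonneg _) (by linarith)
    rcases k with ⟨w, _ | t⟩
    · simpa using by linarith
    · exact (h _ t).trans (by linarith)
  · rw [abs_zero]; positivity

lemma abs_cellMean_le (i : Fin n) (k : Cell T) :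
    ∀ᵐ ω ∂P, |D.cellMean P Q i (πh i ω) (mh i ω) k| ≤ 3 * M * (1 / c) := by
  have hM := R.one_le_M
  have hc := R.one_le_inv
  filter_upwards [R.abs_meanY_sub_out_le i, R.abs_weight_le i k.1] with ω h h'
  unfold cellMean
  rw [abs_mul, mul_comm, abs_mul, abs_of_nonneg (prop_nonneg i _)]
  refine mul_le_mul ?_ ?_ (by positivity [prop_nonneg (P := P) (D := D) i k.1]) (by linarith)
  · rcases k with ⟨w, _ | t⟩
    · simpa using by linarith
    · exact h _ t
  · exact (mul_le_of_le_one_left (abs_nonneg _) (prop_le_one i _)).trans h'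

lemma measurable_cell (i : Fin n) (k : Cell T) : Measurable fun ω => D.cell Q πh mh i ω k := by
  rcases k with ⟨w, _ | t⟩
  · exact Measurable.ite (R.measurableSet_W_eq i w)
      ((measurable_const.div (R.measurable_prop i w)).mul measurable_const) measurable_const
  · exact Measurable.ite (R.measurableSet_W_eq i w)
      ((measurable_const.div (R.measurable_prop i w)).mul
        ((R.measurable_Y_apply _ i t).sub (R.measurable_out i t))) measurable_const

lemma measurable_cellMean (i : Fin n) (k : Cell T) :
    Measurable fun ω => D.cellMean P Q i (πh i ω) (mh i ω) k := by
  rcases k with ⟨w, _ | t⟩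
  · exact ((measurable_const.div (R.measurable_prop i w)).const_mul _).mul measurable_const
  · exact ((measurable_const.div (R.measurable_prop i w)).const_mul _).mul
        (measurable_const.sub (R.measurable_out i t))

lemma aebdd_cell (i : Fin n) (k : Cell T) : AEBdd P fun ω => D.cell Q πh mh i ω k :=
  ⟨R.measurable_cell i k, _, R.abs_cell_le i k⟩

lemma aebdd_cellMean (i : Fin n) (k : Cell T) :
    AEBdd P fun ω => D.cellMean P Q i (πh i ω) (mh i ω) k :=
  ⟨R.measurable_cellMean i k, _, R.abs_cellMean_le i k⟩

lemma aebdd_avgCell (k : Cell T) : AEBdd P fun ω => D.avgCell Q πh mh ω k :=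
  (AEBdd.sum _ fun i => R.aebdd_cell i k).div_const _

lemma aebdd_avgCellMean (k : Cell T) : AEBdd P fun ω => D.avgCellMean P Q πh mh ω k :=
  (AEBdd.sum _ fun i => R.aebdd_cellMean i k).div_const _

omit R [MeasurableSpace Ω] in
lemma abs_avg_le {f : Fin n → ℝ} {B : ℝ} (hB : 0 ≤ B) (h : ∀ i, |f i| ≤ B) :
    |(∑ i, f i) / n| ≤ B := by
  rw [abs_div, Nat.abs_cast]
  refine div_le_of_le_mul₀ (Nat.cast_nonneg n) hB ?_
  refine (Finset.abs_sum_le_sum_abs _ _).trans ((Finset.sum_le_sum fun i _ => h i).trans ?_)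
  simp [mul_comm]

lemma norm_cell_le (i : Fin n) : ∀ᵐ ω ∂P, ‖D.cell Q πh mh i ω‖ ≤ 3 * M * (1 / c) := by
  have hM := R.one_le_M
  have hc := R.one_le_inv
  filter_upwards [ae_all_iff.2 fun k => R.abs_cell_le i k] with ω h
  exact (pi_norm_le_iff_of_nonneg (by positivity)).2 h

lemma norm_avgCell_le : ∀ᵐ ω ∂P, ‖D.avgCell Q πh mh ω‖ ≤ 3 * M * (1 / c) := by
  have hM := R.one_le_M
  have hc := R.one_le_inv
  filter_upwards [ae_all_iff.2 fun i => ae_all_iff.2 fun k => R.abs_cell_le i k] with ω h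
  exact (pi_norm_le_iff_of_nonneg (by positivity)).2 fun k =>
    abs_avg_le (by positivity) fun i => h i k

lemma norm_avgCellMean_le : ∀ᵐ ω ∂P, ‖D.avgCellMean P Q πh mh ω‖ ≤ 3 * M * (1 / c) := by
  have hM := R.one_le_M
  have hc := R.one_le_inv
  filter_upwards [ae_all_iff.2 fun i => ae_all_iff.2 fun k => R.abs_cellMean_le i k] with ω h
  exact (pi_norm_le_iff_of_nonneg (by positivity)).2 fun k =>
    abs_avg_le (by positivity) fun i => h i k

/-- The split (v - v')y - vd separates the error of the weight from that of the adjustment. Since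
1/c and M are at least 1, one constant covers both parts. It serves the cells and their means alike.
-/
lemma abs_mul_sub_mul_le {v v' y d : ℝ} {X : ℝ} (hX : 0 ≤ X)
    (h1 : |v - v'| ≤ (1 / c) ^ 2 * X) (h2 : |v| ≤ 1 / c) (hd : |d| ≤ X) (hy : |y| ≤ M) :
    |v * (y - d) - v' * y| ≤ 2 * M * (1 / c) ^ 2 * X := by
  have hM := R.one_le_M
  have hc := R.one_le_inv
  have h3 : v * (y - d) - v' * y = (v - v') * y - v * d := by ring
  rw [h3]
  refine (abs_sub _ _).trans ?_
  rw [abs_mul, abs_mul]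
  have e1 : |v - v'| * |y| ≤ (1 / c) ^ 2 * X * M := by gcongr
  have e2 : |v| * |d| ≤ 1 / c * X := by gcongr
  have e3 : 1 / c * X ≤ (1 / c) ^ 2 * X * M := by
    have : 1 / c * 1 ≤ 1 / c * (1 / c * M) := by gcongr; exact one_le_mul_of_one_le_of_one_le hc hM
    nlinarith
  linarith

lemma abs_sub_weight_le {v v' : ℝ} {X : ℝ} (hX : 0 ≤ X)
    (h1 : |v - v'| ≤ (1 / c) ^ 2 * X) : |v - v'| ≤ 2 * M * (1 / c) ^ 2 * X := by
  have hM := R.one_le_M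
  refine h1.trans ?_
  rw [mul_assoc (2 * M)]
  exact le_mul_of_one_le_left (by positivity) (by linarith)

lemma abs_cell_sub_le (i : Fin n) (k : Cell T) : ∀ᵐ ω ∂P,
    |D.cell Q πh mh i ω k - D.cell Q (fun i _ => π' i) (fun i _ => m' i) i ω k|
      ≤ 2 * M * (1 / c) ^ 2 * disc S πh mh π' m' i ω := by
  have hM := R.one_le_M
  filter_upwards [R.abs_weight_sub_le i k.1, R.abs_weight_le i k.1, R.bdd_lim i] with ω h1 h2 h3
  have hd := disc_nonneg (S := S) (πh := πh) (mh := mh) (π' := π') (m' := m') i ω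
  unfold cell
  split_ifs
  · rcases k with ⟨w, _ | t⟩
    · simpa using R.abs_sub_weight_le hd h1
    · have := R.abs_mul_sub_mul_le hd h1 h2 (abs_out_sub_le_disc i t ω) (h3 (w t) t)
      rwa [sub_sub_sub_cancel_right] at this
  · rw [sub_zero, abs_zero]; positivity

lemma abs_cellMean_sub_le (i : Fin n) (k : Cell T) : ∀ᵐ ω ∂P,
    |D.cellMean P Q i (πh i ω) (mh i ω) k - D.cellMean P Q i (π' i) (m' i) k|
      ≤ 2 * M * (1 / c) ^ 2 * disc S πh mh π' m' i ω := by
  have hM := R.one_le_M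
  filter_upwards [R.abs_weight_sub_le i k.1, R.abs_weight_le i k.1] with ω h1 h2
  have hd := disc_nonneg (S := S) (πh := πh) (mh := mh) (π' := π') (m' := m') i ω
  unfold cellMean
  rw [mul_assoc, mul_assoc, ← mul_sub, abs_mul, abs_of_nonneg (prop_nonneg i _)]
  refine (mul_le_of_le_one_left (abs_nonneg _) (prop_le_one i _)).trans ?_
  rcases k with ⟨w, _ | t⟩
  · simpa using R.abs_sub_weight_le hd h1
  · have := R.abs_mul_sub_mul_le hd h1 h2 (abs_out_sub_le_disc i t ω) (R.abs_meanY_sub_le (w t) i t)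
    rwa [sub_sub_sub_cancel_right] at this

/-! #### Second moments of centered averages -/

lemma integral_sq_avg_le {u v X : Fin n → Ω → ℝ}
    (hu : ∀ i, Measurable[MeasurableSpace.comap (D.unit i) inferInstance] (u i))
    (hub : ∀ i, ∀ᵐ ω ∂P, |u i ω| ≤ 2 * M) (hu0 : ∀ i, ∫ ω, u i ω ∂P = 0)
    (hv : ∀ i, Measurable[D.outOfFold fold i] (v i)) (hX : ∀ i, AEBdd P (X i)) {a : ℝ}
    (hvX : ∀ i, ∀ᵐ ω ∂P, |v i ω| ≤ a * X i ω) :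
    ∫ ω, ((∑ i, u i ω * v i ω) / n) ^ 2 ∂P
      ≤ 4 * K * M ^ 2 * a ^ 2 * ((∑ i, ∫ ω, X i ω ^ 2 ∂P) / n) / n := by
  have hvb : ∀ i, AEBdd P (v i) := fun i => by
    obtain ⟨C, hC⟩ := (hX i).2
    refine ⟨(hv i).mono (outOfFold_le R.measurable_unit fold i) le_rfl, |a| * C, ?_⟩
    filter_upwards [hvX i, hC] with ω h1 h2
    refine (h1.trans (le_abs_self _)).trans ?_
    rw [abs_mul]
    gcongr
  refine (integral_sq_avg_mul_le R.measurable_unit R.indep fold hu hv hub hvb hu0).trans ?_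
  have h1 : ∑ i, ∫ ω, v i ω ^ 2 ∂P ≤ a ^ 2 * ∑ i, ∫ ω, X i ω ^ 2 ∂P := by
    rw [Finset.mul_sum]
    refine Finset.sum_le_sum fun i _ => ?_
    rw [← integral_const_mul]
    refine integral_mono_ae ((hvb i).pow 2).integrable (((hX i).pow 2).const_mul _).integrable ?_
    filter_upwards [hvX i] with ω h
    rw [← mul_pow, ← sq_abs]
    gcongr
  calc K * (2 * M) ^ 2 * ((∑ i, ∫ ω, v i ω ^ 2 ∂P) / n) / n
      ≤ K * (2 * M) ^ 2 * ((a ^ 2 * ∑ i, ∫ ω, X i ω ^ 2 ∂P) / n) / n := by gcongr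
    _ = _ := by ring

lemma measurable_weight (i : Fin n) (w : Path T) :
    Measurable[D.outOfFold fold i] fun ω => Q w / πh i ω w :=
  measurable_const.div (R.prop_measurable i w)

/-- Every coordinate is a cross-fitted average with bounded out-of-fold factors, hence the rate 1/n.
The constant comes from 40 = 2·4 + 2·16, the two terms of an outcome coordinate. -/
lemma integral_sq_avgCell_sub_le (hn : 0 < n) (k : Cell T) :
    ∫ ω, (D.avgCell Q πh mh ω k - D.avgCellMean P Q πh mh ω k) ^ 2 ∂P
      ≤ 40 * K * M ^ 4 * (1 / c) ^ 2 / n := by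
  have hM := R.one_le_M
  have hn' : (n : ℝ) ≠ 0 := by exact_mod_cast hn.ne'
  have h1 : (∑ _i : Fin n, ∫ _ : Ω, (1 : ℝ) ^ 2 ∂P) / (n : ℝ) = 1 := by simp [hn']
  have hM4 : M ^ 2 ≤ M ^ 4 := pow_le_pow_right₀ hM (by norm_num)
  have heq : ∀ ω, D.avgCell Q πh mh ω k - D.avgCellMean P Q πh mh ω k
      = (∑ i, (D.cell Q πh mh i ω k - D.cellMean P Q i (πh i ω) (mh i ω) k)) / n := fun ω => by
    simp only [avgCell, avgCellMean, Finset.sum_sub_distrib, sub_div]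
  simp_rw [heq]
  rcases k with ⟨w, _ | t⟩
  · simp_rw [cell_sub_cellMean_none]
    refine (R.integral_sq_avg_le (fun i => R.measurable_comap_indC w i)
      (fun i => ae_of_all _ fun ω => R.abs_indC_le w i ω) (fun i => R.integral_indC w i)
      (fun i => R.measurable_weight i w) (X := fun _ _ => 1) (fun i => AEBdd.const 1) (a := 1 / c)
      (fun i => by simpa using R.abs_weight_le i w)).trans ?_
    rw [h1]
    gcongr ?_ / _
    rw [mul_one]
    gcongr
    norm_num
  · simp_rw [cell_sub_cellMean_some P D Q πh mh m', Finset.sum_sub_distrib, sub_div]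
    have b1 := R.integral_sq_avg_le (fun i => R.measurable_comap_outC w t i)
      (fun i => R.abs_outC_le w t i) (fun i => R.integral_outC w t i)
      (fun i => R.measurable_weight i w) (X := fun _ _ => 1) (fun i => AEBdd.const 1) (a := 1 / c)
      (fun i => by simpa using R.abs_weight_le i w)
    have b2 := R.integral_sq_avg_le (fun i => R.measurable_comap_indC w i)
      (fun i => ae_of_all _ fun ω => R.abs_indC_le w i ω) (fun i => R.integral_indC w i)
      (fun i => (R.measurable_weight i w).mul ((R.out_measurable i t).sub_const (m' i t)))
      (X := fun _ _ => 1) (fun i => AEBdd.const 1) (a := 1 / c * (2 * M))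
      (fun i => by
        filter_upwards [R.abs_weight_le i w, R.abs_out_sub_le i] with ω h h'
        rw [mul_one, Pi.mul_apply, abs_mul]
        have := R.c_pos
        exact mul_le_mul h (h' t) (abs_nonneg _) (by positivity))
    rw [h1] at b1 b2
    have a1 : AEBdd P fun ω => (∑ i, D.outC P m' w t i ω * (Q w / πh i ω w)) / n :=
      (AEBdd.sum _ fun i => AEBdd.mul ⟨(R.measurable_comap_outC w t i).mono
        (R.measurable_unit i).comap_le le_rfl, _, R.abs_outC_le w t i⟩
        (R.aebdd_weight i w)).div_const _
    have a2 : AEBdd P fun ω =>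
        (∑ i, D.indC P w i ω * (Q w / πh i ω w * (mh i ω t - m' i t))) / n :=
      (AEBdd.sum _ fun i => AEBdd.mul ⟨(R.measurable_comap_indC w i).mono
        (R.measurable_unit i).comap_le le_rfl, _, ae_of_all _ fun ω => R.abs_indC_le w i ω⟩
        ((R.aebdd_weight i w).mul (R.aebdd_out_sub i t))).div_const _
    have hle : ∀ x y : ℝ, (x - y) ^ 2 ≤ 2 * x ^ 2 + 2 * y ^ 2 := fun x y => by
      nlinarith [sq_nonneg (x + y)]
    refine (integral_mono ((a1.sub a2).pow 2).integrable
      (((a1.pow 2).const_mul 2).add ((a2.pow 2).const_mul 2)).integrable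
      fun ω => hle _ _).trans ?_
    rw [integral_add ((a1.pow 2).const_mul 2).integrable ((a2.pow 2).const_mul 2).integrable,
      integral_const_mul, integral_const_mul]
    refine (add_le_add (mul_le_mul_of_nonneg_left b1 zero_le_two)
      (mul_le_mul_of_nonneg_left b2 zero_le_two)).trans ?_
    rw [← mul_div_assoc, ← mul_div_assoc, ← add_div]
    gcongr ?_ / _
    have : (K : ℝ) * (1 / c) ^ 2 * M ^ 2 ≤ K * (1 / c) ^ 2 * M ^ 4 := by gcongr
    nlinarith

/-- The mean squared distance of the estimates from their limits. -/
def _root_.RIPW.Panel.avgDisc (P : Measure Ω) (S : Finset (Path T)) (πh : PropEst n T Ω)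
    (mh : OutEst n T Ω) (π' : Fin n → Path T → ℝ) (m' : Fin n → Fin T → ℝ) : ℝ :=
  (∑ i, ∫ ω, disc S πh mh π' m' i ω ^ 2 ∂P) / n

/-- Subtracting the noise at the limits keeps the same centered unit factors and changes only the
out-of-fold factors, which are now differences of estimates and limits. The smallness of the
estimation error therefore multiplies the rate 1/n instead of being added to it. -/
lemma integral_sq_avgCell_sub_sub_le (k : Cell T) :
    ∫ ω, ((D.avgCell Q πh mh ω k - D.avgCellMean P Q πh mh ω k)
      - (D.avgCell Q (fun i _ => π' i) (fun i _ => m' i) ω k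
        - D.avgCellMean P Q (fun i _ => π' i) (fun i _ => m' i) ω k)) ^ 2 ∂P
      ≤ 16 * K * M ^ 2 * (1 / c) ^ 4 * avgDisc P S πh mh π' m' / n := by
  have hM := R.one_le_M
  have hc := R.one_le_inv
  have hc4 : (1 / c) ^ 2 ≤ (1 / c) ^ 4 := pow_le_pow_right₀ hc (by norm_num)
  have hΔ : 0 ≤ avgDisc P S πh mh π' m' :=
    div_nonneg (Finset.sum_nonneg fun i _ => integral_nonneg fun ω => sq_nonneg _)
      (Nat.cast_nonneg n)
  have heq : ∀ ω, (D.avgCell Q πh mh ω k - D.avgCellMean P Q πh mh ω k)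
      - (D.avgCell Q (fun i _ => π' i) (fun i _ => m' i) ω k
        - D.avgCellMean P Q (fun i _ => π' i) (fun i _ => m' i) ω k)
      = (∑ i, ((D.cell Q πh mh i ω k - D.cellMean P Q i (πh i ω) (mh i ω) k)
        - (D.cell Q (fun i _ => π' i) (fun i _ => m' i) i ω k
          - D.cellMean P Q i (π' i) (m' i) k))) / n := fun ω => by
    simp only [avgCell, avgCellMean, Finset.sum_sub_distrib, sub_div]
  simp_rw [heq]
  rcases k with ⟨w, _ | t⟩
  · have e : ∀ i ω, (D.cell Q πh mh i ω (w, none) - D.cellMean P Q i (πh i ω) (mh i ω) (w, none))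
        - (D.cell Q (fun i _ => π' i) (fun i _ => m' i) i ω (w, none)
          - D.cellMean P Q i (π' i) (m' i) (w, none))
        = D.indC P w i ω * (Q w / πh i ω w - Q w / π' i w) := fun i ω => by
      have := cell_sub_cellMean_none P D Q (fun i _ => π' i) (fun i _ => m' i) w i ω
      rw [cell_sub_cellMean_none, this, mul_sub]
    simp_rw [e]
    refine (R.integral_sq_avg_le (fun i => R.measurable_comap_indC w i)
      (fun i => ae_of_all _ fun ω => R.abs_indC_le w i ω) (fun i => R.integral_indC w i)
      (fun i => (R.measurable_weight i w).sub_const _) (X := disc S πh mh π' m')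
      (fun i => R.aebdd_disc i) (a := (1 / c) ^ 2) (fun i => R.abs_weight_sub_le i w)).trans ?_
    change 4 * K * M ^ 2 * ((1 / c) ^ 2) ^ 2 * avgDisc P S πh mh π' m' / n ≤ _
    rw [← pow_mul]
    gcongr
    norm_num
  · have e : ∀ i ω, (D.cell Q πh mh i ω (w, some t) - D.cellMean P Q i (πh i ω) (mh i ω) (w, some t))
        - (D.cell Q (fun i _ => π' i) (fun i _ => m' i) i ω (w, some t)
          - D.cellMean P Q i (π' i) (m' i) (w, some t))
        = D.outC P m' w t i ω * (Q w / πh i ω w - Q w / π' i w)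
          - D.indC P w i ω * (Q w / πh i ω w * (mh i ω t - m' i t)) := fun i ω => by
      have := cell_sub_cellMean_some P D Q (fun i _ => π' i) (fun i _ => m' i) m' w t i ω
      rw [cell_sub_cellMean_some P D Q πh mh m', this]
      ring
    simp_rw [e, Finset.sum_sub_distrib, sub_div]
    have b1 := R.integral_sq_avg_le (fun i => R.measurable_comap_outC w t i)
      (fun i => R.abs_outC_le w t i) (fun i => R.integral_outC w t i)
      (fun i => (R.measurable_weight i w).sub_const (Q w / π' i w)) (X := disc S πh mh π' m')
      (fun i => R.aebdd_disc i) (a := (1 / c) ^ 2) (fun i => R.abs_weight_sub_le i w)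
    have b2 := R.integral_sq_avg_le (fun i => R.measurable_comap_indC w i)
      (fun i => ae_of_all _ fun ω => R.abs_indC_le w i ω) (fun i => R.integral_indC w i)
      (fun i => (R.measurable_weight i w).mul ((R.out_measurable i t).sub_const (m' i t)))
      (X := disc S πh mh π' m') (fun i => R.aebdd_disc i) (a := 1 / c)
      (fun i => by
        filter_upwards [R.abs_weight_le i w] with ω h
        rw [Pi.mul_apply, abs_mul]
        have := R.c_pos
        exact mul_le_mul h (abs_out_sub_le_disc i t ω) (abs_nonneg _) (by positivity))
    change _ ≤ 4 * K * M ^ 2 * ((1 / c) ^ 2) ^ 2 * avgDisc P S πh mh π' m' / n at b1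
    change _ ≤ 4 * K * M ^ 2 * (1 / c) ^ 2 * avgDisc P S πh mh π' m' / n at b2
    rw [← pow_mul] at b1
    have a1 : AEBdd P fun ω => (∑ i, D.outC P m' w t i ω * (Q w / πh i ω w - Q w / π' i w)) / n :=
      (AEBdd.sum _ fun i => AEBdd.mul ⟨(R.measurable_comap_outC w t i).mono
        (R.measurable_unit i).comap_le le_rfl, _, R.abs_outC_le w t i⟩
        ((R.aebdd_weight i w).sub (AEBdd.const _))).div_const _
    have a2 : AEBdd P fun ω =>
        (∑ i, D.indC P w i ω * (Q w / πh i ω w * (mh i ω t - m' i t))) / n :=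
      (AEBdd.sum _ fun i => AEBdd.mul ⟨(R.measurable_comap_indC w i).mono
        (R.measurable_unit i).comap_le le_rfl, _, ae_of_all _ fun ω => R.abs_indC_le w i ω⟩
        ((R.aebdd_weight i w).mul (R.aebdd_out_sub i t))).div_const _
    have hle : ∀ x y : ℝ, (x - y) ^ 2 ≤ 2 * x ^ 2 + 2 * y ^ 2 := fun x y => by
      nlinarith [sq_nonneg (x + y)]
    refine (integral_mono ((a1.sub a2).pow 2).integrable
      (((a1.pow 2).const_mul 2).add ((a2.pow 2).const_mul 2)).integrable
      fun ω => hle _ _).trans ?_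
    rw [integral_add ((a1.pow 2).const_mul 2).integrable ((a2.pow 2).const_mul 2).integrable,
      integral_const_mul, integral_const_mul]
    refine (add_le_add (mul_le_mul_of_nonneg_left b1 zero_le_two)
      (mul_le_mul_of_nonneg_left b2 zero_le_two)).trans ?_
    rw [← mul_div_assoc, ← mul_div_assoc, ← add_div]
    gcongr ?_ / _
    have : 4 * K * M ^ 2 * (1 / c) ^ 2 * avgDisc P S πh mh π' m'
        ≤ 4 * K * M ^ 2 * (1 / c) ^ 4 * avgDisc P S πh mh π' m' := by gcongr
    norm_num at this ⊢
    linarith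

end Regular

end Panel

/-! ### Second moments of norms and averages. -/

lemma AEBdd.sqrt {Ω : Type*} [MeasurableSpace Ω] {P : Measure Ω} {X : Ω → ℝ} (h : AEBdd P X) :
    AEBdd P fun ω => √(X ω) := by
  obtain ⟨hX, C, hC⟩ := h
  refine ⟨hX.sqrt, √C, ?_⟩
  filter_upwards [hC] with ω hω
  rw [abs_of_nonneg (Real.sqrt_nonneg _)]
  exact Real.sqrt_le_sqrt ((le_abs_self _).trans hω)

lemma sq_l2 {T : ℕ} (v : Fin T → ℝ) : l2 v ^ 2 = ∑ t, v t ^ 2 :=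
  Real.sq_sqrt (Finset.sum_nonneg fun _ _ => sq_nonneg _)

lemma sq_sum_le_card_univ {ι : Type*} [Fintype ι] (s : Finset ι) (f : ι → ℝ) :
    (∑ i ∈ s, f i) ^ 2 ≤ Fintype.card ι * ∑ i ∈ s, f i ^ 2 := by
  refine sq_sum_le_card_mul_sum_sq.trans ?_
  gcongr
  exact Finset.card_le_univ s

lemma integral_sq_norm_le {Ω ι : Type*} [MeasurableSpace Ω] [Fintype ι] {P : Measure Ω}
    [IsProbabilityMeasure P] {X : Ω → ι → ℝ} (h : ∀ k, AEBdd P fun ω => X ω k) {B : ℝ}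
    (hB : ∀ k, ∫ ω, X ω k ^ 2 ∂P ≤ B) : ∫ ω, ‖X ω‖ ^ 2 ∂P ≤ Fintype.card ι * B := by
  calc ∫ ω, ‖X ω‖ ^ 2 ∂P ≤ ∫ ω, ∑ k, X ω k ^ 2 ∂P :=
        integral_mono ((AEBdd.norm_pi h).pow 2).integrable
          (AEBdd.sum _ fun k => (h k).pow 2).integrable fun ω => sq_norm_le_sum_sq _
    _ = ∑ k, ∫ ω, X ω k ^ 2 ∂P := integral_finsetSum _ fun k _ => ((h k).pow 2).integrable
    _ ≤ ∑ k : ι, B := Finset.sum_le_sum fun k _ => hB k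
    _ = _ := by simp

lemma integral_sq_avg_le_avg {Ω : Type*} [MeasurableSpace Ω] {P : Measure Ω}
    [IsProbabilityMeasure P] {n : ℕ} {X : Fin n → Ω → ℝ} (h : ∀ i, AEBdd P (X i)) :
    ∫ ω, ((∑ i, X i ω) / n) ^ 2 ∂P ≤ (∑ i, ∫ ω, X i ω ^ 2 ∂P) / n := by
  rw [← integral_finsetSum _ fun i _ => ((h i).pow 2).integrable, ← integral_div]
  refine integral_mono (((AEBdd.sum _ h).div_const _).pow 2).integrable
    ((AEBdd.sum _ fun i => (h i).pow 2).div_const _).integrable fun ω => ?_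
  have := avg_mul_avg_le (fun i => X i ω) fun i => X i ω
  rwa [Real.mul_self_sqrt (div_nonneg (Finset.sum_nonneg fun i _ => sq_nonneg _)
    (Nat.cast_nonneg n)), ← sq] at this

lemma AEBdd.form {T : ℕ} {Ω : Type*} [MeasurableSpace Ω] {P : Measure Ω} {X Y : Ω → Cell T → ℝ}
    (hX : ∀ k, AEBdd P fun ω => X ω k) (hY : ∀ k, AEBdd P fun ω => Y ω k) (τ : ℝ) :
    AEBdd P fun ω => form τ (X ω) (Y ω) := by
  simp only [form_apply, formY_apply, formW_apply, fθ_apply, fwy_apply, fww_apply, fw_apply,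
    fy_apply, center]
  refine AEBdd.sub (AEBdd.sub ((AEBdd.sum _ fun w => hX _).mul (AEBdd.sum _ fun w =>
    AEBdd.sum _ fun t => (hY _).const_mul _)) (AEBdd.sum _ fun t => ((AEBdd.sum _ fun w =>
    (hX _).const_mul _).mul (AEBdd.sum _ fun w => (hY _).sub
      ((AEBdd.sum _ fun s => hY _).div_const _))))) (AEBdd.const_mul (AEBdd.sub
      ((AEBdd.sum _ fun w => hX _).mul (AEBdd.sum _ fun w => (hY _).const_mul _))
      (AEBdd.sum _ fun t => ((AEBdd.sum _ fun w => (hX _).const_mul _).mul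
        (AEBdd.sum _ fun w => (hY _).const_mul _)))) _)

namespace Panel

namespace Regular

variable {n T K : ℕ} {Ω : Type*} [MeasurableSpace Ω]
  {P : Measure Ω} [IsProbabilityMeasure P] {D : Panel n T Ω} {S : Finset (Path T)}
  {Q : Path T → ℝ} {fold : Fin n → Fin K} {πh : PropEst n T Ω} {mh : OutEst n T Ω}
  {π' : Fin n → Path T → ℝ} {m' : Fin n → Fin T → ℝ} {c M : ℝ}
  (R : D.Regular P S Q fold πh mh π' m' c M)

include R

/-! #### Norm bounds -/

lemma integral_sq_norm_avgCell_sub_le (hn : 0 < n) :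
    ∫ ω, ‖D.avgCell Q πh mh ω - D.avgCellMean P Q πh mh ω‖ ^ 2 ∂P
      ≤ Fintype.card (Cell T) * (40 * K * M ^ 4 * (1 / c) ^ 2 / n) :=
  integral_sq_norm_le (fun k => (R.aebdd_avgCell k).sub (R.aebdd_avgCellMean k))
    fun k => R.integral_sq_avgCell_sub_le hn k

lemma integral_sq_norm_avgCell_sub_sub_le :
    ∫ ω, ‖(D.avgCell Q πh mh ω - D.avgCellMean P Q πh mh ω)
      - (D.avgCell Q (fun i _ => π' i) (fun i _ => m' i) ω
        - D.avgCellMean P Q (fun i _ => π' i) (fun i _ => m' i) ω)‖ ^ 2 ∂P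
      ≤ Fintype.card (Cell T)
        * (16 * K * M ^ 2 * (1 / c) ^ 4 * avgDisc P S πh mh π' m' / n) :=
  integral_sq_norm_le (fun k => ((R.aebdd_avgCell k).sub (R.aebdd_avgCellMean k)).sub
    ((R.limit.aebdd_avgCell k).sub (R.limit.aebdd_avgCellMean k)))
    fun k => R.integral_sq_avgCell_sub_sub_le k

lemma integral_sq_norm_cell_sub_le :
    (∑ i, ∫ ω, ‖D.cell Q πh mh i ω - D.cell Q (fun i _ => π' i) (fun i _ => m' i) i ω‖ ^ 2 ∂P) / n
      ≤ (2 * M * (1 / c) ^ 2) ^ 2 * avgDisc P S πh mh π' m' := by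
  have hM := R.one_le_M
  rw [avgDisc, mul_div_assoc', Finset.mul_sum]
  gcongr with i
  rw [← integral_const_mul]
  refine integral_mono_ae ((AEBdd.norm_pi fun k => (R.aebdd_cell i k).sub
    (R.limit.aebdd_cell i k)).pow 2).integrable
    (((R.aebdd_disc i).pow 2).const_mul _).integrable ?_
  filter_upwards [ae_all_iff.2 fun k => R.abs_cell_sub_le i k] with ω h
  rw [← mul_pow]
  gcongr
  exact (pi_norm_le_iff_of_nonneg (mul_nonneg (by positivity) (disc_nonneg i ω))).2 h

lemma integral_sq_norm_avgCellMean_sub_le :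
    ∫ ω, ‖D.avgCellMean P Q πh mh ω
      - D.avgCellMean P Q (fun i _ => π' i) (fun i _ => m' i) ω‖ ^ 2 ∂P
      ≤ (2 * M * (1 / c) ^ 2) ^ 2 * avgDisc P S πh mh π' m' := by
  have hM := R.one_le_M
  calc _ ≤ ∫ ω, (2 * M * (1 / c) ^ 2) ^ 2 * ((∑ i, disc S πh mh π' m' i ω) / n) ^ 2 ∂P := by
        refine integral_mono_ae ((AEBdd.norm_pi fun k => (R.aebdd_avgCellMean k).sub
          (R.limit.aebdd_avgCellMean k)).pow 2).integrable
          ((((AEBdd.sum _ R.aebdd_disc).div_const _).pow 2).const_mul _).integrable ?_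
        filter_upwards [ae_all_iff.2 fun i => ae_all_iff.2 fun k => R.abs_cellMean_sub_le i k]
          with ω h
        rw [← mul_pow]
        gcongr
        refine (pi_norm_le_iff_of_nonneg (mul_nonneg (by positivity) (div_nonneg
          (Finset.sum_nonneg fun i _ => disc_nonneg i ω) (Nat.cast_nonneg n)))).2 fun k => ?_
        rw [Real.norm_eq_abs, Pi.sub_apply, avgCellMean, avgCellMean, ← sub_div,
          ← Finset.sum_sub_distrib, abs_div, Nat.abs_cast, mul_div_assoc', Finset.mul_sum]
        gcongr
        exact (Finset.abs_sum_le_sum_abs _ _).trans (Finset.sum_le_sum fun i _ => h i k)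
    _ ≤ _ := by
        rw [integral_const_mul]
        gcongr
        exact integral_sq_avg_le_avg R.aebdd_disc

lemma integral_cell_limit (i : Fin n) (k : Cell T) :
    ∫ ω, D.cell Q (fun i _ => π' i) (fun i _ => m' i) i ω k ∂P
      = D.cellMean P Q i (π' i) (m' i) k := by
  have h : ∫ ω, (D.cell Q (fun i _ => π' i) (fun i _ => m' i) i ω k
      - D.cellMean P Q i (π' i) (m' i) k) ∂P = 0 := by
    rcases k with ⟨w, _ | t⟩
    · have e : ∀ ω, _ := cell_sub_cellMean_none P D Q (fun i _ => π' i) (fun i _ => m' i) w i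
      simp_rw [e]
      rw [integral_mul_const, R.integral_indC, zero_mul]
    · have e : ∀ ω, _ :=
        cell_sub_cellMean_some P D Q (fun i _ => π' i) (fun i _ => m' i) m' w t i
      simp_rw [e]
      -- At the limits the adjustment is m' itself, so the second term of the decomposition
      -- disappears.
      simp only [sub_self, mul_zero, sub_zero]
      rw [integral_mul_const, R.integral_outC, zero_mul]
  rw [integral_sub (R.limit.aebdd_cell i k).integrable (integrable_const _)] at h
  simpa [sub_eq_zero] using h

lemma integral_avgCell_limit (k : Cell T) (ω₀ : Ω) :
    ∫ ω, D.avgCell Q (fun i _ => π' i) (fun i _ => m' i) ω k ∂P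
      = D.avgCellMean P Q (fun i _ => π' i) (fun i _ => m' i) ω₀ k := by
  unfold avgCell avgCellMean
  rw [integral_div, integral_finsetSum _ fun i _ => (R.limit.aebdd_cell i k).integrable]
  simp_rw [R.integral_cell_limit]

/-! #### Comparison of the distances with mean squared errors -/

lemma integral_sq_prop_sub (i : Fin n) (p : Path T → ℝ) :
    ∫ ω, (πh i ω (D.W i ω) - p (D.W i ω)) ^ 2 ∂P
      = ∑ w, D.prop P i w * ∫ ω, (πh i ω w - p w) ^ 2 ∂P := by
  have h1 : ∀ ω, (πh i ω (D.W i ω) - p (D.W i ω)) ^ 2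
      = ∑ w, (if D.W i ω = w then (1 : ℝ) else 0) * (πh i ω w - p w) ^ 2 := fun ω => by
    simp
  have hb : ∀ w, AEBdd P fun ω => (πh i ω w - p w) ^ 2 := fun w =>
    ((R.aebdd_prop i w).sub (AEBdd.const _)).pow 2
  simp_rw [h1]
  rw [integral_finsetSum _ fun w _ => ((R.aebdd_ind w i).mul (hb w)).integrable]
  refine Finset.sum_congr rfl fun w _ => ?_
  have hm : Measurable[MeasurableSpace.comap (D.unit i) inferInstance]
      fun ω => if D.W i ω = w then (1 : ℝ) else 0 := by
    have : Measurable fun z : (Bool → Fin T → ℝ) × Path T => if z.2 = w then (1 : ℝ) else 0 :=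
      Measurable.ite (measurable_snd (measurableSet_singleton w)) measurable_const measurable_const
    exact this.comp (comap_measurable (D.unit i))
  have hind := indepFun_outOfFold R.measurable_unit R.indep fold i hm
    (g := fun ω => (πh i ω w - p w) ^ 2) (((R.prop_measurable i w).sub_const _).pow_const 2)
  rw [hind.integral_fun_mul_eq_mul_integral (R.aebdd_ind w i).measurable.aestronglyMeasurable
    (hb w).measurable.aestronglyMeasurable, R.integral_ind]

/-- Mean squared errors are evaluated at the realized path, while the weights need every path in S.
The estimate is independent of W_i, so the error at W_i is an average over paths with weights
π_i(w), and these exceed c on S. -/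
lemma sum_integral_sq_prop_sub_le (i : Fin n) (p : Path T → ℝ) :
    ∑ w ∈ S, ∫ ω, (πh i ω w - p w) ^ 2 ∂P
      ≤ 1 / c * ∫ ω, (πh i ω (D.W i ω) - p (D.W i ω)) ^ 2 ∂P := by
  rw [R.integral_sq_prop_sub, Finset.mul_sum]
  have h0 : ∀ w, 0 ≤ ∫ ω, (πh i ω w - p w) ^ 2 ∂P := fun w => integral_nonneg fun ω => sq_nonneg _
  have hc := R.c_pos
  refine (Finset.sum_le_sum fun w hw => ?_).trans (Finset.sum_le_sum_of_subset_of_nonneg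
    (Finset.subset_univ S) fun w _ _ => ?_)
  · rw [← mul_assoc]
    refine le_mul_of_one_le_left (h0 w) ?_
    rw [one_div, inv_mul_eq_div, one_le_div hc]
    exact (R.prop_gt i w hw).le
  · exact mul_nonneg (by positivity) (mul_nonneg (prop_nonneg i w) (h0 w))

lemma integral_sq_l2_sub (i : Fin n) (m : Fin T → ℝ) :
    ∫ ω, l2 (fun t => mh i ω t - m t) ^ 2 ∂P = ∑ t, ∫ ω, (mh i ω t - m t) ^ 2 ∂P := by
  simp_rw [sq_l2]
  exact integral_finsetSum _ fun t _ => (((R.aebdd_out i t).sub (AEBdd.const _)).pow 2).integrable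

lemma avgDisc_le : avgDisc P S πh mh π' m'
    ≤ 2 * (Fintype.card (Path T) * (1 / c) + T) * D.limitError P πh mh π' m' := by
  have hc := R.c_pos
  rw [avgDisc, limitError, mul_div_assoc', Finset.mul_sum]
  gcongr with i
  set A := ∫ ω, (πh i ω (D.W i ω) - π' i (D.W i ω)) ^ 2 ∂P with hA
  set B := ∫ ω, l2 (fun t => mh i ω t - m' i t) ^ 2 ∂P with hB
  have hA0 : 0 ≤ A := integral_nonneg fun ω => sq_nonneg _
  have hB0 : 0 ≤ B := integral_nonneg fun ω => sq_nonneg _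
  have b1 : ∀ w, AEBdd P fun ω => (πh i ω w - π' i w) ^ 2 := fun w =>
    ((R.aebdd_prop i w).sub (AEBdd.const _)).pow 2
  have b2 : ∀ t, AEBdd P fun ω => (mh i ω t - m' i t) ^ 2 := fun t => (R.aebdd_out_sub i t).pow 2
  calc ∫ ω, disc S πh mh π' m' i ω ^ 2 ∂P
      ≤ ∫ ω, (2 * Fintype.card (Path T) * ∑ w ∈ S, (πh i ω w - π' i w) ^ 2
          + 2 * T * ∑ t, (mh i ω t - m' i t) ^ 2) ∂P := by
        refine integral_mono ((R.aebdd_disc i).pow 2).integrable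
          (((AEBdd.sum _ b1).const_mul _).add ((AEBdd.sum _ b2).const_mul _)).integrable fun ω => ?_
        have h1 := sq_sum_le_card_univ S fun w => |πh i ω w - π' i w|
        have h2 := sq_sum_le_card_univ Finset.univ fun t => |mh i ω t - m' i t|
        simp only [sq_abs, Fintype.card_fin] at h1 h2
        simp only [disc]
        nlinarith [sq_nonneg (∑ w ∈ S, |πh i ω w - π' i w| - ∑ t, |mh i ω t - m' i t|)]
    _ = 2 * Fintype.card (Path T) * (∑ w ∈ S, ∫ ω, (πh i ω w - π' i w) ^ 2 ∂P) + 2 * T * B := by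
        rw [integral_add ((AEBdd.sum _ b1).const_mul _).integrable
          ((AEBdd.sum _ b2).const_mul _).integrable, integral_const_mul, integral_const_mul,
          integral_finsetSum _ fun w _ => (b1 w).integrable,
          integral_finsetSum _ fun t _ => (b2 t).integrable, hB, R.integral_sq_l2_sub]
    _ ≤ 2 * Fintype.card (Path T) * (1 / c * A) + 2 * T * B := by
        gcongr
        exact R.sum_integral_sq_prop_sub_le i (π' i)
    _ ≤ _ := by
        have e1 : 0 ≤ 2 * (Fintype.card (Path T) : ℝ) * (1 / c) * B := by positivity
        have e2 : 0 ≤ 2 * (T : ℝ) * A := by positivity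
        linarith

/-! #### The bias -/

lemma tau_eq (i : Fin n) (t : Fin T) : D.tau P i t = D.meanY P true i t - D.meanY P false i t :=
  integral_sub (R.aebdd_Y _ _ _).integrable (R.aebdd_Y _ _ _).integrable

/-- The inputs for the bias bound, with p_i = π_i Π/π̂_i. Since p_i - Π = (Π/π̂_i)(π_i - π̂_i), the
distance of the frozen weights from Π is controlled by the propensity error on S. -/
lemma sum_weight_mul_le (i : Fin n) : ∀ᵐ ω ∂P,
    (∀ w, 0 ≤ D.prop P i w * (Q w / πh i ω w)) ∧ ∑ w, D.prop P i w * (Q w / πh i ω w) ≤ 1 / c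
      ∧ ∑ w, |D.prop P i w * (Q w / πh i ω w) - Q w|
        ≤ 1 / c * ∑ w ∈ S, |πh i ω w - D.prop P i w| := by
  have hc := R.c_pos
  filter_upwards [R.est_gt i] with ω h
  have hw0 : ∀ w, 0 ≤ Q w / πh i ω w ∧ Q w / πh i ω w ≤ Q w * (1 / c) := fun w => by
    by_cases hw : w ∈ S
    · have := h w hw
      refine ⟨div_nonneg (R.Q_nonneg w) (hc.trans this).le, ?_⟩
      rw [mul_one_div]
      exact div_le_div_of_nonneg_left (R.Q_nonneg w) hc this.le
    · simp [R.reshaped.2.1 w hw]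
  refine ⟨fun w => mul_nonneg (prop_nonneg i w) (hw0 w).1, ?_, ?_⟩
  · calc _ ≤ ∑ w, Q w * (1 / c) := Finset.sum_le_sum fun w _ =>
          (mul_le_of_le_one_left (hw0 w).1 (prop_le_one i w)).trans (hw0 w).2
      _ = _ := by rw [← Finset.sum_mul, R.reshaped.2.2, one_mul]
  · rw [← Finset.sum_subset (Finset.subset_univ S) fun w _ hw => by simp [R.reshaped.2.1 w hw],
      Finset.mul_sum]
    refine Finset.sum_le_sum fun w hw => ?_
    have h1 := h w hw
    have h1' := hc.trans h1
    have e : D.prop P i w * (Q w / πh i ω w) - Q w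
        = Q w / πh i ω w * (D.prop P i w - πh i ω w) := by field_simp
    rw [e, abs_mul, abs_of_nonneg (hw0 w).1, abs_sub_comm]
    refine mul_le_mul_of_nonneg_right ((hw0 w).2.trans ?_) (abs_nonneg _)
    exact mul_le_of_le_one_left (by positivity) (R.Q_le_one w)

/-- Brings the mean cells to the shape required by the bias bound. Double centering writes
E[Y_it(0)] as m_it plus a unit term and a time term, and the treatment effect is split into τ* and
its deviation. -/
lemma avgCellMean_some {ξ : Fin T → ℝ} (w : Path T) (t : Fin T) (ω : Ω) :
    D.avgCellMean P Q πh mh ω (w, some t)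
      = (∑ i, D.prop P i w * (Q w / πh i ω w) *
          (((D.m P i t - mh i ω t) + w.vec t * (D.tau P i t - D.date P ξ))
            + ((∑ s, D.meanY0 P i s) / T - (∑ j, ∑ s, D.meanY0 P j s) / (n * T))
            + (∑ j, D.meanY0 P j t) / n + D.date P ξ * w.vec t)) / n := by
  unfold avgCellMean cellMean
  congr 1
  refine Finset.sum_congr rfl fun i _ => ?_
  simp only [Option.elim]
  congr 1
  have h0 : D.meanY P (w t) i t = D.meanY0 P i t + w.vec t * D.tau P i t := by
    rw [R.tau_eq]
    unfold Path.vec meanY0 meanY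
    cases w t <;> simp
  rw [h0, m]
  ring

/-- The bias bound holds for almost every outcome with the estimates frozen, and is a product of two
root mean squares over units. Cauchy–Schwarz over the probability space separates their expectations
into δ̄_π and δ̄_y. -/
theorem integral_abs_form_avgCellMean_le (hn : 0 < n) {ξ : Fin T → ℝ} (hξ : IsTimeWeight ξ)
    (hDATE : DATEEquation Q ξ) :
    ∫ ω, |form (D.date P ξ) (D.avgCellMean P Q πh mh ω) (D.avgCellMean P Q πh mh ω)| ∂P
      ≤ (4 + 8 * T) * (1 / c) * (√(Fintype.card (Path T) * (1 / c) ^ 3) * √(2 * T))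
        * (D.avgDeltaProp P πh * D.avgDeltaOut P ξ mh) := by
  have hc := R.c_pos
  have hn' : (n : ℝ) ≠ 0 := by exact_mod_cast hn.ne'
  set δ : Fin n → Fin T → ℝ := fun i t => D.tau P i t - D.date P ξ with hδ
  -- This is the defining property of τ*: the effect deviations have zero average under the weights
  -- ξ.
  have hδ0 : ∑ t, ξ t * ∑ i, δ i t = 0 := by
    simp only [hδ, Finset.sum_sub_distrib, mul_sub]
    simp only [Finset.sum_const, Finset.card_univ, Fintype.card_fin, nsmul_eq_mul]
    rw [← Finset.sum_mul, hξ.2, date]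
    simp only [mul_div_assoc', ← Finset.sum_div]
    field_simp
    ring
  set X : Fin n → Ω → ℝ := fun i ω => ∑ w, |D.prop P i w * (Q w / πh i ω w) - Q w| with hX
  set Y : Fin n → Ω → ℝ := fun i ω => ∑ t, (|D.m P i t - mh i ω t| + |δ i t|) with hY
  have hXb : ∀ i, AEBdd P (X i) := fun i => AEBdd.sum _ fun w =>
    (((R.aebdd_weight i w).const_mul _).sub (AEBdd.const _)).abs
  have hYb : ∀ i, AEBdd P (Y i) := fun i => AEBdd.sum _ fun t =>
    (((AEBdd.const _).sub (R.aebdd_out i t)).abs).add (AEBdd.const _)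
  have hXa : AEBdd P fun ω => (∑ i, X i ω ^ 2) / n :=
    (AEBdd.sum _ fun i => (hXb i).pow 2).div_const _
  have hYa : AEBdd P fun ω => (∑ i, Y i ω ^ 2) / n :=
    (AEBdd.sum _ fun i => (hYb i).pow 2).div_const _
  have hXX : ∫ ω, (∑ i, X i ω ^ 2) / n ∂P
      ≤ Fintype.card (Path T) * (1 / c) ^ 3 * D.avgDeltaProp P πh ^ 2 := by
    rw [avgDeltaProp, Real.sq_sqrt (div_nonneg (Finset.sum_nonneg fun i _ => sq_nonneg _)
      (Nat.cast_nonneg n)), integral_div,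
      integral_finsetSum _ fun i _ => ((hXb i).pow 2).integrable, mul_div_assoc', Finset.mul_sum]
    gcongr with i
    have hb : ∀ w, AEBdd P fun ω => (πh i ω w - D.prop P i w) ^ 2 := fun w =>
      ((R.aebdd_prop i w).sub (AEBdd.const _)).pow 2
    have hs : D.deltaProp P πh i ^ 2
        = ∫ ω, (πh i ω (D.W i ω) - D.prop P i (D.W i ω)) ^ 2 ∂P :=
      Real.sq_sqrt (integral_nonneg fun ω => sq_nonneg _)
    rw [hs]
    calc ∫ ω, X i ω ^ 2 ∂P ≤ ∫ ω, (1 / c) ^ 2 *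
          (Fintype.card (Path T) * ∑ w ∈ S, (πh i ω w - D.prop P i w) ^ 2) ∂P := by
          refine integral_mono_ae ((hXb i).pow 2).integrable
            (((AEBdd.sum _ hb).const_mul _).const_mul _).integrable ?_
          filter_upwards [R.sum_weight_mul_le i] with ω h
          have h1 := sq_sum_le_card_univ S fun w => |πh i ω w - D.prop P i w|
          simp only [sq_abs] at h1
          have h2 : X i ω ^ 2 ≤ (1 / c * ∑ w ∈ S, |πh i ω w - D.prop P i w|) ^ 2 :=
            pow_le_pow_left₀ (Finset.sum_nonneg fun w _ => abs_nonneg _) h.2.2 2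
          refine h2.trans ?_
          rw [mul_pow]
          gcongr
      _ = (1 / c) ^ 2 * (Fintype.card (Path T)
          * ∑ w ∈ S, ∫ ω, (πh i ω w - D.prop P i w) ^ 2 ∂P) := by
          rw [integral_const_mul, integral_const_mul,
            integral_finsetSum _ fun w _ => (hb w).integrable]
      _ ≤ (1 / c) ^ 2 * (Fintype.card (Path T)
          * (1 / c * ∫ ω, (πh i ω (D.W i ω) - D.prop P i (D.W i ω)) ^ 2 ∂P)) := by
          gcongr
          exact R.sum_integral_sq_prop_sub_le i _
      _ = _ := by ring
  have hYY : ∫ ω, (∑ i, Y i ω ^ 2) / n ∂P ≤ 2 * T * D.avgDeltaOut P ξ mh ^ 2 := by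
    rw [avgDeltaOut, Real.sq_sqrt (div_nonneg (Finset.sum_nonneg fun i _ => sq_nonneg _)
      (Nat.cast_nonneg n)), integral_div,
      integral_finsetSum _ fun i _ => ((hYb i).pow 2).integrable, mul_div_assoc', Finset.mul_sum]
    gcongr with i
    have hb : ∀ t, AEBdd P fun ω => (mh i ω t - D.m P i t) ^ 2 := fun t =>
      ((R.aebdd_out i t).sub (AEBdd.const _)).pow 2
    have hs : (∫ ω, l2 (fun t => mh i ω t - D.m P i t) ^ 2 ∂P)
        + l2 (fun t => D.tau P i t - D.date P ξ) ^ 2 ≤ D.deltaOut P ξ mh i ^ 2 := by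
      unfold deltaOut
      have h0 : 0 ≤ ∫ ω, l2 (fun t => mh i ω t - D.m P i t) ^ 2 ∂P :=
        integral_nonneg fun ω => sq_nonneg _
      have h1 := Real.sq_sqrt h0
      have h2 : 0 ≤ √(∫ ω, l2 (fun t => mh i ω t - D.m P i t) ^ 2 ∂P)
          * l2 (fun t => D.tau P i t - D.date P ξ) :=
        mul_nonneg (Real.sqrt_nonneg _) (Real.sqrt_nonneg _)
      nlinarith
    calc ∫ ω, Y i ω ^ 2 ∂P ≤ ∫ ω, (2 * T * ∑ t, (mh i ω t - D.m P i t) ^ 2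
          + 2 * T * ∑ t, δ i t ^ 2) ∂P := by
          refine integral_mono ((hYb i).pow 2).integrable
            (((AEBdd.sum _ hb).const_mul _).add (AEBdd.const _)).integrable fun ω => ?_
          have h1 := sq_sum_le_card_univ Finset.univ fun t => (|D.m P i t - mh i ω t| + |δ i t|)
          rw [Fintype.card_fin] at h1
          refine h1.trans ?_
          rw [Finset.mul_sum, Finset.mul_sum, Finset.mul_sum, ← Finset.sum_add_distrib]
          refine Finset.sum_le_sum fun t _ => ?_
          rw [← mul_add, mul_comm 2 (T : ℝ), mul_assoc]
          gcongr
          rw [← sq_abs (mh i ω t - D.m P i t), ← sq_abs (δ i t), abs_sub_comm (mh i ω t)]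
          nlinarith [sq_nonneg (|D.m P i t - mh i ω t| - |δ i t|)]
      _ = 2 * T * ((∫ ω, l2 (fun t => mh i ω t - D.m P i t) ^ 2 ∂P)
          + l2 (fun t => D.tau P i t - D.date P ξ) ^ 2) := by
          rw [integral_add ((AEBdd.sum _ hb).const_mul _).integrable (integrable_const _),
            integral_const_mul, integral_finsetSum _ fun t _ => (hb t).integrable,
            R.integral_sq_l2_sub, sq_l2]
          simp
          ring
      _ ≤ _ := by gcongr
  have hpt : ∀ᵐ ω ∂P, |form (D.date P ξ) (D.avgCellMean P Q πh mh ω) (D.avgCellMean P Q πh mh ω)|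
      ≤ (4 + 8 * T) * (1 / c) * |√((∑ i, X i ω ^ 2) / n) * √((∑ i, Y i ω ^ 2) / n)| := by
    filter_upwards [ae_all_iff.2 R.sum_weight_mul_le] with ω h
    rw [abs_of_nonneg (mul_nonneg (Real.sqrt_nonneg _) (Real.sqrt_nonneg _))]
    exact abs_form_bias_le R.Q_nonneg R.reshaped.2.2 hDATE hn
      (p := fun i w => D.prop P i w * (Q w / πh i ω w))
      (e := fun i t => D.m P i t - mh i ω t) (δ := δ)
      (fun w => by simp [avgCellMean, cellMean]) (fun w t => R.avgCellMean_some w t ω) hδ0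
      (fun i => (h i).1) (fun i => (h i).2.1)
  have hform := AEBdd.form R.aebdd_avgCellMean R.aebdd_avgCellMean (D.date P ξ)
  refine (integral_mono_ae hform.abs.integrable
    ((hXa.sqrt.mul hYa.sqrt).abs.const_mul _).integrable hpt).trans ?_
  rw [integral_const_mul, mul_assoc ((4 + 8 * (T : ℝ)) * (1 / c))]
  gcongr
  refine (integral_abs_mul_le hXa.sqrt hYa.sqrt).trans ?_
  have hsX : ∫ ω, √((∑ i, X i ω ^ 2) / n) ^ 2 ∂P = ∫ ω, (∑ i, X i ω ^ 2) / n ∂P :=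
    integral_congr_ae (ae_of_all _ fun ω => Real.sq_sqrt (div_nonneg
      (Finset.sum_nonneg fun i _ => sq_nonneg _) (Nat.cast_nonneg n)))
  have hsY : ∫ ω, √((∑ i, Y i ω ^ 2) / n) ^ 2 ∂P = ∫ ω, (∑ i, Y i ω ^ 2) / n ∂P :=
    integral_congr_ae (ae_of_all _ fun ω => Real.sq_sqrt (div_nonneg
      (Finset.sum_nonneg fun i _ => sq_nonneg _) (Nat.cast_nonneg n)))
  rw [hsX, hsY]
  calc _ ≤ √(Fintype.card (Path T) * (1 / c) ^ 3 * D.avgDeltaProp P πh ^ 2)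
        * √(2 * T * D.avgDeltaOut P ξ mh ^ 2) :=
        mul_le_mul (Real.sqrt_le_sqrt hXX) (Real.sqrt_le_sqrt hYY) (Real.sqrt_nonneg _)
          (Real.sqrt_nonneg _)
    _ = _ := by
        rw [Real.sqrt_mul' _ (sq_nonneg _), Real.sqrt_mul' _ (sq_nonneg _),
          Real.sqrt_sq (show 0 ≤ D.avgDeltaProp P πh from Real.sqrt_nonneg _),
          Real.sqrt_sq (show 0 ≤ D.avgDeltaOut P ξ mh from Real.sqrt_nonneg _)]
        ring

end Regular

end Panel

/-! ### Convergence to zero in probability along a sequence of probability spaces -/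

section TendstoZero

variable {Ω : ℕ → Type*} [∀ n, MeasurableSpace (Ω n)] {P : ∀ n, Measure (Ω n)}

/-- `X n → 0` in probability; the functions need not be measurable. -/
def TendstoZeroInProb (P : ∀ n, Measure (Ω n)) (X : ∀ n, Ω n → ℝ) : Prop :=
  ∀ ε > 0, Tendsto (fun n => P n {ω | ε < |X n ω|}) atTop (𝓝 0)

namespace TendstoZeroInProb

variable {X Y : ∀ n, Ω n → ℝ}

/-- The general transfer principle: smallness of Y implies smallness of X away from events of
vanishing probability. These events will be those on which the denominator is small. -/
lemma of_measure_le {s : ∀ n, Set (Ω n)} (hs : Tendsto (fun n => P n (s n)) atTop (𝓝 0))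
    (hY : TendstoZeroInProb P Y)
    (h : ∀ ε > 0, ∃ δ > 0, ∀ᶠ n in atTop, ∀ᵐ ω ∂(P n), ω ∉ s n → |Y n ω| ≤ δ → |X n ω| ≤ ε) :
    TendstoZeroInProb P X := by
  intro ε hε
  obtain ⟨δ, hδ, hn⟩ := h ε hε
  have hlim : Tendsto (fun n => P n (s n) + P n {ω | δ < |Y n ω|}) atTop (𝓝 0) := by
    simpa using hs.add (hY δ hδ)
  refine tendsto_of_tendsto_of_tendsto_of_le_of_le' tendsto_const_nhds hlim
    (Eventually.of_forall fun n => zero_le) ?_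
  filter_upwards [hn] with n hn
  refine (measure_mono_ae ?_).trans (measure_union_le _ _)
  filter_upwards [hn] with ω h hω
  by_contra hc
  have hc' : ω ∉ s n ∧ ¬ δ < |Y n ω| := by
    simpa [not_or] using show ¬ (ω ∈ s n ∨ δ < |Y n ω|) from hc
  exact absurd (h hc'.1 (not_lt.1 hc'.2)) (not_le.2 hω)

lemma mono (hY : TendstoZeroInProb P Y)
    (h : ∀ᶠ n in atTop, ∀ᵐ ω ∂(P n), |X n ω| ≤ |Y n ω|) : TendstoZeroInProb P X :=
  of_measure_le (s := fun _ => ∅) (by simp) hY fun ε hε => ⟨ε, hε, by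
    filter_upwards [h] with n hn
    filter_upwards [hn] with ω h _ h' using h.trans h'⟩

lemma const_mul (hX : TendstoZeroInProb P X) (a : ℝ) :
    TendstoZeroInProb P fun n ω => a * X n ω :=
  of_measure_le (s := fun _ => ∅) (by simp) hX fun ε hε => ⟨ε / (|a| + 1), by positivity,
    Eventually.of_forall fun n => ae_of_all _ fun ω _ h => by
      rw [le_div_iff₀ (by positivity)] at h
      rw [abs_mul]
      nlinarith [abs_nonneg (X n ω)]⟩

lemma add (hX : TendstoZeroInProb P X) (hY : TendstoZeroInProb P Y) :
    TendstoZeroInProb P fun n ω => X n ω + Y n ω :=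
  of_measure_le (s := fun n => ∅) (by simp)
    (Y := fun n ω => max |X n ω| |Y n ω|) (fun ε hε => by
      have hlim : Tendsto (fun n => P n {ω | ε < |X n ω|} + P n {ω | ε < |Y n ω|}) atTop (𝓝 0) := by
        simpa using (hX ε hε).add (hY ε hε)
      refine tendsto_of_tendsto_of_tendsto_of_le_of_le tendsto_const_nhds hlim
        (fun n => zero_le) fun n => ?_
      refine (measure_mono fun ω hω => ?_).trans (measure_union_le _ _)
      have h1 : ε < max |X n ω| |Y n ω| := by
        rwa [Set.mem_ofPred_eq, abs_of_nonneg (le_max_of_le_left (abs_nonneg _))] at hω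
      exact lt_max_iff.1 h1)
    fun ε hε => ⟨ε / 2, by positivity, Eventually.of_forall fun n => ae_of_all _ fun ω _ h => by
      rw [abs_of_nonneg (le_max_of_le_left (abs_nonneg _)), max_le_iff] at h
      linarith [abs_add_le (X n ω) (Y n ω)]⟩

lemma of_integral [∀ n, IsProbabilityMeasure (P n)] {a : ℕ → ℝ}
    (hX : ∀ᶠ n in atTop, Integrable (X n) (P n))
    (h : ∀ᶠ n in atTop, ∫ ω, |X n ω| ∂(P n) ≤ a n) (ha : Tendsto a atTop (𝓝 0)) :
    TendstoZeroInProb P X := by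
  intro ε hε
  have hlim : Tendsto (fun n => ENNReal.ofReal (a n / ε)) atTop (𝓝 0) := by
    have := ENNReal.tendsto_ofReal (ha.div_const ε)
    simpa using this
  refine tendsto_of_tendsto_of_tendsto_of_le_of_le' tendsto_const_nhds hlim
    (Eventually.of_forall fun n => zero_le) ?_
  filter_upwards [hX, h] with n hXn hn
  have h1 := mul_meas_ge_le_integral_of_nonneg (μ := P n) (f := fun ω => |X n ω|)
    (ae_of_all _ fun ω => abs_nonneg _) hXn.abs ε
  have h2 : (P n).real {ω | ε < |X n ω|} ≤ a n / ε := by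
    rw [le_div_iff₀ hε, mul_comm]
    refine le_trans (mul_le_mul_of_nonneg_left ?_ hε.le) (h1.trans hn)
    exact measureReal_mono fun ω (hω : ε < |X n ω|) => hω.le
  rw [← ENNReal.ofReal_toReal (measure_ne_top (P n) {ω | ε < |X n ω|})]
  exact ENNReal.ofReal_le_ofReal h2

lemma of_integral_sq [∀ n, IsProbabilityMeasure (P n)] {a : ℕ → ℝ}
    (hX : ∀ n, AEBdd (P n) (X n)) (h : ∀ᶠ n in atTop, ∫ ω, X n ω ^ 2 ∂(P n) ≤ a n)
    (ha : Tendsto a atTop (𝓝 0)) : TendstoZeroInProb P X := by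
  refine of_integral (a := fun n => √(a n)) (Eventually.of_forall fun n => (hX n).integrable) ?_
    (by simpa using ha.sqrt)
  filter_upwards [h] with n hn
  exact (integral_abs_le_sqrt (hX n)).trans (Real.sqrt_le_sqrt hn)

end TendstoZeroInProb

end TendstoZero

/-! ### Linearization of the numerator -/

/-- The four pieces are the bias, the drift of the estimates against the noise s, the change of the
noise caused by estimation, and the squared noise. The drift G₀ - g is paired only with s: its own
square is absorbed in the bias B(G₀, G₀), which has a separate bound. -/
lemma form_expansion {T : ℕ} (τ : ℝ) (G G₀ g s : Cell T → ℝ) :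
    form τ G G - (form τ g s + form τ s g)
      = form τ G₀ G₀ + (form τ (G₀ - g) s + form τ s (G₀ - g))
        + (form τ G₀ (G - G₀ - s) + form τ (G - G₀ - s) G₀) + form τ (G - G₀) (G - G₀) := by
  simp only [map_sub, LinearMap.sub_apply]
  ring

namespace Panel

/-- The mean of the cell averages at the deterministic limits of the estimates. -/
def limMean {n T : ℕ} {Ω : Type*} [MeasurableSpace Ω] (P : Measure Ω) (Q : Path T → ℝ)
    (D : Panel n T Ω) (π' : Fin n → Path T → ℝ) (m' : Fin n → Fin T → ℝ) : Cell T → ℝ :=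
  fun k => (∑ i, D.cellMean P Q i (π' i) (m' i) k) / n

/-- The cell averages at the deterministic limits of the estimates. -/
def limCell {n T : ℕ} {Ω : Type*} (Q : Path T → ℝ) (D : Panel n T Ω)
    (π' : Fin n → Path T → ℝ) (m' : Fin n → Fin T → ℝ) (ω : Ω) : Cell T → ℝ :=
  D.avgCell Q (fun i _ => π' i) (fun i _ => m' i) ω

namespace Regular

variable {n T K : ℕ} {Ω : Type*} [MeasurableSpace Ω]
  {P : Measure Ω} [IsProbabilityMeasure P] {D : Panel n T Ω} {S : Finset (Path T)}
  {Q : Path T → ℝ} {fold : Fin n → Fin K} {πh : PropEst n T Ω} {mh : OutEst n T Ω}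
  {π' : Fin n → Path T → ℝ} {m' : Fin n → Fin T → ℝ} {c M : ℝ}
  (R : D.Regular P S Q fold πh mh π' m' c M)

include R

lemma abs_tau_le (i : Fin n) (t : Fin T) : |D.tau P i t| ≤ 2 * M := by
  rw [R.tau_eq, ← sub_sub_sub_cancel_right _ _ (m' i t)]
  refine (abs_sub _ _).trans ?_
  linarith [R.abs_meanY_sub_le true i t, R.abs_meanY_sub_le false i t]

lemma abs_date_le {ξ : Fin T → ℝ} (hξ : IsTimeWeight ξ) : |D.date P ξ| ≤ 2 * M := by
  have hM := R.one_le_M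
  unfold date
  refine (Finset.abs_sum_le_sum_abs _ _).trans ?_
  calc ∑ t, |ξ t * ((∑ i, D.tau P i t) / n)| ≤ ∑ t, ξ t * (2 * M) := by
        refine Finset.sum_le_sum fun t _ => ?_
        rw [abs_mul, abs_of_nonneg (hξ.1 t)]
        exact mul_le_mul_of_nonneg_left
          (abs_avg_le (by positivity) fun i => R.abs_tau_le i t) (hξ.1 t)
    _ = 2 * M := by rw [← Finset.sum_mul, hξ.2, one_mul]

lemma norm_limMean_le : ‖D.limMean P Q π' m'‖ ≤ 3 * M * (1 / c) := by
  obtain ⟨ω, h⟩ := R.limit.norm_avgCellMean_le.exists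
  exact h

/-- The linearization error of the numerator. -/
theorem integral_abs_form_sub_le {τ C a₁ a₂ a₃ a₄ : ℝ} (hC0 : 0 ≤ C)
    (hC : ∀ x y : Cell T → ℝ, |form τ x y| ≤ C * ‖x‖ * ‖y‖)
    (h₁ : ∫ ω, ‖D.avgCell Q πh mh ω - D.avgCellMean P Q πh mh ω‖ ^ 2 ∂P ≤ a₁)
    (h₂ : ∫ ω, ‖D.limCell Q π' m' ω - D.limMean P Q π' m'‖ ^ 2 ∂P ≤ a₂)
    (h₃ : ∫ ω, ‖(D.avgCell Q πh mh ω - D.avgCellMean P Q πh mh ω)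
      - (D.limCell Q π' m' ω - D.limMean P Q π' m')‖ ^ 2 ∂P ≤ a₃)
    (h₄ : ∫ ω, ‖D.avgCellMean P Q πh mh ω - D.limMean P Q π' m'‖ ^ 2 ∂P ≤ a₄) :
    ∫ ω, |form τ (D.avgCell Q πh mh ω) (D.avgCell Q πh mh ω)
      - (form τ (D.limMean P Q π' m') (D.limCell Q π' m' ω - D.limMean P Q π' m')
        + form τ (D.limCell Q π' m' ω - D.limMean P Q π' m') (D.limMean P Q π' m'))| ∂P
      ≤ (∫ ω, |form τ (D.avgCellMean P Q πh mh ω) (D.avgCellMean P Q πh mh ω)| ∂P)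
        + 2 * C * (√a₄ * √a₂) + 2 * C * (3 * M * (1 / c)) * √a₃ + C * a₁ := by
  have hM := R.one_le_M
  have hc := R.one_le_inv
  set G := D.avgCell Q πh mh
  set G₀ := D.avgCellMean P Q πh mh
  set g := D.limMean P Q π' m'
  set s : Ω → Cell T → ℝ := fun ω => D.limCell Q π' m' ω - g with hs
  have hG : ∀ k, AEBdd P fun ω => G ω k := R.aebdd_avgCell
  have hG₀ : ∀ k, AEBdd P fun ω => G₀ ω k := R.aebdd_avgCellMean
  have hg : ∀ k, AEBdd P fun _ => g k := fun k => AEBdd.const _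
  have hsb : ∀ k, AEBdd P fun ω => s ω k := fun k => (R.limit.aebdd_avgCell k).sub (hg k)
  have d1 : ∀ k, AEBdd P fun ω => (G₀ ω - g) k := fun k => (hG₀ k).sub (hg k)
  have d2 : ∀ k, AEBdd P fun ω => (G ω - G₀ ω) k := fun k => (hG k).sub (hG₀ k)
  have d3 : ∀ k, AEBdd P fun ω => (G ω - G₀ ω - s ω) k := fun k => (d2 k).sub (hsb k)
  have n1 := AEBdd.norm_pi d1
  have n2 := AEBdd.norm_pi d2
  have n3 := AEBdd.norm_pi d3
  have ns := AEBdd.norm_pi hsb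
  have hpt : ∀ᵐ ω ∂P, |form τ (G ω) (G ω) - (form τ g (s ω) + form τ (s ω) g)|
      ≤ |form τ (G₀ ω) (G₀ ω)| + 2 * C * |‖G₀ ω - g‖ * ‖s ω‖|
        + 2 * C * (3 * M * (1 / c)) * |‖G ω - G₀ ω - s ω‖| + C * ‖G ω - G₀ ω‖ ^ 2 := by
    filter_upwards [R.norm_avgCellMean_le] with ω h
    rw [form_expansion τ (G ω) (G₀ ω) g (s ω), abs_of_nonneg (show 0 ≤ ‖G₀ ω - g‖ * ‖s ω‖ by
      positivity), abs_norm]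
    have e1 := hC (G₀ ω - g) (s ω)
    have e2 := hC (s ω) (G₀ ω - g)
    have e3 : C * ‖G₀ ω‖ * ‖G ω - G₀ ω - s ω‖ ≤ C * (3 * M * (1 / c)) * ‖G ω - G₀ ω - s ω‖ := by
      gcongr
    have e4 := hC (G₀ ω) (G ω - G₀ ω - s ω)
    have e5 := hC (G ω - G₀ ω - s ω) (G₀ ω)
    have e6 := hC (G ω - G₀ ω) (G ω - G₀ ω)
    calc _ ≤ |form τ (G₀ ω) (G₀ ω)| + (|form τ (G₀ ω - g) (s ω)| + |form τ (s ω) (G₀ ω - g)|)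
          + (|form τ (G₀ ω) (G ω - G₀ ω - s ω)| + |form τ (G ω - G₀ ω - s ω) (G₀ ω)|)
          + |form τ (G ω - G₀ ω) (G ω - G₀ ω)| := by
          refine (abs_add_le _ _).trans (add_le_add ((abs_add_le _ _).trans (add_le_add
            ((abs_add_le _ _).trans (add_le_add le_rfl (abs_add_le _ _))) (abs_add_le _ _))) le_rfl)
      _ ≤ _ := by
          have e7 : C * ‖s ω‖ * ‖G₀ ω - g‖ = C * ‖G₀ ω - g‖ * ‖s ω‖ := by ring
          have e8 : C * ‖G ω - G₀ ω - s ω‖ * ‖G₀ ω‖ = C * ‖G₀ ω‖ * ‖G ω - G₀ ω - s ω‖ := by ring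
          have e9 : C * ‖G ω - G₀ ω‖ * ‖G ω - G₀ ω‖ = C * ‖G ω - G₀ ω‖ ^ 2 := by ring
          rw [e7] at e2; rw [e8] at e5; rw [e9] at e6
          linarith
  have hsg := AEBdd.form hg hsb τ
  have hgs := AEBdd.form hsb hg τ
  refine (integral_mono_ae ((AEBdd.form hG hG τ).sub (hsg.add hgs)).abs.integrable
    (((((AEBdd.form hG₀ hG₀ τ).abs.add ((n1.mul ns).abs.const_mul (2 * C))).add
      (n3.abs.const_mul (2 * C * (3 * M * (1 / c))))).add
      ((n2.pow 2).const_mul C))).integrable hpt).trans ?_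
  rw [integral_add ((((AEBdd.form hG₀ hG₀ τ).abs.add ((n1.mul ns).abs.const_mul _)).add
      (n3.abs.const_mul _))).integrable ((n2.pow 2).const_mul _).integrable,
    integral_add ((AEBdd.form hG₀ hG₀ τ).abs.add ((n1.mul ns).abs.const_mul _)).integrable
      (n3.abs.const_mul _).integrable,
    integral_add (AEBdd.form hG₀ hG₀ τ).abs.integrable ((n1.mul ns).abs.const_mul _).integrable,
    integral_const_mul, integral_const_mul, integral_const_mul]
  gcongr
  · exact (integral_abs_mul_le n1 ns).trans (by gcongr)
  · exact (integral_abs_le_sqrt n3).trans (by gcongr)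

end Regular

end Panel

/-! ### Asymptotics of numerator and denominator along the sequence of panels. -/

namespace Panel

section Sequence

variable {T : ℕ} {Ω : ℕ → Type*} [∀ n, MeasurableSpace (Ω n)] {P : ∀ n, Measure (Ω n)}
  [∀ n, IsProbabilityMeasure (P n)] {D : ∀ n, Panel n T (Ω n)} {S : Finset (Path T)}
  {Q : Path T → ℝ} {K : ℕ → ℕ} {fold : ∀ n, Fin n → Fin (K n)} {πh : ∀ n, PropEst n T (Ω n)}
  {mh : ∀ n, OutEst n T (Ω n)} {π' : ∀ n, Fin n → Path T → ℝ} {m' : ∀ n, Fin n → Fin T → ℝ}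
  {c M : ℝ}
  (R : ∀ n, (D n).Regular (P n) S Q (fold n) (πh n) (mh n) (π' n) (m' n) c M)

include R

/-- A single constant serves all n because the number of folds is bounded and c, M are fixed. With Δ
denoting `avgDisc`, noise is of order 1/n, the change of noise Δ/n, and the drifts Δ. -/
lemma exists_moment_bounds (hK : ∃ B, ∀ n, K n ≤ B) : ∃ A, 0 ≤ A ∧ ∀ n, 0 < n →
    (∫ ω, ‖(D n).avgCell Q (πh n) (mh n) ω - (D n).avgCellMean (P n) Q (πh n) (mh n) ω‖ ^ 2
      ∂(P n) ≤ A / n) ∧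
    (∫ ω, ‖(D n).limCell Q (π' n) (m' n) ω - (D n).limMean (P n) Q (π' n) (m' n)‖ ^ 2
      ∂(P n) ≤ A / n) ∧
    (∫ ω, ‖((D n).avgCell Q (πh n) (mh n) ω - (D n).avgCellMean (P n) Q (πh n) (mh n) ω)
        - ((D n).limCell Q (π' n) (m' n) ω - (D n).limMean (P n) Q (π' n) (m' n))‖ ^ 2 ∂(P n)
      ≤ A * avgDisc (P n) S (πh n) (mh n) (π' n) (m' n) / n) ∧
    (∫ ω, ‖(D n).avgCellMean (P n) Q (πh n) (mh n) ω - (D n).limMean (P n) Q (π' n) (m' n)‖ ^ 2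
      ∂(P n) ≤ A * avgDisc (P n) S (πh n) (mh n) (π' n) (m' n)) ∧
    (∑ i, ∫ ω, ‖(D n).cell Q (πh n) (mh n) i ω
        - (D n).cell Q (fun i _ => π' n i) (fun i _ => m' n i) i ω‖ ^ 2 ∂(P n)) / n
      ≤ A * avgDisc (P n) S (πh n) (mh n) (π' n) (m' n) := by
  obtain ⟨B, hB⟩ := hK
  have hM := (R 0).one_le_M
  have hc := (R 0).c_pos
  set a₁ : ℝ := Fintype.card (Cell T) * (40 * B * M ^ 4 * (1 / c) ^ 2) with ha₁
  set a₂ : ℝ := Fintype.card (Cell T) * (16 * B * M ^ 2 * (1 / c) ^ 4) with ha₂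
  set a₃ : ℝ := (2 * M * (1 / c) ^ 2) ^ 2 with ha₃
  have p₁ : 0 ≤ a₁ := by positivity
  have p₂ : 0 ≤ a₂ := by positivity
  have p₃ : 0 ≤ a₃ := by positivity
  refine ⟨a₁ + a₂ + a₃, by positivity, fun n hn => ?_⟩
  have hKB : (K n : ℝ) ≤ B := by exact_mod_cast hB n
  have hΔ : 0 ≤ avgDisc (P n) S (πh n) (mh n) (π' n) (m' n) :=
    div_nonneg (Finset.sum_nonneg fun i _ => integral_nonneg fun ω => sq_nonneg _)
      (Nat.cast_nonneg n)
  have b₁ : Fintype.card (Cell T) * (40 * K n * M ^ 4 * (1 / c) ^ 2 / n)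
      ≤ (a₁ + a₂ + a₃) / n := by
    rw [mul_div_assoc']
    gcongr
    calc _ ≤ a₁ := by rw [ha₁]; gcongr
      _ ≤ _ := by linarith
  refine ⟨((R n).integral_sq_norm_avgCell_sub_le hn).trans b₁,
    ((R n).limit.integral_sq_norm_avgCell_sub_le hn).trans b₁,
    (R n).integral_sq_norm_avgCell_sub_sub_le.trans ?_,
    (R n).integral_sq_norm_avgCellMean_sub_le.trans ?_,
    (R n).integral_sq_norm_cell_sub_le.trans ?_⟩
  · rw [mul_div_assoc', ← mul_assoc (Fintype.card (Cell T) : ℝ)]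
    gcongr
    calc _ ≤ a₂ := by rw [ha₂]; gcongr
      _ ≤ _ := by linarith
  · gcongr; linarith
  · gcongr; linarith

/-- The linear part of the numerator. -/
def linPart {n : ℕ} {Ω : Type*} [MeasurableSpace Ω] (P : Measure Ω) (Q : Path T → ℝ)
    (D : Panel n T Ω) (π' : Fin n → Path T → ℝ) (m' : Fin n → Fin T → ℝ) (τ : ℝ) (ω : Ω) : ℝ :=
  form τ (D.limMean P Q π' m') (D.limCell Q π' m' ω - D.limMean P Q π' m')
    + form τ (D.limCell Q π' m' ω - D.limMean P Q π' m') (D.limMean P Q π' m')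

/-- The numerator `Γ_θ (Γ_wy - τ Γ_ww) - Γ_wᵀ (Γ_y - τ Γ_w)`. -/
def numer {n : ℕ} {Ω : Type*} (Q : Path T → ℝ) (D : Panel n T Ω) (πh : PropEst n T Ω)
    (mh : OutEst n T Ω) (τ : ℝ) (ω : Ω) : ℝ :=
  form τ (D.avgCell Q πh mh ω) (D.avgCell Q πh mh ω)

lemma aebdd_numer (n : ℕ) (τ : ℝ) :
    AEBdd (P n) fun ω => (D n).numer Q (πh n) (mh n) τ ω :=
  AEBdd.form (R n).aebdd_avgCell (R n).aebdd_avgCell τ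

lemma aebdd_linPart (n : ℕ) (τ : ℝ) :
    AEBdd (P n) fun ω => (D n).linPart (P n) Q (π' n) (m' n) τ ω := by
  unfold linPart
  set g := (D n).limMean (P n) Q (π' n) (m' n)
  set s : Ω n → Cell T → ℝ := fun ω => (D n).limCell Q (π' n) (m' n) ω - g with hs
  have hg : ∀ k, AEBdd (P n) fun _ => g k := fun k => AEBdd.const _
  have h : ∀ k, AEBdd (P n) fun ω => s ω k := fun k =>
    ((R n).limit.aebdd_avgCell k).sub (hg k)
  exact (AEBdd.form hg h τ).add (AEBdd.form h hg τ)

lemma exists_form_bound_date {ξ : Fin T → ℝ} (hξ : IsTimeWeight ξ) :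
    ∃ C, 0 ≤ C ∧ ∀ n (x y : Cell T → ℝ),
      |form ((D n).date (P n) ξ) x y| ≤ C * ‖x‖ * ‖y‖ := by
  obtain ⟨C, hC0, hC⟩ := exists_form_bound T
  have hM := (R 0).one_le_M
  refine ⟨C * (1 + 2 * M), by positivity, fun n x y => (hC _ x y).trans ?_⟩
  gcongr
  exact (R n).abs_date_le hξ

/-- Collects the four pieces of the expansion: the bias gives δ̄_π δ̄_y, both terms involving the
estimates give √Δ/√n, and the squared noise gives 1/n. -/
lemma exists_linearization_bound (hK : ∃ B, ∀ n, K n ≤ B) {ξ : Fin T → ℝ} (hξ : IsTimeWeight ξ)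
    (hDATE : DATEEquation Q ξ) : ∃ A, 0 ≤ A ∧ ∀ n, 0 < n →
      ∫ ω, |(D n).numer Q (πh n) (mh n) ((D n).date (P n) ξ) ω
        - (D n).linPart (P n) Q (π' n) (m' n) ((D n).date (P n) ξ) ω| ∂(P n)
      ≤ A * ((D n).avgDeltaProp (P n) (πh n) * (D n).avgDeltaOut (P n) ξ (mh n)
        + √(avgDisc (P n) S (πh n) (mh n) (π' n) (m' n)) / √n + 1 / n) := by
  obtain ⟨A, hA0, hA⟩ := exists_moment_bounds R hK
  obtain ⟨C, hC0, hC⟩ := exists_form_bound_date R hξ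
  have hM := (R 0).one_le_M
  have hc := (R 0).c_pos
  set a₀ : ℝ := (4 + 8 * T) * (1 / c) * (√(Fintype.card (Path T) * (1 / c) ^ 3) * √(2 * T))
  have p₀ : 0 ≤ a₀ := by positivity
  refine ⟨a₀ + (2 * C * A + 2 * C * (3 * M * (1 / c)) * √A) + C * A, by positivity,
    fun n hn => ?_⟩
  obtain ⟨h₁, h₂, h₃, h₄, -⟩ := hA n hn
  have hb := (R n).integral_abs_form_avgCellMean_le hn hξ hDATE
  have h := (R n).integral_abs_form_sub_le hC0 (hC n) h₁ h₂ h₃ h₄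
  set δ := (D n).avgDeltaProp (P n) (πh n) * (D n).avgDeltaOut (P n) ξ (mh n)
  set Δ := avgDisc (P n) S (πh n) (mh n) (π' n) (m' n) with hΔ
  have hδ : 0 ≤ δ := mul_nonneg (Real.sqrt_nonneg _) (Real.sqrt_nonneg _)
  have e1 : √(A * Δ) * √(A / n) = A * (√Δ / √n) := by
    rw [Real.sqrt_mul hA0, Real.sqrt_div hA0]
    calc √A * √Δ * (√A / √n) = (√A * √A) * (√Δ / √n) := by ring
      _ = _ := by rw [Real.mul_self_sqrt hA0]
  have e2 : √(A * Δ / n) = √A * (√Δ / √n) := by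
    rw [mul_div_assoc, Real.sqrt_mul hA0, Real.sqrt_div' _ (Nat.cast_nonneg n)]
  have e3 : C * (A / n) = C * A * (1 / n) := by ring
  rw [e1, e2, e3] at h
  refine h.trans ?_
  have q1 : 0 ≤ √Δ / √n := by positivity
  have q2 : (0 : ℝ) ≤ 1 / n := by positivity
  set b₁ := 2 * C * A + 2 * C * (3 * M * (1 / c)) * √A with hb₁
  have p₁ : 0 ≤ b₁ := by positivity
  have p₂ : 0 ≤ C * A := by positivity
  have r1 := mul_nonneg p₀ q1
  have r2 := mul_nonneg p₀ q2
  have r3 := mul_nonneg p₁ hδ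
  have r4 := mul_nonneg p₁ q2
  have r5 := mul_nonneg p₂ hδ
  have r6 := mul_nonneg p₂ q1
  have r7 : 2 * C * (A * (√Δ / √n)) + 2 * C * (3 * M * (1 / c)) * (√A * (√Δ / √n))
      = b₁ * (√Δ / √n) := by rw [hb₁]; ring
  linarith

variable (hΔ : Tendsto (fun n => avgDisc (P n) S (πh n) (mh n) (π' n) (m' n)) atTop (𝓝 0))

omit R in
include hΔ in
omit [∀ n, IsProbabilityMeasure (P n)] in
lemma tendsto_sqrt_avgDisc :
    Tendsto (fun n => √(avgDisc (P n) S (πh n) (mh n) (π' n) (m' n))) atTop (𝓝 0) := by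
  simpa using hΔ.sqrt

omit R [∀ n, MeasurableSpace (Ω n)] in
lemma tendsto_inv_sqrt_natCast : Tendsto (fun n : ℕ => 1 / √(n : ℝ)) atTop (𝓝 0) := by
  have := tendsto_inv_atTop_zero.comp (Real.tendsto_sqrt_atTop.comp
    (tendsto_natCast_atTop_atTop (R := ℝ)))
  simpa [Function.comp_def] using this

include hΔ in
-- After multiplication by √n the remainder is √n δ̄_π δ̄_y + √Δ + 1/√n up to a constant, and
-- Markov's inequality concludes.
lemma tendstoZeroInProb_numer_sub_linPart (hK : ∃ B, ∀ n, K n ≤ B) {ξ : Fin T → ℝ}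
    (hξ : IsTimeWeight ξ) (hDATE : DATEEquation Q ξ)
    (hδ : (fun n => (D n).avgDeltaProp (P n) (πh n) * (D n).avgDeltaOut (P n) ξ (mh n))
        =o[atTop] fun n : ℕ => 1 / Real.sqrt n) :
    TendstoZeroInProb P fun n ω => √n * ((D n).numer Q (πh n) (mh n) ((D n).date (P n) ξ) ω
        - (D n).linPart (P n) Q (π' n) (m' n) ((D n).date (P n) ξ) ω) := by
  obtain ⟨A, hA0, hA⟩ := exists_linearization_bound R hK hξ hDATE
  have hint : ∀ n, AEBdd (P n) fun ω => √n * ((D n).numer Q (πh n) (mh n) ((D n).date (P n) ξ) ω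
        - (D n).linPart (P n) Q (π' n) (m' n) ((D n).date (P n) ξ) ω) := fun n =>
    ((aebdd_numer R n _).sub (aebdd_linPart R n _)).const_mul _
  refine TendstoZeroInProb.of_integral (a := fun n : ℕ => A *
    ((D n).avgDeltaProp (P n) (πh n) * (D n).avgDeltaOut (P n) ξ (mh n) / (1 / √n)
      + √(avgDisc (P n) S (πh n) (mh n) (π' n) (m' n)) + 1 / √n))
    (Eventually.of_forall fun n => (hint n).integrable) ?_ ?_
  · filter_upwards [eventually_gt_atTop 0] with n hn
    have hn' : (0 : ℝ) < n := by exact_mod_cast hn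
    have hs : 0 < √(n : ℝ) := Real.sqrt_pos.2 hn'
    simp_rw [abs_mul, abs_of_pos hs]
    rw [integral_const_mul]
    refine (mul_le_mul_of_nonneg_left (hA n hn) hs.le).trans (le_of_eq ?_)
    have e : √(n : ℝ) * (1 / n) = 1 / √n := by
      rw [mul_one_div, div_eq_div_iff hn'.ne' hs.ne', Real.mul_self_sqrt hn'.le, one_mul]
    rw [mul_left_comm]
    congr 1
    rw [mul_add, mul_add, e, mul_div_cancel₀ _ hs.ne', div_div_eq_mul_div, div_one,
      mul_comm (√(n : ℝ))]
  · have h1 := hδ.tendsto_div_nhds_zero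
    have := ((h1.add (tendsto_sqrt_avgDisc hΔ)).add tendsto_inv_sqrt_natCast).const_mul A
    simpa using this

include hΔ in
-- For consistency the linear part needs no limit law: it is bounded by a multiple of the norm of
-- the noise s, whose second moment is of order 1/n.
lemma tendstoZeroInProb_numer (hK : ∃ B, ∀ n, K n ≤ B) {ξ : Fin T → ℝ}
    (hξ : IsTimeWeight ξ) (hDATE : DATEEquation Q ξ)
    (hδ : (fun n => (D n).avgDeltaProp (P n) (πh n) * (D n).avgDeltaOut (P n) ξ (mh n))
        =o[atTop] fun _ => (1 : ℝ)) :
    TendstoZeroInProb P fun n ω => (D n).numer Q (πh n) (mh n) ((D n).date (P n) ξ) ω := by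
  obtain ⟨A, hA0, hA⟩ := exists_linearization_bound R hK hξ hDATE
  obtain ⟨A', hA0', hA'⟩ := exists_moment_bounds R hK
  obtain ⟨C, hC0, hC⟩ := exists_form_bound_date R hξ
  have hM := (R 0).one_le_M
  have hc := (R 0).c_pos
  have h1 : TendstoZeroInProb P fun n ω => (D n).numer Q (πh n) (mh n) ((D n).date (P n) ξ) ω
        - (D n).linPart (P n) Q (π' n) (m' n) ((D n).date (P n) ξ) ω := by
    refine TendstoZeroInProb.of_integral (Eventually.of_forall fun n =>
      ((aebdd_numer R n _).sub (aebdd_linPart R n _)).integrable)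
      ((eventually_gt_atTop 0).mono hA) ?_
    have e1 := hδ.tendsto_div_nhds_zero
    simp only [div_one] at e1
    have e2 := (tendsto_sqrt_avgDisc hΔ).mul tendsto_inv_sqrt_natCast
    have e3 := tendsto_one_div_atTop_nhds_zero_nat (𝕜 := ℝ)
    have := ((e1.add e2).add e3).const_mul A
    simpa [div_eq_mul_inv] using this
  have hs : TendstoZeroInProb P fun n ω =>
      ‖(D n).limCell Q (π' n) (m' n) ω - (D n).limMean (P n) Q (π' n) (m' n)‖ := by
    refine TendstoZeroInProb.of_integral_sq (a := fun n => A' / n) (fun n =>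
      AEBdd.norm_pi fun k => ((R n).limit.aebdd_avgCell k).sub (AEBdd.const _))
      ((eventually_gt_atTop 0).mono fun n hn => (hA' n hn).2.1) ?_
    exact tendsto_const_div_atTop_nhds_zero_nat A'
  have h2 : TendstoZeroInProb P fun n ω =>
      (D n).linPart (P n) Q (π' n) (m' n) ((D n).date (P n) ξ) ω := by
    refine (hs.const_mul (2 * C * (3 * M * (1 / c)))).mono (Eventually.of_forall fun n =>
      ae_of_all _ fun ω => ?_)
    rw [abs_of_nonneg (show 0 ≤ 2 * C * (3 * M * (1 / c)) * ‖(D n).limCell Q (π' n) (m' n) ω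
      - (D n).limMean (P n) Q (π' n) (m' n)‖ by positivity)]
    unfold linPart
    have hg := (R n).norm_limMean_le
    set g := (D n).limMean (P n) Q (π' n) (m' n)
    set s := (D n).limCell Q (π' n) (m' n) ω - g
    have e1 := hC n g s
    have e2 := hC n s g
    have e3 : C * ‖g‖ * ‖s‖ ≤ C * (3 * M * (1 / c)) * ‖s‖ := by gcongr
    have e4 : C * ‖s‖ * ‖g‖ = C * ‖g‖ * ‖s‖ := by ring
    rw [e4] at e2
    refine (abs_add_le _ _).trans ?_
    linarith
  refine (h1.add h2).mono (Eventually.of_forall fun n => ae_of_all _ fun ω => ?_)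
  rw [sub_add_cancel]

lemma tendstoZeroInProb_norm_avgCell_sub_avgCellMean (hK : ∃ B, ∀ n, K n ≤ B) :
    TendstoZeroInProb P fun n ω =>
      ‖(D n).avgCell Q (πh n) (mh n) ω - (D n).avgCellMean (P n) Q (πh n) (mh n) ω‖ := by
  obtain ⟨A, hA0, hA⟩ := exists_moment_bounds R hK
  exact TendstoZeroInProb.of_integral_sq (a := fun n => A / n) (fun n =>
    AEBdd.norm_pi fun k => ((R n).aebdd_avgCell k).sub ((R n).aebdd_avgCellMean k))
    ((eventually_gt_atTop 0).mono fun n hn => (hA n hn).1) (tendsto_const_div_atTop_nhds_zero_nat A)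

include hΔ in
lemma tendstoZeroInProb_norm_avgCell_sub_limMean (hK : ∃ B, ∀ n, K n ≤ B) :
    TendstoZeroInProb P fun n ω =>
      ‖(D n).avgCell Q (πh n) (mh n) ω - (D n).limMean (P n) Q (π' n) (m' n)‖ := by
  obtain ⟨A, hA0, hA⟩ := exists_moment_bounds R hK
  have h : TendstoZeroInProb P fun n ω => ‖(D n).avgCellMean (P n) Q (πh n) (mh n) ω
      - (D n).limMean (P n) Q (π' n) (m' n)‖ := by
    refine TendstoZeroInProb.of_integral_sq (fun n =>
      AEBdd.norm_pi fun k => ((R n).aebdd_avgCellMean k).sub (AEBdd.const _))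
      ((eventually_gt_atTop 0).mono fun n hn => (hA n hn).2.2.2.1) ?_
    simpa using hΔ.const_mul A
  refine ((tendstoZeroInProb_norm_avgCell_sub_avgCellMean R hK).add h).mono
    (Eventually.of_forall fun n => ae_of_all _ fun ω => ?_)
  rw [abs_norm, abs_of_nonneg (by positivity)]
  exact norm_sub_le_norm_sub_add_norm_sub _ _ _

/-- The two paths with different centered versions keep masses bounded below in the cell average, up
to noise of vanishing size, and `le_formW` turns these masses into a lower bound for 𝒟. -/
lemma exists_tendsto_measure_denom_lt (hK : ∃ B, ∀ n, K n ≤ B) (hS : IsOverlapSet S) :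
    ∃ κ > 0, Tendsto (fun n => P n {ω | (D n).denom Q (πh n) ω < κ}) atTop (𝓝 0) := by
  obtain ⟨w₁, hw₁, w₂, hw₂, hne, hpos⟩ := exists_pair_of_isOverlapSet hS
  have hc := (R 0).c_pos
  have hQ₁ := (R 0).reshaped.1 w₁ hw₁
  have hQ₂ := (R 0).reshaped.1 w₂ hw₂
  -- The mean cell of w is at least c Π(w), as π_i(w) > c and π̂_i(w) ≤ 1. Halving leaves room for
  -- noise of size q.
  set q := min (c * Q w₁) (c * Q w₂) / 2 with hq
  have hq0 : 0 < q := by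
    have : 0 < min (c * Q w₁) (c * Q w₂) := lt_min (by positivity) (by positivity)
    positivity
  have hq1 : 2 * q ≤ c * Q w₁ := by
    have := min_le_left (c * Q w₁) (c * Q w₂); linarith
  have hq2 : 2 * q ≤ c * Q w₂ := by
    have := min_le_right (c * Q w₁) (c * Q w₂); linarith
  refine ⟨q * q * ∑ t, (center w₁.vec t - center w₂.vec t) ^ 2, by positivity, ?_⟩
  refine tendsto_of_tendsto_of_tendsto_of_le_of_le' tendsto_const_nhds
    (tendstoZeroInProb_norm_avgCell_sub_avgCellMean R hK q hq0)
    (Eventually.of_forall fun n => zero_le) ?_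
  filter_upwards [eventually_gt_atTop 0] with n hn
  have hn' : (0 : ℝ) < n := by exact_mod_cast hn
  refine measure_mono_ae ?_
  filter_upwards [ae_all_iff.2 (R n).est_mem, ae_all_iff.2 (R n).est_gt] with ω h1 h2
    (hω : (D n).denom Q (πh n) ω < _)
  change q < |‖(D n).avgCell Q (πh n) (mh n) ω - (D n).avgCellMean (P n) Q (πh n) (mh n) ω‖|
  by_contra hcon
  rw [not_lt, abs_norm] at hcon
  have hmean : ∀ w ∈ S, c * Q w ≤ (D n).avgCellMean (P n) Q (πh n) (mh n) ω (w, none) := by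
    intro w hw
    unfold avgCellMean
    rw [le_div_iff₀ hn']
    calc c * Q w * n = ∑ _i : Fin n, c * Q w := by simp [mul_comm]
      _ ≤ _ := Finset.sum_le_sum fun i _ => by
        simp only [cellMean, Option.elim, mul_one]
        have a1 := (R n).prop_gt i w hw
        have a2 : 0 < πh n i ω w := hc.trans (h2 i w hw)
        have a3 : Q w ≤ Q w / πh n i ω w := by
          rw [le_div_iff₀ a2]
          exact mul_le_of_le_one_right ((R n).Q_nonneg w) (h1 i w).2
        exact mul_le_mul a1.le a3 ((R n).Q_nonneg w) (Regular.prop_nonneg i w)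
  have hcell : ∀ w ∈ S, 2 * q ≤ c * Q w → q ≤ (D n).avgCell Q (πh n) (mh n) ω (w, none) := by
    intro w hw hqw
    have a1 := norm_le_pi_norm ((D n).avgCell Q (πh n) (mh n) ω
      - (D n).avgCellMean (P n) Q (πh n) (mh n) ω) (w, none)
    rw [Pi.sub_apply, Real.norm_eq_abs] at a1
    have a2 := (abs_le.1 (a1.trans hcon)).1
    have a3 := hmean w hw
    linarith
  have hnn : ∀ w, 0 ≤ (D n).avgCell Q (πh n) (mh n) ω (w, none) := fun w => by
    refine div_nonneg (Finset.sum_nonneg fun i _ => ?_) hn'.le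
    unfold cell
    split_ifs
    · simp only [Option.elim, mul_one]
      exact div_nonneg ((R n).Q_nonneg w) (h1 i w).1
    · exact le_rfl
  have hle := le_formW hnn w₁ w₂ hne
  rw [formW_avgCell] at hle
  have : q * q * ∑ t, (center w₁.vec t - center w₂.vec t) ^ 2
      ≤ (D n).avgCell Q (πh n) (mh n) ω (w₁, none) * (D n).avgCell Q (πh n) (mh n) ω (w₂, none)
        * ∑ t, (center w₁.vec t - center w₂.vec t) ^ 2 := by
    gcongr
    · exact hnn w₁
    · exact hcell w₁ hw₁ hq1
    · exact hcell w₂ hw₂ hq2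
  linarith

omit R [∀ n, IsProbabilityMeasure (P n)] [∀ n, MeasurableSpace (Ω n)] in
lemma denom_mul_sub {n : ℕ} {Ω : Type*} {D : Panel n T Ω} {πh : PropEst n T Ω}
    {mh : OutEst n T Ω} {ω : Ω} {τ : ℝ} (h : D.IsEstimate Q πh mh ω τ) (hT : 0 < T) (τ₀ : ℝ) :
    D.denom Q πh ω * (τ - τ₀) = D.numer Q πh mh τ₀ ω := by
  rw [mul_sub, h.denom_mul hT, numer, form_apply, formW_avgCell]
  ring

lemma tendstoZeroInProb_estimate_sub (hK : ∃ B, ∀ n, K n ≤ B) (hS : IsOverlapSet S)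
    {τh : ∀ n, Ω n → ℝ} (hT : 0 < T)
    (hτh : ∀ n, ∀ᵐ ω ∂(P n), (D n).IsEstimate Q (πh n) (mh n) ω (τh n ω)) {τ₀ : ℕ → ℝ}
    (hN : TendstoZeroInProb P fun n ω => (D n).numer Q (πh n) (mh n) (τ₀ n) ω) :
    TendstoZeroInProb P fun n ω => τh n ω - τ₀ n := by
  obtain ⟨κ, hκ, hd⟩ := exists_tendsto_measure_denom_lt R hK hS
  refine TendstoZeroInProb.of_measure_le hd hN fun ε hε => ⟨κ * ε, by positivity,
    Eventually.of_forall fun n => ?_⟩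
  filter_upwards [hτh n] with ω h h1 h2
  have h1' : κ ≤ (D n).denom Q (πh n) ω := not_lt.1 h1
  rw [← denom_mul_sub h hT, abs_mul, abs_of_pos (hκ.trans_le h1')] at h2
  have h3 : κ * |τh n ω - τ₀ n| ≤ κ * ε :=
    (mul_le_mul_of_nonneg_right h1' (abs_nonneg _)).trans h2
  exact le_of_mul_le_mul_left h3 hκ

end Sequence

end Panel

/-! ### Empirical variances -/

section EmpVar

variable {n : ℕ}

/-- The empirical variance with denominator `n`. -/
def empVar (x : Fin n → ℝ) : ℝ := (∑ i, (x i - (∑ j, x j) / n) ^ 2) / n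

lemma empVar_eq (x : Fin n → ℝ) : empVar x = (∑ i, x i ^ 2) / n - ((∑ i, x i) / n) ^ 2 := by
  rcases Nat.eq_zero_or_pos n with rfl | hn
  · simp [empVar]
  have hn' : (n : ℝ) ≠ 0 := by exact_mod_cast hn.ne'
  unfold empVar
  set m := (∑ j, x j) / n with hm
  have h1 : ∑ i, x i = n * m := by rw [hm]; field_simp
  simp_rw [sub_sq, Finset.sum_add_distrib, Finset.sum_sub_distrib, ← Finset.sum_mul,
    ← Finset.mul_sum, h1]
  simp only [Finset.sum_const, Finset.card_univ, Fintype.card_fin, nsmul_eq_mul]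
  field_simp
  ring

lemma empVar_le (x : Fin n → ℝ) : empVar x ≤ (∑ i, x i ^ 2) / n := by
  rw [empVar_eq]; linarith [sq_nonneg ((∑ i, x i) / n)]

/-- Young's inequality for each pair of deviations, by completing the square; the empirical variance
of the difference is then at most its mean square. Only this lower bound is needed for coverage. -/
lemma le_empVar_add {η : ℝ} (h0 : 0 < η) (x y : Fin n → ℝ) :
    (1 - η) * empVar y ≤ empVar x + 1 / η * ((∑ i, (x i - y i) ^ 2) / n) := by
  have h1 : (1 - η) * empVar y ≤ empVar x + 1 / η * empVar (fun i => x i - y i) := by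
    unfold empVar
    rw [mul_div_assoc', mul_div_assoc', ← add_div, Finset.mul_sum, Finset.mul_sum,
      ← Finset.sum_add_distrib]
    gcongr with i
    rw [Finset.sum_sub_distrib, sub_div]
    set a := x i - (∑ j, x j) / n with ha
    set b := y i - (∑ j, y j) / n with hb
    have e : x i - y i - ((∑ j, x j) / n - (∑ j, y j) / n) = a - b := by rw [ha, hb]; ring
    rw [e]
    have e2 : a ^ 2 + 1 / η * (a - b) ^ 2 - (1 - η) * b ^ 2
        = (1 / η) * (a - b + η * b) ^ 2 + (a - b) ^ 2 := by
      field_simp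
      ring
    have : 0 ≤ (1 / η) * (a - b + η * b) ^ 2 + (a - b) ^ 2 := by positivity
    linarith
  refine h1.trans ?_
  gcongr
  exact empVar_le _

end EmpVar

/-! ### Studentized sums of independent bounded random variables -/

section Studentized

variable {Ω : ℕ → Type*} [∀ n, MeasurableSpace (Ω n)] {P : ∀ n, Measure (Ω n)}
  [∀ n, IsProbabilityMeasure (P n)]

lemma tendstoZeroInProb_avg_centered {V : ∀ n, Fin n → Ω n → ℝ} {B : ℝ}
    (hV : ∀ n i, Measurable (V n i)) (hind : ∀ n, iIndepFun (V n) (P n))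
    (hB : ∀ n i, ∀ᵐ ω ∂(P n), |V n i ω| ≤ B) :
    TendstoZeroInProb P fun n ω => (∑ i, (V n i ω - ∫ ω', V n i ω' ∂(P n))) / n := by
  have hb : ∀ n i, AEBdd (P n) (V n i) := fun n i => ⟨hV n i, B, hB n i⟩
  have hm : ∀ n i, |∫ ω', V n i ω' ∂(P n)| ≤ B := fun n i => by
    have := norm_integral_le_of_norm_le_const (μ := P n) (f := V n i) (C := B)
      (by simpa using hB n i)
    simpa using this
  refine TendstoZeroInProb.of_integral_sq (a := fun n => (2 * B) ^ 2 / n)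
    (fun n => (AEBdd.sum _ fun i => (hb n i).sub (AEBdd.const _)).div_const _) ?_
    (tendsto_const_div_atTop_nhds_zero_nat _)
  filter_upwards [eventually_gt_atTop 0] with n hn
  have hn' : (n : ℝ) ≠ 0 := by exact_mod_cast hn.ne'
  -- The weak law is the cross-fitting bound with a single fold and constant out-of-fold factors.
  have := integral_sq_avg_mul_le (P := P n) (Z := V n) (hV n) (hind n) (fun _ => (0 : Fin 1))
    (u := fun i ω => V n i ω - ∫ ω', V n i ω' ∂(P n)) (v := fun _ _ => 1) (U := 2 * B)
    (fun i => (comap_measurable (V n i)).sub_const _) (fun i => measurable_const)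
    (fun i => by
      filter_upwards [hB n i] with ω h
      exact (abs_sub _ _).trans (by linarith [hm n i]))
    (fun i => AEBdd.const 1)
    (fun i => by
      rw [integral_sub (hb n i).integrable (integrable_const _)]
      simp)
  simpa [hn'] using this

/-- The empirical variance of independent bounded variables is asymptotically no smaller than
their average variance. -/
lemma exists_le_empVar_add {V : ∀ n, Fin n → Ω n → ℝ} {B : ℝ}
    (hV : ∀ n i, Measurable (V n i)) (hind : ∀ n, iIndepFun (V n) (P n))
    (hB : ∀ n i, ∀ᵐ ω ∂(P n), |V n i ω| ≤ B) (hB0 : 0 ≤ B) :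
    ∃ E : ∀ n, Ω n → ℝ, TendstoZeroInProb P E ∧ ∀ n, ∀ᵐ ω ∂(P n),
      (∑ i, Var[V n i; P n]) / n ≤ empVar (fun i => V n i ω) + E n ω := by
  have hb : ∀ n i, AEBdd (P n) (V n i) := fun n i => ⟨hV n i, B, hB n i⟩
  have hm : ∀ n i, |∫ ω', V n i ω' ∂(P n)| ≤ B := fun n i => by
    have := norm_integral_le_of_norm_le_const (μ := P n) (f := V n i) (C := B)
      (by simpa using hB n i)
    simpa using this
  have hsq := tendstoZeroInProb_avg_centered (P := P) (V := fun n i ω => V n i ω ^ 2)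
    (B := B ^ 2) (fun n i => (hV n i).pow_const 2)
    (fun n => (hind n).comp (fun _ x => x ^ 2) fun _ => measurable_id.pow_const 2)
    (fun n i => by
      filter_upwards [hB n i] with ω h
      rw [abs_pow]
      gcongr)
  have hav := tendstoZeroInProb_avg_centered hV hind hB
  set E1 : ∀ n, Ω n → ℝ := fun n ω => (∑ i, (V n i ω ^ 2 - ∫ ω', V n i ω' ^ 2 ∂(P n))) / n
    with hE1
  set E2 : ∀ n, Ω n → ℝ := fun n ω => (∑ i, (V n i ω - ∫ ω', V n i ω' ∂(P n))) / n with hE2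
  have h1 : TendstoZeroInProb P fun n ω => |E1 n ω| :=
    hsq.mono (Eventually.of_forall fun n => ae_of_all _ fun ω => (abs_abs _).le)
  have h2 : TendstoZeroInProb P fun n ω => |E2 n ω| :=
    hav.mono (Eventually.of_forall fun n => ae_of_all _ fun ω => (abs_abs _).le)
  refine ⟨fun n ω => |E1 n ω| + 2 * B * |E2 n ω|, h1.add (h2.const_mul _), fun n => ?_⟩
  filter_upwards [ae_all_iff.2 (hB n)] with ω h
  set μ : Fin n → ℝ := fun i => ∫ ω', V n i ω' ∂(P n) with hμ
  have hvar : ∀ i, Var[V n i; P n] = (∫ ω', V n i ω' ^ 2 ∂(P n)) - μ i ^ 2 := fun i => by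
    rw [variance_eq_sub (MemLp.of_bound (hV n i).aestronglyMeasurable B (by simpa using hB n i))]
    simp [hμ]
  have e1 : E1 n ω = (∑ i, V n i ω ^ 2) / n - (∑ i, ∫ ω', V n i ω' ^ 2 ∂(P n)) / n := by
    rw [hE1]; simp only [Finset.sum_sub_distrib, sub_div]
  have e2 : E2 n ω = (∑ i, V n i ω) / n - (∑ i, μ i) / n := by
    rw [hE2]; simp only [Finset.sum_sub_distrib, sub_div]; rfl
  rw [empVar_eq]
  simp_rw [hvar, Finset.sum_sub_distrib, sub_div]
  -- The source of conservatism: the spread of the unequal means enters the empirical variance with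
  -- a nonnegative sign.
  have hj : ((∑ i, μ i) / n) ^ 2 ≤ (∑ i, μ i ^ 2) / n := by
    have := empVar_eq μ
    have h0 : 0 ≤ empVar μ := div_nonneg (Finset.sum_nonneg fun i _ => sq_nonneg _)
      (Nat.cast_nonneg n)
    linarith
  set a := (∑ i, V n i ω) / n with ha
  set b := (∑ i, μ i) / n with hb'
  have ha' : |a| ≤ B := Panel.Regular.abs_avg_le hB0 h
  have hb'' : |b| ≤ B := Panel.Regular.abs_avg_le hB0 (hm n)
  have h3 : a ^ 2 - b ^ 2 ≤ 2 * B * |E2 n ω| := by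
    rw [e2]
    calc a ^ 2 - b ^ 2 ≤ |(a + b) * (a - b)| := by
          rw [show a ^ 2 - b ^ 2 = (a + b) * (a - b) by ring]; exact le_abs_self _
      _ = |a + b| * |a - b| := abs_mul _ _
      _ ≤ _ := by
        gcongr
        exact (abs_add_le _ _).trans (by linarith)
  have h4 := neg_abs_le (E1 n ω)
  linarith

/-- The shrunken intervals increase to the open interval (-z, z), which has the same Gaussian mass
as the closed one. The shift by 3 makes the loss 1/(k + 3) smaller than 1/2 for all k. -/
lemma tendsto_measure_Icc_gaussianReal {z : ℝ} (hz : 0 < z) :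
    Tendsto (fun k : ℕ => gaussianReal 0 1
      (Set.Icc (-((1 - 2 * (1 / ((k : ℝ) + 3))) * z)) ((1 - 2 * (1 / ((k : ℝ) + 3))) * z))) atTop
      (𝓝 (gaussianReal 0 1 (Set.Icc (-z) z))) := by
  have := nullSingletonClass_gaussianReal (μ := 0) one_ne_zero
  have ht : Tendsto (fun k : ℕ => (1 - 2 * (1 / ((k : ℝ) + 3))) * z) atTop (𝓝 z) := by
    have h1 : Tendsto (fun k : ℕ => 1 / ((k : ℝ) + 3)) atTop (𝓝 0) :=
      tendsto_const_nhds.div_atTop (tendsto_atTop_add_const_right _ _ tendsto_natCast_atTop_atTop)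
    simpa using ((h1.const_mul 2).const_sub 1).mul_const z
  have hlt : ∀ k : ℕ, (1 - 2 * (1 / ((k : ℝ) + 3))) * z < z := fun k => by
    have : (0 : ℝ) < 1 / ((k : ℝ) + 3) := by positivity
    nlinarith
  have hmono : Monotone fun k : ℕ => (1 - 2 * (1 / ((k : ℝ) + 3))) * z := fun k l h => by
    have : 1 / ((l : ℝ) + 3) ≤ 1 / ((k : ℝ) + 3) := by
      have : (k : ℝ) ≤ l := by exact_mod_cast h
      gcongr
    beta_reduce
    gcongr
  have hun : ⋃ k : ℕ, Set.Icc (-((1 - 2 * (1 / ((k : ℝ) + 3))) * z))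
      ((1 - 2 * (1 / ((k : ℝ) + 3))) * z) = Set.Ioo (-z) z := by
    ext x
    simp only [Set.mem_iUnion, ← abs_le, Set.mem_Icc, Set.mem_Ioo, ← abs_lt]
    refine ⟨fun ⟨k, h⟩ => h.trans_lt (hlt k), fun h => ?_⟩
    exact ((ht.eventually (lt_mem_nhds h)).exists).imp fun k hk => hk.le
  have := tendsto_measure_iUnion_atTop (μ := gaussianReal 0 1)
    (s := fun k : ℕ => Set.Icc (-((1 - 2 * (1 / ((k : ℝ) + 3))) * z))
      ((1 - 2 * (1 / ((k : ℝ) + 3))) * z))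
    fun k l h => Set.Icc_subset_Icc (neg_le_neg (hmono h)) (hmono h)
  rw [hun, measure_congr (Ioo_ae_eq_Icc (μ := gaussianReal 0 1))] at this
  exact this

/-- A one-sided Slutsky argument. The average variance need not converge, so the sum is normalized
by its own standard deviation. Outside three events of vanishing probability, the linearization
error and the deficit of the estimated standard deviation each cost a fraction θ of the width;
finally θ tends to zero. -/
theorem le_liminf_measure_abs_le {V : ∀ n, Fin n → Ω n → ℝ} {B ν₀ : ℝ}
    (hV : ∀ n i, Measurable (V n i)) (hind : ∀ n, iIndepFun (V n) (P n))
    (hB : ∀ n i, ∀ᵐ ω ∂(P n), |V n i ω| ≤ B) (hB0 : 0 ≤ B) (hν₀ : 0 < ν₀)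
    (hν : ∀ᶠ n : ℕ in atTop, ν₀ ≤ (∑ i, Var[V n i; P n]) / n) {N : ∀ n, Ω n → ℝ}
    (hN : TendstoZeroInProb P fun n ω =>
      √n * (N n ω - (∑ i, (V n i ω - ∫ ω', V n i ω' ∂(P n))) / n))
    {Vh : ∀ n, Fin n → Ω n → ℝ}
    (hVh : TendstoZeroInProb P fun n ω => (∑ i, (Vh n i ω - V n i ω) ^ 2) / n) {z : ℝ}
    (hz : 0 < z) :
    gaussianReal 0 1 (Set.Icc (-z) z) ≤ liminf (fun n : ℕ => P n {ω | √n * |N n ω| ≤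
      z * √((∑ i, (Vh n i ω - (∑ j, Vh n j ω) / n) ^ 2) / ((n : ℝ) - 1))}) atTop := by
  have hb : ∀ n i, AEBdd (P n) (V n i) := fun n i => ⟨hV n i, B, hB n i⟩
  have hm : ∀ n i, |∫ ω', V n i ω' ∂(P n)| ≤ B := fun n i => by
    have := norm_integral_le_of_norm_le_const (μ := P n) (f := V n i) (C := B)
      (by simpa using hB n i)
    simpa using this
  obtain ⟨E, hE, hEle⟩ := exists_le_empVar_add hV hind hB hB0
  set s : ℕ → ℝ := fun n => √((∑ i, Var[V n i; P n]) / n) with hs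
  set L : ∀ n, Ω n → ℝ := fun n ω => (∑ i, (V n i ω - ∫ ω', V n i ω' ∂(P n))) / n with hL
  -- the central limit theorem
  have hclt : ∀ a, Tendsto (fun n => P n {ω | √n * |L n ω| ≤ a * s n}) atTop
      (𝓝 (gaussianReal 0 1 (Set.Icc (-a) a))) := fun a => by
    have h := tendsto_measure_abs_sum_le (P := P)
      (X := fun n i ω => (V n i ω - ∫ ω', V n i ω' ∂(P n)) / (s n * √n))
      (fun n i => ((hV n i).sub_const _).div_const _)
      (fun n => (hind n).comp (fun i x => (x - ∫ ω', V n i ω' ∂(P n)) / (s n * √n))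
        fun i => (measurable_id.sub_const _).div_const _)
      -- A centered term is at most 2B, and the normalization is at least √ν₀ √n.
      (b := fun n => 2 * B / √ν₀ * (1 / √n))
      (by simpa using Panel.tendsto_inv_sqrt_natCast.const_mul (2 * B / √ν₀))
      (by
        filter_upwards [hν, eventually_gt_atTop 0] with n hn h0 i
        filter_upwards [hB n i] with ω hω
        have h0' : (0 : ℝ) < √n := Real.sqrt_pos.2 (by exact_mod_cast h0)
        have hs0 : √ν₀ ≤ s n := Real.sqrt_le_sqrt hn
        have hν' : 0 < √ν₀ := Real.sqrt_pos.2 hν₀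
        rw [abs_div, abs_of_pos (mul_pos (hν'.trans_le hs0) h0'), div_mul_div_comm, mul_one]
        have h3 : |V n i ω - ∫ ω', V n i ω' ∂(P n)| ≤ 2 * B :=
          (abs_sub _ _).trans (by linarith [hm n i])
        gcongr)
      (fun n i => by
        rw [integral_div, integral_sub (hb n i).integrable (integrable_const _)]
        simp)
      (by
        filter_upwards [hν, eventually_gt_atTop 0] with n hn h0
        have h0' : (0 : ℝ) < n := by exact_mod_cast h0
        have hpos := hν₀.trans_le hn
        simp_rw [div_pow, integral_div, ← variance_eq_integral (hV n _).aemeasurable]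
        rw [← Finset.sum_div, mul_pow, Real.sq_sqrt hpos.le, Real.sq_sqrt h0'.le,
          div_mul_cancel₀ _ h0'.ne', div_self]
        intro h
        rw [h, zero_div] at hpos
        exact lt_irrefl _ hpos) a
    refine h.congr' ?_
    filter_upwards [hν, eventually_gt_atTop 0] with n hn h0
    have h0' : (0 : ℝ) < n := by exact_mod_cast h0
    have hq : (0 : ℝ) < √n := Real.sqrt_pos.2 h0'
    have hs0 : 0 < s n := Real.sqrt_pos.2 (hν₀.trans_le hn)
    congr 1
    ext ω
    simp only [Set.mem_ofPred_eq, hL]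
    rw [← Finset.sum_div, abs_div, abs_of_pos (mul_pos hs0 hq), div_le_iff₀ (mul_pos hs0 hq),
      abs_div, Nat.abs_cast]
    nth_rewrite 3 [← Real.mul_self_sqrt h0'.le]
    rw [← mul_div_assoc, mul_div_mul_left _ _ hq.ne', div_le_iff₀ hq, mul_assoc]
  -- comparison for a fixed loss `θ`
  have hθ : ∀ θ, 0 < θ → θ < 1 / 2 →
      gaussianReal 0 1 (Set.Icc (-((1 - 2 * θ) * z)) ((1 - 2 * θ) * z))
        ≤ liminf (fun n : ℕ => P n {ω | √n * |N n ω| ≤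
          z * √((∑ i, (Vh n i ω - (∑ j, Vh n j ω) / n) ^ 2) / ((n : ℝ) - 1))}) atTop := by
    intro θ h0 h1
    -- Replacing V by its estimate and the average variance by the empirical one leaves the fraction
    -- (1 - η)² - η of the variance, which is at least 1 - 3η = 1 - θ ≥ (1 - θ)².
    set η := θ / 3 with hη
    have hη0 : 0 < η := by positivity
    have hν' : 0 < √ν₀ := Real.sqrt_pos.2 hν₀
    have hbad : Tendsto (fun n : ℕ =>
        P n {ω | θ * z * √ν₀ < |√n * (N n ω - L n ω)|} + (P n {ω | η * ν₀ < |E n ω|}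
          + P n {ω | η ^ 2 * ν₀ < |(∑ i, (Vh n i ω - V n i ω) ^ 2) / n|})) atTop (𝓝 0) := by
      simpa only [add_zero] using (hN (θ * z * √ν₀) (by positivity)).add
        ((hE (η * ν₀) (by positivity)).add (hVh (η ^ 2 * ν₀) (by positivity)))
    -- Adding the vanishing probability of the bad events does not change the lower limit.
    rw [← (hclt ((1 - 2 * θ) * z)).liminf_eq, ← ENNReal.liminf_add_of_right_tendsto_zero hbad
      (fun n : ℕ => P n {ω | √n * |N n ω| ≤
        z * √((∑ i, (Vh n i ω - (∑ j, Vh n j ω) / n) ^ 2) / ((n : ℝ) - 1))})]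
    refine liminf_le_liminf ?_
    filter_upwards [hν, eventually_gt_atTop 1] with n hn hn1
    have hn1' : (1 : ℝ) < n := by exact_mod_cast hn1
    refine LE.le.trans (measure_mono_ae ?_) ((measure_union_le _ _).trans (add_le_add le_rfl
      ((measure_union_le _ _).trans (add_le_add le_rfl (measure_union_le _ _)))))
    filter_upwards [hEle n] with ω hω (hLω : _ ≤ _)
    by_contra hc
    have hc' : ¬ (√n * |N n ω| ≤ z * √((∑ i, (Vh n i ω - (∑ j, Vh n j ω) / n) ^ 2)
          / ((n : ℝ) - 1)) ∨ θ * z * √ν₀ < |√n * (N n ω - L n ω)| ∨ η * ν₀ < |E n ω|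
          ∨ η ^ 2 * ν₀ < |(∑ i, (Vh n i ω - V n i ω) ^ 2) / n|) := hc
    simp only [not_or, not_lt] at hc'
    obtain ⟨c1, c2, c3, c4⟩ := hc'
    refine c1 ?_
    set v := (∑ i, Var[V n i; P n]) / n with hv
    have hv0 : 0 < v := hν₀.trans_le hn
    have hsn : s n = √v := rfl
    have hsq : √ν₀ ≤ s n := Real.sqrt_le_sqrt hn
    have k1 : (1 - θ) ^ 2 * v ≤ empVar fun i => Vh n i ω := by
      have j1 := le_empVar_add hη0 (fun i => Vh n i ω) (fun i => V n i ω)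
      have j2 : (1 - η) * v ≤ empVar fun i => V n i ω := by
        have : E n ω ≤ η * v := (le_abs_self _).trans (c3.trans (by gcongr))
        linarith
      have j3 : 1 / η * ((∑ i, (Vh n i ω - V n i ω) ^ 2) / n) ≤ η * v := by
        have : (∑ i, (Vh n i ω - V n i ω) ^ 2) / n ≤ η ^ 2 * v :=
          (le_abs_self _).trans (c4.trans (by gcongr))
        calc _ ≤ 1 / η * (η ^ 2 * v) := by gcongr
          _ = _ := by field_simp
      have j4 : (1 - η) * ((1 - η) * v) ≤ (1 - η) * empVar fun i => V n i ω :=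
        mul_le_mul_of_nonneg_left j2 (by linarith)
      have hθη : θ = 3 * η := by rw [hη]; ring
      have j5 : (1 - θ) ^ 2 * v ≤ (1 - 3 * η) * v := by
        refine mul_le_mul_of_nonneg_right ?_ hv0.le
        rw [hθη]; nlinarith
      have j6 : 0 ≤ η ^ 2 * v := by positivity
      nlinarith
    have k2 : (1 - θ) * s n
        ≤ √((∑ i, (Vh n i ω - (∑ j, Vh n j ω) / n) ^ 2) / ((n : ℝ) - 1)) := by
      refine Real.le_sqrt_of_sq_le ?_
      rw [mul_pow, hsn, Real.sq_sqrt hv0.le]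
      -- Dividing by n - 1 instead of n only enlarges the estimate.
      refine k1.trans (div_le_div_of_nonneg_left (Finset.sum_nonneg fun i _ => sq_nonneg _)
        (by linarith) (by linarith))
    have k3 : √(n : ℝ) * |N n ω| ≤ √n * |L n ω| + |√n * (N n ω - L n ω)| := by
      rw [abs_mul, abs_of_nonneg (Real.sqrt_nonneg _), ← mul_add]
      refine mul_le_mul_of_nonneg_left ?_ (Real.sqrt_nonneg _)
      have := abs_add_le (L n ω) (N n ω - L n ω)
      rwa [add_sub_cancel] at this
    calc √(n : ℝ) * |N n ω| ≤ (1 - 2 * θ) * z * s n + θ * z * s n := by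
          refine k3.trans (add_le_add hLω (c2.trans ?_))
          gcongr
      _ = z * ((1 - θ) * s n) := by ring
      _ ≤ _ := by gcongr
  refine le_of_tendsto (tendsto_measure_Icc_gaussianReal hz) (Eventually.of_forall fun k => ?_)
  refine hθ _ (by positivity) ?_
  rw [div_lt_div_iff₀ (by positivity) (by norm_num)]
  linarith [(Nat.cast_nonneg k : (0 : ℝ) ≤ k)]

end Studentized

/-! ### Normal quantiles -/

lemma cdf_gaussianReal_zero : cdf (gaussianReal 0 1) 0 = 1 / 2 := by
  rw [cdf_eq_real]
  have := nullSingletonClass_gaussianReal (μ := 0) one_ne_zero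
  have h1 : (gaussianReal 0 1).map (fun x => -x) = gaussianReal 0 1 := by
    rw [gaussianReal_map_neg, neg_zero]
  have h2 : (gaussianReal 0 1).real (Set.Ici 0) = (gaussianReal 0 1).real (Set.Iic 0) := by
    nth_rewrite 1 [← h1]
    rw [map_measureReal_apply measurable_neg measurableSet_Ici]
    simp
  have h3 : (gaussianReal 0 1).real (Set.Ioi 0) = (gaussianReal 0 1).real (Set.Ici 0) :=
    measureReal_congr Ioi_ae_eq_Ici
  have h4 := probReal_compl_eq_one_sub (μ := gaussianReal 0 1) (measurableSet_Iic (a := (0 : ℝ)))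
  rw [Set.compl_Iic, h3, h2] at h4
  linarith

/-- The infimum defining the quantile is attained because a distribution function is
right-continuous. Nonemptiness and boundedness below of the set come from the limits 1 and 0 at
infinity. -/
lemma normalQuantile_spec {p : ℝ} (h0 : 0 < p) (h1 : p < 1) :
    p ≤ cdf (gaussianReal 0 1) (normalQuantile p) := by
  set F := cdf (gaussianReal 0 1)
  have hne : {x : ℝ | p ≤ F x}.Nonempty :=
    ((tendsto_cdf_atTop (gaussianReal 0 1)).eventually (lt_mem_nhds h1)).exists.imp
      fun x hx => hx.le
  have hbd : BddBelow {x : ℝ | p ≤ F x} := by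
    obtain ⟨y, hy⟩ := ((tendsto_cdf_atBot (gaussianReal 0 1)).eventually (gt_mem_nhds h0)).exists
    exact ⟨y, fun x hx => le_of_lt (not_le.1 fun h => absurd (hx.trans (F.mono h)) (not_le.2 hy))⟩
  have hc := (F.right_continuous (normalQuantile p)).tendsto
  refine ge_of_tendsto (hc.mono_left (nhdsWithin_mono _ Set.Ioi_subset_Ici_self)) ?_
  filter_upwards [self_mem_nhdsWithin] with x hx
  obtain ⟨y, hy, hyx⟩ := (csInf_lt_iff hbd hne).1 (show sInf {x : ℝ | p ≤ F x} < x from hx)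
  exact le_trans hy (F.mono hyx.le)

lemma normalQuantile_pos {p : ℝ} (h0 : 1 / 2 < p) (h1 : p < 1) : 0 < normalQuantile p := by
  by_contra h
  have := normalQuantile_spec (by linarith) h1
  have h2 := (cdf (gaussianReal 0 1)).mono (not_lt.1 h)
  rw [cdf_gaussianReal_zero] at h2
  linarith

/-- Each of the two tails has mass at most α/2, the lower one by symmetry. -/
lemma ofReal_le_gaussianReal_Icc {α : ℝ} (h0 : 0 < α) (h1 : α < 1) :
    ENNReal.ofReal (1 - α) ≤ gaussianReal 0 1
      (Set.Icc (-normalQuantile (1 - α / 2)) (normalQuantile (1 - α / 2))) := by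
  set z := normalQuantile (1 - α / 2)
  have hz : 0 < z := normalQuantile_pos (by linarith) (by linarith)
  have hs : 1 - α / 2 ≤ cdf (gaussianReal 0 1) z := normalQuantile_spec (by linarith) (by linarith)
  rw [cdf_eq_real] at hs
  have e1 : (gaussianReal 0 1).map (fun x => -x) = gaussianReal 0 1 := by
    rw [gaussianReal_map_neg, neg_zero]
  have e2 : (gaussianReal 0 1).real (Set.Iio (-z)) = (gaussianReal 0 1).real (Set.Ioi z) := by
    nth_rewrite 1 [← e1]
    rw [map_measureReal_apply measurable_neg measurableSet_Iio]
    simp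
  have e3 := probReal_compl_eq_one_sub (μ := gaussianReal 0 1) (measurableSet_Iic (a := z))
  rw [Set.compl_Iic] at e3
  have e4 : (gaussianReal 0 1).real (Set.Iic z)
      ≤ (gaussianReal 0 1).real (Set.Icc (-z) z) + (gaussianReal 0 1).real (Set.Iio (-z)) := by
    refine (measureReal_mono fun x (hx : x ≤ z) => ?_).trans (measureReal_union_le _ _)
    rcases lt_or_ge x (-z) with h | h
    · exact Or.inr h
    · exact Or.inl ⟨h, hx⟩
  rw [← ENNReal.ofReal_toReal (measure_ne_top (gaussianReal 0 1) (Set.Icc (-z) z))]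
  refine ENNReal.ofReal_le_ofReal ?_
  change _ ≤ (gaussianReal 0 1).real _
  linarith

lemma TendstoZeroInProb.sq {Ω : ℕ → Type*} [∀ n, MeasurableSpace (Ω n)]
    {P : ∀ n, Measure (Ω n)} {X : ∀ n, Ω n → ℝ} (hX : TendstoZeroInProb P X) :
    TendstoZeroInProb P fun n ω => X n ω ^ 2 :=
  of_measure_le (s := fun _ => ∅) (by simp) hX fun ε hε => ⟨√ε, Real.sqrt_pos.2 hε,
    Eventually.of_forall fun n => ae_of_all _ fun ω _ h => by
      rw [abs_pow, ← Real.sq_sqrt hε.le]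
      gcongr⟩

/-! ### Influence terms -/

/-- The influence of a unit as a linear function of its cells. -/
def score {T : ℕ} (τ : ℝ) (g : Cell T → ℝ) : (Cell T → ℝ) →ₗ[ℝ] ℝ :=
  form τ g + (form τ).flip g

lemma score_apply {T : ℕ} (τ : ℝ) (g x : Cell T → ℝ) :
    score τ g x = form τ g x + form τ x g := rfl

lemma measurable_linearMap {ι : Type*} [Fintype ι] (ℓ : (ι → ℝ) →ₗ[ℝ] ℝ) : Measurable ℓ :=
  (LinearMap.continuous_of_finiteDimensional ℓ).measurable

lemma integral_linearMap {Ω ι : Type*} [MeasurableSpace Ω] [Fintype ι] [DecidableEq ι]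
    {P : Measure Ω} [IsProbabilityMeasure P] {X : Ω → ι → ℝ} (hX : ∀ k, AEBdd P fun ω => X ω k)
    (ℓ : (ι → ℝ) →ₗ[ℝ] ℝ) : ∫ ω, ℓ (X ω) ∂P = ℓ fun k => ∫ ω, X ω k ∂P := by
  have e := LinearMap.pi_apply_eq_sum_univ ℓ
  simp only [smul_eq_mul] at e
  rw [e, funext fun ω => e (X ω), integral_finsetSum _ fun k _ => ((hX k).mul_const _).integrable]
  simp_rw [integral_mul_const]

lemma abs_score_sub_le {T : ℕ} {C Cw b τ τ₀ : ℝ} (hC0 : 0 ≤ C) (hCw0 : 0 ≤ Cw)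
    (hC : ∀ x y : Cell T → ℝ, |form τ₀ x y| ≤ C * ‖x‖ * ‖y‖)
    (hCw : ∀ x y : Cell T → ℝ, |formW x y| ≤ Cw * ‖x‖ * ‖y‖) {G g x y : Cell T → ℝ}
    (hG : ‖G‖ ≤ b) (hg : ‖g‖ ≤ b) (hx : ‖x‖ ≤ b) :
    |score τ G x - score τ₀ g y|
      ≤ 2 * Cw * b ^ 2 * |τ - τ₀| + 2 * C * b * ‖G - g‖ + 2 * C * b * ‖x - y‖ := by
  have hb : 0 ≤ b := (norm_nonneg _).trans hG
  have e : score τ G x - score τ₀ g y = -((τ - τ₀) * (formW G x + formW x G))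
      + (form τ₀ (G - g) x + form τ₀ x (G - g))
      + (form τ₀ g (x - y) + form τ₀ (x - y) g) := by
    simp only [score_apply, map_sub, LinearMap.sub_apply, form_apply]
    ring
  rw [e]
  have h1 : |formW G x + formW x G| ≤ 2 * Cw * b ^ 2 := by
    have a1 : |formW G x| ≤ Cw * b * b := (hCw G x).trans (by gcongr)
    have a2 : |formW x G| ≤ Cw * b * b := (hCw x G).trans (by gcongr)
    refine (abs_add_le _ _).trans ?_
    linarith
  have h2 : |form τ₀ (G - g) x + form τ₀ x (G - g)| ≤ 2 * C * b * ‖G - g‖ := by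
    have a1 : |form τ₀ (G - g) x| ≤ C * ‖G - g‖ * b := (hC _ x).trans (by gcongr)
    have a2 : |form τ₀ x (G - g)| ≤ C * b * ‖G - g‖ := (hC x _).trans (by gcongr)
    refine (abs_add_le _ _).trans ?_
    linarith
  have h3 : |form τ₀ g (x - y) + form τ₀ (x - y) g| ≤ 2 * C * b * ‖x - y‖ := by
    have a1 : |form τ₀ g (x - y)| ≤ C * b * ‖x - y‖ := (hC g _).trans (by gcongr)
    have a2 : |form τ₀ (x - y) g| ≤ C * ‖x - y‖ * b := (hC _ g).trans (by gcongr)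
    refine (abs_add_le _ _).trans ?_
    linarith
  refine (abs_add_le _ _).trans (add_le_add ((abs_add_le _ _).trans (add_le_add ?_ h2)) h3)
  rw [abs_neg, abs_mul, mul_comm]
  gcongr

namespace Panel

namespace Regular

variable {n T K : ℕ} {Ω : Type*} [MeasurableSpace Ω]
  {P : Measure Ω} [IsProbabilityMeasure P] {D : Panel n T Ω} {S : Finset (Path T)}
  {Q : Path T → ℝ} {fold : Fin n → Fin K} {πh : PropEst n T Ω} {mh : OutEst n T Ω}
  {π' : Fin n → Path T → ℝ} {m' : Fin n → Fin T → ℝ} {c M : ℝ}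
  (R : D.Regular P S Q fold πh mh π' m' c M)

include R

lemma integral_avgCell_eq_limMean :
    (fun k => ∫ ω, D.avgCell Q (fun i _ => π' i) (fun i _ => m' i) ω k ∂P)
      = D.limMean P Q π' m' := by
  obtain ⟨ω₀⟩ := nonempty_of_isProbabilityMeasure P
  exact funext fun k => R.integral_avgCell_limit k ω₀

/-- With deterministic estimates, the expected Γ's are the same linear functions evaluated at the
mean cell average. So V_i is a fixed linear functional of the cells of unit i, which yields
measurability, boundedness and independence across units. -/
lemma V_limit_eq (ξ : Fin T → ℝ) (i : Fin n) (ω : Ω) :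
    D.V Q P ξ (fun i _ => π' i) (fun i _ => m' i) i ω
      = score (D.date P ξ) (D.limMean P Q π' m')
        (D.cell Q (fun i _ => π' i) (fun i _ => m' i) i ω) := by
  have h : ∀ ℓ : (Cell T → ℝ) →ₗ[ℝ] ℝ,
      ∫ ω, ℓ (D.avgCell Q (fun i _ => π' i) (fun i _ => m' i) ω) ∂P
        = ℓ (D.limMean P Q π' m') := fun ℓ => by
    rw [integral_linearMap R.limit.aebdd_avgCell, R.integral_avgCell_eq_limMean]
  rw [score_apply, ← infl_eq, ← h, ← h, ← h]
  simp_rw [← fun t => h (fw t), ← fun t => h (fy t), fθ_avgCell, fww_avgCell, fwy_avgCell,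
    fw_avgCell, fy_avgCell]
  rfl

lemma measurable_V_limit (ξ : Fin T → ℝ) (i : Fin n) :
    Measurable (D.V Q P ξ (fun i _ => π' i) (fun i _ => m' i) i) := by
  simp_rw [funext fun ω => R.V_limit_eq ξ i ω]
  exact (measurable_linearMap _).comp (measurable_pi_iff.2 fun k => R.limit.measurable_cell i k)

lemma iIndepFun_V_limit (ξ : Fin T → ℝ) :
    iIndepFun (D.V Q P ξ (fun i _ => π' i) (fun i _ => m' i)) P := by
  have h := R.indep.comp (fun i z => score (D.date P ξ) (D.limMean P Q π' m')
    (fun k : Cell T => if z.2 = k.1 then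
      Q k.1 / π' i k.1 * k.2.elim 1 fun t => z.1 (k.1 t) t - m' i t else 0)) fun i => by
    refine (measurable_linearMap _).comp (measurable_pi_iff.2 fun k => ?_)
    refine Measurable.ite (measurable_snd (measurableSet_singleton k.1)) ?_ measurable_const
    rcases k with ⟨w, _ | t⟩
    · simp only [Option.elim]
      exact measurable_const
    · simp only [Option.elim]
      fun_prop
  convert h using 1
  ext i ω
  exact R.V_limit_eq ξ i ω

lemma integral_V_limit (ξ : Fin T → ℝ) (i : Fin n) :
    ∫ ω, D.V Q P ξ (fun i _ => π' i) (fun i _ => m' i) i ω ∂P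
      = score (D.date P ξ) (D.limMean P Q π' m') (D.cellMean P Q i (π' i) (m' i)) := by
  simp_rw [R.V_limit_eq]
  rw [integral_linearMap (R.limit.aebdd_cell i)]
  simp_rw [R.integral_cell_limit]

/-- Identifies the linear part of the numerator as an average of independent centered variables, the
form in which the central limit theorem applies. -/
lemma linPart_eq (ξ : Fin T → ℝ) (ω : Ω) :
    D.linPart P Q π' m' (D.date P ξ) ω
      = (∑ i, (D.V Q P ξ (fun i _ => π' i) (fun i _ => m' i) i ω
        - ∫ ω', D.V Q P ξ (fun i _ => π' i) (fun i _ => m' i) i ω' ∂P)) / n := by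
  simp_rw [R.integral_V_limit, R.V_limit_eq, ← map_sub]
  rw [← map_sum, div_eq_inv_mul, ← smul_eq_mul, ← map_smul, score_apply, linPart]
  have : D.limCell Q π' m' ω - D.limMean P Q π' m' = (n : ℝ)⁻¹ • ∑ i,
      (D.cell Q (fun i _ => π' i) (fun i _ => m' i) i ω - D.cellMean P Q i (π' i) (m' i)) := by
    ext k
    simp [limCell, limMean, avgCell, div_eq_inv_mul, Finset.sum_sub_distrib, mul_sub]
  rw [this]

lemma abs_V_limit_le {ξ : Fin T → ℝ} {C : ℝ} (hC0 : 0 ≤ C)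
    (hC : ∀ x y : Cell T → ℝ, |form (D.date P ξ) x y| ≤ C * ‖x‖ * ‖y‖) (i : Fin n) :
    ∀ᵐ ω ∂P, |D.V Q P ξ (fun i _ => π' i) (fun i _ => m' i) i ω|
      ≤ 2 * C * (3 * M * (1 / c)) ^ 2 := by
  have hg := R.norm_limMean_le
  filter_upwards [R.limit.norm_cell_le i] with ω h
  rw [R.V_limit_eq, score_apply]
  set g := D.limMean P Q π' m'
  set x := D.cell Q (fun i _ => π' i) (fun i _ => m' i) i ω
  set b := 3 * M * (1 / c)
  have hb : 0 ≤ b := (norm_nonneg _).trans hg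
  have a1 : |form (D.date P ξ) g x| ≤ C * b * b := (hC _ _).trans (by gcongr)
  have a2 : |form (D.date P ξ) x g| ≤ C * b * b := (hC _ _).trans (by gcongr)
  refine (abs_add_le _ _).trans ?_
  linarith

omit R [MeasurableSpace Ω] in
-- Multiplying the Wald inequality by 𝒟 > 0 turns coverage into a bound on the studentized
-- numerator, so the random denominator needs no limit.
lemma _root_.RIPW.Panel.mem_waldInterval {τ τ₀ α κ : ℝ} {ω : Ω} (hn : 0 < n) (hκ : 0 < κ)
    (hd : κ ≤ D.denom Q πh ω) (hN : D.denom Q πh ω * (τ - τ₀) = D.numer Q πh mh τ₀ ω)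
    (h : √n * |D.numer Q πh mh τ₀ ω|
      ≤ normalQuantile (1 - α / 2) * D.sigmaHat Q πh mh τ ω) :
    τ₀ ∈ D.waldInterval Q πh mh τ α ω := by
  have hd0 := hκ.trans_le hd
  have hs : 0 < √(n : ℝ) := Real.sqrt_pos.2 (by exact_mod_cast hn)
  have h1 : |τ - τ₀| ≤ normalQuantile (1 - α / 2) * D.sigmaHat Q πh mh τ ω
      / (√n * D.denom Q πh ω) := by
    rw [le_div_iff₀ (mul_pos hs hd0)]
    rw [← hN, abs_mul, abs_of_pos hd0] at h
    linarith
  rw [abs_le] at h1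
  constructor <;> linarith

end Regular

/-! ### Plug-in influence terms and coverage along the sequence. -/

section Sequence

variable {T : ℕ} {Ω : ℕ → Type*} [∀ n, MeasurableSpace (Ω n)] {P : ∀ n, Measure (Ω n)}
  [∀ n, IsProbabilityMeasure (P n)] {D : ∀ n, Panel n T (Ω n)} {S : Finset (Path T)}
  {Q : Path T → ℝ} {K : ℕ → ℕ} {fold : ∀ n, Fin n → Fin (K n)} {πh : ∀ n, PropEst n T (Ω n)}
  {mh : ∀ n, OutEst n T (Ω n)} {π' : ∀ n, Fin n → Path T → ℝ} {m' : ∀ n, Fin n → Fin T → ℝ}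
  {c M : ℝ}
  (R : ∀ n, (D n).Regular (P n) S Q (fold n) (πh n) (mh n) (π' n) (m' n) c M)
  (hΔ : Tendsto (fun n => avgDisc (P n) S (πh n) (mh n) (π' n) (m' n)) atTop (𝓝 0))

include R hΔ

lemma tendstoZeroInProb_avg_norm_cell_sub (hK : ∃ B, ∀ n, K n ≤ B) :
    TendstoZeroInProb P fun n ω => (∑ i, ‖(D n).cell Q (πh n) (mh n) i ω
      - (D n).cell Q (fun i _ => π' n i) (fun i _ => m' n i) i ω‖ ^ 2) / n := by
  obtain ⟨A, hA0, hA⟩ := exists_moment_bounds R hK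
  have hb : ∀ n i, AEBdd (P n) fun ω => ‖(D n).cell Q (πh n) (mh n) i ω
      - (D n).cell Q (fun i _ => π' n i) (fun i _ => m' n i) i ω‖ ^ 2 := fun n i =>
    (AEBdd.norm_pi fun k => ((R n).aebdd_cell i k).sub ((R n).limit.aebdd_cell i k)).pow 2
  refine TendstoZeroInProb.of_integral
    (a := fun n => A * avgDisc (P n) S (πh n) (mh n) (π' n) (m' n))
    (Eventually.of_forall fun n => ((AEBdd.sum _ (hb n)).div_const _).integrable) ?_
    (by simpa using hΔ.const_mul A)
  filter_upwards [eventually_gt_atTop 0] with n hn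
  have : ∀ ω, |(∑ i, ‖(D n).cell Q (πh n) (mh n) i ω
      - (D n).cell Q (fun i _ => π' n i) (fun i _ => m' n i) i ω‖ ^ 2) / (n : ℝ)|
      = (∑ i, ‖(D n).cell Q (πh n) (mh n) i ω
      - (D n).cell Q (fun i _ => π' n i) (fun i _ => m' n i) i ω‖ ^ 2) / (n : ℝ) := fun ω =>
    abs_of_nonneg (by positivity)
  simp_rw [this]
  rw [integral_div, integral_finsetSum _ fun i _ => (hb n i).integrable]
  exact (hA n hn).2.2.2.2

/-- The plug-in term differs from V_i through the estimated effect, the cell average and the cells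
of the unit. The first two errors are common to all units and vanish in probability; the third is
controlled only in mean square over units, which is all that the empirical variance requires. -/
lemma tendstoZeroInProb_avg_sq_Vhat_sub (hK : ∃ B, ∀ n, K n ≤ B) {ξ : Fin T → ℝ}
    (hξ : IsTimeWeight ξ) {τh : ∀ n, Ω n → ℝ}
    (hτ : TendstoZeroInProb P fun n ω => τh n ω - (D n).date (P n) ξ) :
    TendstoZeroInProb P fun n ω => (∑ i, ((D n).Vhat Q (πh n) (mh n) (τh n ω) i ω
      - (D n).V Q (P n) ξ (fun i _ => π' n i) (fun i _ => m' n i) i ω) ^ 2) / n := by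
  obtain ⟨C, hC0, hC⟩ := exists_form_bound_date R hξ
  obtain ⟨Cw, hCw0, hCw⟩ := exists_bilin_bound (formW (T := T))
  set b := 3 * M * (1 / c)
  have h1 := hτ.sq.const_mul (3 * (2 * Cw * b ^ 2) ^ 2)
  have h2 := (tendstoZeroInProb_norm_avgCell_sub_limMean R hΔ hK).sq.const_mul
    (3 * (2 * C * b) ^ 2)
  have h3 := (tendstoZeroInProb_avg_norm_cell_sub R hΔ hK).const_mul (3 * (2 * C * b) ^ 2)
  refine ((h1.add h2).add h3).mono ?_
  filter_upwards [eventually_gt_atTop 0] with n hn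
  have hn' : (0 : ℝ) < n := by exact_mod_cast hn
  filter_upwards [(R n).norm_avgCell_le, ae_all_iff.2 fun i => (R n).norm_cell_le i] with ω hG hx
  rw [abs_of_nonneg (by positivity), abs_of_nonneg (by positivity), div_le_iff₀ hn']
  set δ := τh n ω - (D n).date (P n) ξ with hδ
  set u := ‖(D n).avgCell Q (πh n) (mh n) ω - (D n).limMean (P n) Q (π' n) (m' n)‖ with hu
  have key : ∀ i, ((D n).Vhat Q (πh n) (mh n) (τh n ω) i ω
      - (D n).V Q (P n) ξ (fun i _ => π' n i) (fun i _ => m' n i) i ω) ^ 2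
      ≤ 3 * (2 * Cw * b ^ 2) ^ 2 * δ ^ 2 + 3 * (2 * C * b) ^ 2 * u ^ 2
        + 3 * (2 * C * b) ^ 2 * ‖(D n).cell Q (πh n) (mh n) i ω
          - (D n).cell Q (fun i _ => π' n i) (fun i _ => m' n i) i ω‖ ^ 2 := fun i => by
    rw [Vhat_eq, ← score_apply, (R n).V_limit_eq, ← sq_abs]
    have h := abs_score_sub_le (τ := τh n ω) hC0 hCw0 (hC n) hCw hG (R n).norm_limMean_le (hx i)
      (y := (D n).cell Q (fun i _ => π' n i) (fun i _ => m' n i) i ω)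
    refine (pow_le_pow_left₀ (abs_nonneg _) h 2).trans ?_
    rw [← hδ, ← hu, ← sq_abs δ]
    set p := 2 * Cw * b ^ 2 * |δ|
    set q := 2 * C * b * u
    set r := 2 * C * b * ‖(D n).cell Q (πh n) (mh n) i ω
          - (D n).cell Q (fun i _ => π' n i) (fun i _ => m' n i) i ω‖
    calc (p + q + r) ^ 2 ≤ 3 * p ^ 2 + 3 * q ^ 2 + 3 * r ^ 2 := by
          nlinarith [sq_nonneg (p - q), sq_nonneg (p - r), sq_nonneg (q - r)]
      _ = _ := by ring
  refine (Finset.sum_le_sum fun i _ => key i).trans (le_of_eq ?_)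
  rw [Finset.sum_add_distrib, ← Finset.mul_sum]
  simp only [Finset.sum_const, Finset.card_univ, Fintype.card_fin, nsmul_eq_mul]
  field_simp

theorem le_liminf_measure_mem_waldInterval (hK : ∃ B, ∀ n, K n ≤ B) (hS : IsOverlapSet S)
    (hT : 0 < T) {ξ : Fin T → ℝ} (hξ : IsTimeWeight ξ) (hDATE : DATEEquation Q ξ)
    {τh : ∀ n, Ω n → ℝ}
    (hτh : ∀ n, ∀ᵐ ω ∂(P n), (D n).IsEstimate Q (πh n) (mh n) ω (τh n ω))
    (hδ : (fun n => (D n).avgDeltaProp (P n) (πh n) * (D n).avgDeltaOut (P n) ξ (mh n))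
        =o[atTop] fun n : ℕ => 1 / Real.sqrt n) {ν₀ : ℝ} (hν₀ : 0 < ν₀)
    (hν : ∀ᶠ n : ℕ in atTop, ν₀ ≤ (∑ i, variance
      ((D n).V Q (P n) ξ (fun i _ => π' n i) (fun i _ => m' n i) i) (P n)) / n)
    {α : ℝ} (hα : α ∈ Set.Ioo (0 : ℝ) 1) :
    ENNReal.ofReal (1 - α) ≤ liminf (fun n => P n {ω | (D n).date (P n) ξ ∈
      (D n).waldInterval Q (πh n) (mh n) (τh n ω) α ω}) atTop := by
  obtain ⟨C, hC0, hC⟩ := exists_form_bound_date R hξ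
  obtain ⟨κ, hκ, hd⟩ := exists_tendsto_measure_denom_lt R hK hS
  have hδ1 : (fun n => (D n).avgDeltaProp (P n) (πh n) * (D n).avgDeltaOut (P n) ξ (mh n))
      =o[atTop] fun _ => (1 : ℝ) :=
    hδ.trans ((isLittleO_one_iff ℝ).2 tendsto_inv_sqrt_natCast)
  have hτ : TendstoZeroInProb P fun n ω => τh n ω - (D n).date (P n) ξ :=
    tendstoZeroInProb_estimate_sub R hK hS hT hτh
      (tendstoZeroInProb_numer R hΔ hK hξ hDATE hδ1)
  have hN := tendstoZeroInProb_numer_sub_linPart R hΔ hK hξ hDATE hδ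
  simp_rw [fun n ω => (R n).linPart_eq ξ ω] at hN
  have hz : 0 < normalQuantile (1 - α / 2) :=
    normalQuantile_pos (by linarith [hα.2]) (by linarith [hα.1])
  refine (ofReal_le_gaussianReal_Icc hα.1 hα.2).trans ?_
  refine (le_liminf_measure_abs_le (fun n i => (R n).measurable_V_limit ξ i)
    (fun n => (R n).iIndepFun_V_limit ξ) (fun n i => (R n).abs_V_limit_le hC0 (hC n) i)
    (by positivity) hν₀ hν hN (tendstoZeroInProb_avg_sq_Vhat_sub R hΔ hK hξ hτ) hz).trans ?_
  -- Small denominators occur with vanishing probability, so their event may be added without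
  -- affecting the lower limit.
  rw [← ENNReal.liminf_add_of_right_tendsto_zero hd
    (fun n => P n {ω | (D n).date (P n) ξ ∈
      (D n).waldInterval Q (πh n) (mh n) (τh n ω) α ω})]
  refine liminf_le_liminf ?_
  filter_upwards [eventually_gt_atTop 0] with n hn
  refine LE.le.trans (measure_mono_ae ?_) (measure_union_le _ _)
  filter_upwards [hτh n] with ω he (hω : _ ≤ _)
  by_cases h : (D n).denom Q (πh n) ω < κ
  · exact Or.inr h
  · exact Or.inl (mem_waldInterval hn hκ (not_lt.1 h) (denom_mul_sub he hT _) hω)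

end Sequence

end Panel

end

end RIPW

/-! ### Assembly of consistency and coverage. -/

theorem mainTheorem7 {T : ℕ} {Ω : ℕ → Type*} [∀ n, MeasurableSpace (Ω n)]
    (P : ∀ n, Measure (Ω n)) [∀ n, IsProbabilityMeasure (P n)]
    -- the panels of `n` units, `n = 0, 1, 2, …`
    (D : ∀ n, RIPW.Panel n T (Ω n))
    (hY : ∀ n a i, Measurable ((D n).Y a i)) (hW : ∀ n i, Measurable ((D n).W i))
    -- time weights, overlap set, and reshaped distribution solving the DATE equation
    (ξ : Fin T → ℝ) (hξ : RIPW.IsTimeWeight ξ)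
    (S : Finset (RIPW.Path T)) (hS : RIPW.IsOverlapSet S)
    (Q : RIPW.Path T → ℝ) (hQ : RIPW.IsReshaped S Q) (hDATE : RIPW.DATEEquation Q ξ)
    -- estimates from cross-fitting with a bounded number of folds
    (πh : ∀ n, RIPW.PropEst n T (Ω n)) (mh : ∀ n, RIPW.OutEst n T (Ω n))
    (K : ℕ → ℕ) (hK : ∃ B, ∀ n, K n ≤ B) (fold : ∀ n, Fin n → Fin (K n))
    (hcf : ∀ n, (D n).IsCrossFit (fold n) (πh n) (mh n))
    -- the RIPW estimator
    (τh : ∀ n, Ω n → ℝ)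
    (hτh : ∀ n, ∀ᵐ ω ∂(P n), (D n).IsEstimate Q (πh n) (mh n) ω (τh n ω))
    -- latent mean ignorability
    (hign : ∀ n, (D n).LatentMeanIgnorable (P n))
    -- overlap
    (hover : RIPW.Overlap P S πh)
    (hover₀ : RIPW.Overlap P S fun n i _ => (D n).prop (P n) i)
    -- independent units
    (hind : ∀ n, iIndepFun (fun i => (D n).unit i) (P n))
    -- bounded adjusted outcomes
    (hbdd : RIPW.BoundedOutcomes P D mh)
    -- asymptotically deterministic estimates, with one of the two limits correct
    (π' : ∀ n, Fin n → RIPW.Path T → ℝ) (m' : ∀ n, Fin n → Fin T → ℝ)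
    (hover' : RIPW.Overlap P S fun n i _ => π' n i)
    (hbdd' : RIPW.BoundedOutcomes P D fun n i _ => m' n i)
    (r : ℝ) (hr : 0 < r)
    (hlim : (fun n => (D n).limitError (P n) (πh n) (mh n) (π' n) (m' n))
      =O[atTop] fun n : ℕ => (n : ℝ) ^ (-r))
    (hdr : ∀ n, (∀ i, π' n i = (D n).prop (P n) i) ∨ (∀ i, m' n i = (D n).m (P n) i)) :
    -- (i) consistency
    (((fun n => (D n).avgDeltaProp (P n) (πh n) * (D n).avgDeltaOut (P n) ξ (mh n))
        =o[atTop] fun _ => (1 : ℝ)) →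
      ∀ ε > 0, Tendsto (fun n => P n {ω | ε < |τh n ω - (D n).date (P n) ξ|}) atTop (𝓝 0)) ∧
    -- (ii) asymptotic coverage of the Wald interval
    (((fun n => (D n).avgDeltaProp (P n) (πh n) * (D n).avgDeltaOut (P n) ξ (mh n))
        =o[atTop] fun n : ℕ => 1 / Real.sqrt n) →
      1 / 2 < r →
      (∃ ν₀ > 0, ∀ᶠ n : ℕ in atTop,
        ν₀ ≤ (∑ i, variance
          ((D n).V Q (P n) ξ (fun i _ => π' n i) (fun i _ => m' n i) i) (P n)) / n) →
      ∀ α ∈ Set.Ioo (0 : ℝ) 1,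
        ENNReal.ofReal (1 - α) ≤ liminf
          (fun n => P n {ω | (D n).date (P n) ξ ∈
            (D n).waldInterval Q (πh n) (mh n) (τh n ω) α ω}) atTop) := by
  -- With no time periods there is only one path, so none could differ from the all-zero path.
  have hT : 0 < T := by
    obtain ⟨w, -, h, -⟩ := hS.2
    obtain ⟨t, -⟩ := Function.ne_iff.1 h
    exact t.pos
  obtain ⟨hmem, c₁, hc₁, hgt⟩ := hover
  obtain ⟨-, c₂, hc₂, hgt₀⟩ := hover₀
  obtain ⟨hmem', c₃, hc₃, hgt'⟩ := hover'
  obtain ⟨M₁, hM₁⟩ := hbdd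
  obtain ⟨M₂, hM₂⟩ := hbdd'
  -- One overlap constant and one bound serve the estimates, the truth and the limits. The caps c ≤
  -- 1 ≤ M allow powers of 1/c and M to be compared.
  set c := min (min c₁ c₂) (min c₃ 1) with hc
  set M := max (max M₁ M₂) 1 with hM
  have R : ∀ n, (D n).Regular (P n) S Q (fold n) (πh n) (mh n) (π' n) (m' n) c M := fun n =>
    { measurable_Y := hY n
      measurable_W := hW n
      reshaped := hQ
      indep := hind n
      ignorable := hign n
      prop_measurable := (hcf n).prop_measurable
      out_measurable := (hcf n).out_measurable
      c_pos := lt_min (lt_min hc₁ hc₂) (lt_min hc₃ one_pos)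
      c_le := (min_le_right _ _).trans (min_le_right _ _)
      one_le_M := le_max_right _ _
      est_mem := hmem n
      est_gt := fun i => (hgt n i).mono fun ω h w hw =>
        ((min_le_left _ _).trans (min_le_left _ _)).trans_lt (h w hw)
      prop_gt := fun i w hw => by
        -- The inequality is deterministic, and an almost sure statement under a probability measure
        -- holds at some point.
        obtain ⟨_, h⟩ := (hgt₀ n i).exists
        exact ((min_le_left _ _).trans (min_le_right _ _)).trans_lt (h w hw)
      lim_mem := fun i => by
        obtain ⟨_, h⟩ := (hmem' n i).exists
        exact h
      lim_gt := fun i w hw => by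
        obtain ⟨_, h⟩ := (hgt' n i).exists
        exact ((min_le_right _ _).trans (min_le_left _ _)).trans_lt (h w hw)
      bdd := fun i => (hM₁ n i).mono fun ω h a t =>
        (h a t).le.trans ((le_max_left _ _).trans (le_max_left _ _))
      bdd_lim := fun i => (hM₂ n i).mono fun ω h a t =>
        (h a t).le.trans ((le_max_right _ _).trans (le_max_left _ _)) }
  have hlim₀ : Tendsto (fun n => (D n).limitError (P n) (πh n) (mh n) (π' n) (m' n)) atTop
      (𝓝 0) :=
    hlim.trans_tendsto ((tendsto_rpow_neg_atTop hr).comp tendsto_natCast_atTop_atTop)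
  have hΔ : Tendsto (fun n => RIPW.Panel.avgDisc (P n) S (πh n) (mh n) (π' n) (m' n)) atTop
      (𝓝 0) := by
    refine squeeze_zero (fun n => div_nonneg (Finset.sum_nonneg fun i _ =>
      integral_nonneg fun ω => sq_nonneg _) (Nat.cast_nonneg n)) (fun n => (R n).avgDisc_le) ?_
    simpa using hlim₀.const_mul (2 * (Fintype.card (RIPW.Path T) * (1 / c) + T))
  refine ⟨fun hδ => ?_, fun hδ _ ⟨ν₀, hν₀, hν⟩ α hα => ?_⟩
  · exact RIPW.Panel.tendstoZeroInProb_estimate_sub R hK hS hT hτh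
      (RIPW.Panel.tendstoZeroInProb_numer R hΔ hK hξ hDATE hδ)
  · exact RIPW.Panel.le_liminf_measure_mem_waldInterval R hΔ hK hS hT hξ hDATE hτh hδ hν₀ hν hα
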